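/- For a topological space $S$ let $\mathrm{Loop}(S)$ be the set of compact subsets of $S$ homeomorphic to the circle $S^1$, with the topology induced by the Vietoris topology on compact subsets. Let $\{\mu_S\}$ be a family consisting of a positive Borel measure $\mu_S$ on $\mathrm{Loop}(S)$ for each Riemann surface $S$, which satisfies conformal restriction (for each conformal embedding $S_1\to S_2$, the restriction of $\mu_{S_2}$ to $\mathrm{Loop}(S_1)$ equals $\mu_{S_1}$) and which is nontrivial: for some $0<a<A$ the measure of $$\{\gamma\in \mathrm{Loop}(\{0<|z|<A\})\setminus \mathrm{Loop}(\{|z|<a\}):\gamma \text{ surrounds } 0\}$$ is finite and positive. Let $\mu_0$ be the restriction of $\mu_{\mathbb C}$ to the loops in $\mathbb C\setminus\{0\}$ which surround $0$. For a loop $\gamma$ in $\mathbb C\setminus\{0\}$ surrounding $0$, let $U_+\ni 0$ and $U_-\ni\infty$ be the components of $(\mathbb C\cup\{\infty\})\setminus\gamma$. Let $\phi_+:(\{|z|<1\},0)\to(U_+,0)$ and $\phi_-:(\{|z|>1\}\cup\{\infty\},\infty)\to(U_-,\infty)$ be the conformal isomorphisms normalized by $$\phi_+(z)=\rho_0(\gamma)\,u(z),\quad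 u(z)=z\Big(1+\sum_{n\ge1}u_nz^n\Big),\qquad \phi_-(z)=\rho_\infty(\gamma)\,z\Big(1+\sum_{n\ge1}b_nz^{-n}\Big),$$ with $\rho_0(\gamma)>0$ and $\rho_\infty(\gamma)>0$. Then there is a unique nonzero finite measure $\nu_0$ on the space of normalized maps $u$, identified with their coefficient sequences and with the $\sigma$-algebra generated by the coefficients, such that the image of $\mu_0$ under $\gamma\mapsto(u,\rho_\infty)$ is $d\nu_0(u)\times d\rho_\infty/\rho_\infty$. If the family $\{\mu_S\}$ is normalized (by multiplication by a positive constant) so that $\nu_0$ is a probability measure, then for every $n\ge1$ $$\int |u_n|^2\,d\nu_0=\frac1{n+1}.$$ -/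

import Mathlib

open scoped Manifold ContDiff

/-- A Riemann surface: a connected Hausdorff second countable space with a holomorphic atlas of
charts in `ℂ`. -/
structure RiemannSurface : Type 1 where
  carrier : Type
  [top : TopologicalSpace carrier]
  [charted : ChartedSpace ℂ carrier]
  [manifold : IsManifold 𝓘(ℂ) ω carrier]
  [t2 : T2Space carrier]
  [secondCountable : SecondCountableTopology carrier]
  [connected : ConnectedSpace carrier]

namespace RiemannSurface

instance : CoeSort RiemannSurface Type := ⟨RiemannSurface.carrier⟩

attribute [instance] RiemannSurface.top RiemannSurface.charted RiemannSurface.manifold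
  RiemannSurface.t2 RiemannSurface.secondCountable RiemannSurface.connected

/-- The complex plane. -/
noncomputable def plane : RiemannSurface := ⟨ℂ⟩

/-- A conformal embedding of Riemann surfaces: an injective holomorphic map. -/
structure IsConformalEmbedding {S₁ S₂ : RiemannSurface} (f : S₁ → S₂) : Prop where
  holomorphic : MDifferentiable 𝓘(ℂ) 𝓘(ℂ) f
  injective : Function.Injective f

theorem IsConformalEmbedding.continuous {S₁ S₂ : RiemannSurface} {f : S₁ → S₂}
    (hf : IsConformalEmbedding f) : Continuous f :=
  hf.holomorphic.continuous

end RiemannSurface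

/-- `Loop S`: the compact subsets of `S` that are homeomorphic to the circle. The topology is
induced by the Vietoris topology on `Compacts S`. -/
def Loop (S : Type*) [TopologicalSpace S] : Type _ :=
  {K : TopologicalSpace.Compacts S // Nonempty (K ≃ₜ Circle)}

namespace Loop

instance {S : Type*} [TopologicalSpace S] : TopologicalSpace (Loop S) :=
  instTopologicalSpaceSubtype

instance {S : Type*} [TopologicalSpace S] : MeasurableSpace (Loop S) := borel _

instance {S : Type*} [TopologicalSpace S] : BorelSpace (Loop S) := ⟨rfl⟩

/-- The set of points of a loop. -/
def toSet {S : Type*} [TopologicalSpace S] (γ : Loop S) : Set S := (γ.1 : Set S)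

/-- The image of a loop under an injective continuous map. -/
def map {S T : Type*} [TopologicalSpace S] [TopologicalSpace T] [T2Space T] (f : S → T)
    (hc : Continuous f) (hi : Function.Injective f) (γ : Loop S) : Loop T :=
  ⟨γ.1.map f hc, by
    obtain ⟨e⟩ := γ.2
    have hK : CompactSpace (γ.1 : Set S) := isCompact_iff_compactSpace.mp γ.1.isCompact
    have hemb : Topology.IsEmbedding (fun x : (γ.1 : Set S) => f x) :=
      ((hc.comp continuous_subtype_val).isClosedEmbedding
        (hi.comp Subtype.val_injective)).isEmbedding
    have hr : Set.range (fun x : (γ.1 : Set S) => f x) = (γ.1.map f hc : Set T) := by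
      ext y
      simp
    exact ⟨((hemb.toHomeomorph.trans (Homeomorph.setCongr hr)).symm).trans e⟩⟩

/-- The loop `γ` surrounds the point `z`: `z` lies in the bounded component of the complement
of `γ`. -/
def Surrounds (γ : Loop ℂ) (z : ℂ) : Prop :=
  z ∉ γ.toSet ∧ Bornology.IsBounded (connectedComponentIn γ.toSetᶜ z)

/-- The component `U₊` of `0` in the complement of `γ`. -/
def inner (γ : Loop ℂ) : Set ℂ := connectedComponentIn γ.toSetᶜ 0

/-- The unbounded part of the complement of `γ`, that is `U₋` without the point at infinity. -/
def outer (γ : Loop ℂ) : Set ℂ :=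
  {z | z ∉ γ.toSet ∧ ¬ Bornology.IsBounded (connectedComponentIn γ.toSetᶜ z)}

/-- `φ` is the uniformizing map `φ₊ : (Δ, 0) → (U₊, 0)`: a conformal isomorphism from the open
unit disk onto `U₊` with `φ(0) = 0` and `φ'(0) > 0`. -/
structure IsInnerMap (γ : Loop ℂ) (φ : ℂ → ℂ) : Prop where
  holomorphic : DifferentiableOn ℂ φ (Metric.ball 0 1)
  injective : Set.InjOn φ (Metric.ball 0 1)
  image : φ '' Metric.ball 0 1 = γ.inner
  map_zero : φ 0 = 0
  deriv_pos : ∃ ρ : ℝ, 0 < ρ ∧ deriv φ 0 = ρ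

/-- `φ` is the uniformizing map `φ₋ : (Δ*, ∞) → (U₋, ∞)`, on the finite points `|z| > 1`, and
`φ(z) = ρ z (1 + O(1/z))` at infinity with `ρ > 0`. -/
structure IsOuterMap (γ : Loop ℂ) (φ : ℂ → ℂ) (ρ : ℝ) : Prop where
  holomorphic : DifferentiableOn ℂ φ {z | 1 < ‖z‖}
  injective : Set.InjOn φ {z | 1 < ‖z‖}
  image : φ '' {z | 1 < ‖z‖} = γ.outer
  pos : 0 < ρ
  tendsto : Filter.Tendsto (fun z => φ z / z) (Bornology.cobounded ℂ) (nhds (ρ : ℂ))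

/-- The uniformizing map `φ₊` of the interior of a loop that surrounds `0`. It is unique on the
unit disk; its values elsewhere are not used. -/
noncomputable def innerMap (γ : Loop ℂ) : ℂ → ℂ := Classical.epsilon γ.IsInnerMap

/-- The conformal radius `ρ₀(γ) = φ₊'(0)`. -/
noncomputable def conformalRadius (γ : Loop ℂ) : ℝ := (deriv γ.innerMap 0).re

/-- The transfinite diameter `ρ_∞(γ)`, the leading coefficient of `φ₋` at infinity. -/
noncomputable def transfiniteDiameter (γ : Loop ℂ) : ℝ :=
  Classical.epsilon fun ρ => ∃ φ, γ.IsOuterMap φ ρ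

/-- The coefficients `u_n(γ)` in `φ₊(z) = ρ₀ u(z)`, `u(z) = z (1 + ∑_{n ≥ 1} u_n z ^ n)`; the
value at `n = 0` is `1`. The normalized map `u` is identified with this sequence. -/
noncomputable def u (γ : Loop ℂ) (n : ℕ) : ℂ :=
  iteratedDeriv (n + 1) γ.innerMap 0 / (Nat.factorial (n + 1) : ℂ) / (γ.conformalRadius : ℂ)

end Loop

/-- A measure on the self-avoiding loops of each Riemann surface. -/
abbrev LoopMeasureFamily : Type 1 :=
  (S : RiemannSurface) → MeasureTheory.Measure (Loop S)

namespace LoopMeasureFamily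

/-- Conformal restriction: for each conformal embedding `f : S₁ → S₂`, the restriction of `μ S₂`
to the loops in `f(S₁) ≅ S₁` is `μ S₁`. -/
def ConformalRestriction (μ : LoopMeasureFamily) : Prop :=
  ∀ (S₁ S₂ : RiemannSurface) (f : S₁ → S₂) (hf : RiemannSurface.IsConformalEmbedding f),
    (μ S₂).restrict {γ | γ.toSet ⊆ Set.range f} =
      (μ S₁).map (Loop.map f hf.continuous hf.injective)

/-- The measure on loops in the plane. -/
noncomputable def onPlane (μ : LoopMeasureFamily) : MeasureTheory.Measure (Loop ℂ) := μ RiemannSurface.plane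

/-- For some `0 < a < A`, the measure of the set of loops in `{0 < |z| < A}`, not contained in
`{|z| < a}`, that surround `0`, is finite and positive. -/
def Nontrivial (μ : LoopMeasureFamily) : Prop :=
  ∃ a A : ℝ, 0 < a ∧ a < A ∧
    0 < μ.onPlane {γ | γ.toSet ⊆ {z | 0 < ‖z‖ ∧ ‖z‖ < A} ∧ ¬ γ.toSet ⊆ {z | ‖z‖ < a} ∧
      γ.Surrounds 0} ∧
    μ.onPlane {γ | γ.toSet ⊆ {z | 0 < ‖z‖ ∧ ‖z‖ < A} ∧ ¬ γ.toSet ⊆ {z | ‖z‖ < a} ∧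
      γ.Surrounds 0} < ⊤

/-- `μ₀`: the restriction of `μ` to loops in the plane which surround `0`. -/
noncomputable def zero (μ : LoopMeasureFamily) : MeasureTheory.Measure (Loop ℂ) :=
  μ.onPlane.restrict {γ | γ.Surrounds 0}

/-- The Haar measure `dρ / ρ` of the multiplicative group of positive reals. -/
noncomputable def haarPos : MeasureTheory.Measure ℝ :=
  (MeasureTheory.volume.restrict (Set.Ioi 0)).withDensity fun ρ => ENNReal.ofReal (1 / ρ)

/-- `ν` is the measure `ν₀` on normalized maps `u` in the decomposition
`dμ₀(u, ρ_∞) = dν₀(u) × dρ_∞ / ρ_∞`. -/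
def Decomposes (μ : LoopMeasureFamily) (ν : MeasureTheory.Measure (ℕ → ℂ)) : Prop :=
  μ.zero.map (fun γ => (γ.u, γ.transfiniteDiameter)) = ν.prod haarPos

end LoopMeasureFamily

/-! The second moments come from transporting mass along translations. Consider pairs $(\gamma,p)$,
where $\gamma$ surrounds $0$, $\rho_\infty(\gamma)\in[1,e)$ and $p\in\phi_+(\{|z|<r\})$. Since
$\mu_{\mathbb C}$ is translation invariant, the involution $(\gamma,p)\mapsto(\gamma-p,-p)$
preserves $\mu_{\mathbb C}\times$ area. It also preserves this set of pairs: $\rho_\infty$ does not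
see translations, and the condition on $p$ bounds the hyperbolic distance in $U_+$ between $0$ and
$p$, which is symmetric. So $\rho_0(\gamma)^{-2}$ and $\rho_0(\gamma-p)^{-2}$ have the same integral
over it (`ConformalRestriction.lintegral_translate`).

For fixed $\gamma$ the first integral over $p$ is the area of $u(\{|z|<r\})$, that is $\pi\sum_n
(n+1)|u_n|^2r^{2n+2}$ (`lintegral_image_conformalRadius`). For $p=\phi_+(q)$ one has
$\rho_0(\gamma-p)=(1-|q|^2)|\phi_+'(q)|$, so the Jacobian cancels and the second is
$\int_{|q|<r}(1-|q|^2)^{-2}=\pi\sum_n r^{2n+2}$, the same for every loop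
(`lintegral_image_conformalRadius_translate`). Integrating over $\gamma$ and comparing coefficients
of $r^2$ gives $(n+1)\int|u_n|^2d\nu_0=1$.

The measure $\nu_0$ comes from scale invariance: scaling fixes $u$ and multiplies $\rho_\infty$, so
in logarithmic coordinates the law of $(u,\rho_\infty)$ is invariant under translation of the second
factor and splits off a Haar measure (`eq_prod_haarPos`). This needs $1\le\rho_\infty<e$ to have
finite mass, which follows from nontriviality because $\rho_\infty$ and $\max_\gamma|z|$ are
comparable (`ConformalRestriction.onPlane_band_lt_top`).

The remaining work makes these quantities meaningful and measurable. The uniformizing maps are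
produced by a Riemann mapping theorem whose topological input uses only that a loop is compact and
connected, with no appeal to the Jordan curve theorem (`noHoles_component`, `NoHoles.isExactOn`).
Their uniqueness, the semicontinuity of $\rho_0$ and $\rho_\infty$ and the measurability of $u_n$
all rest on subordination and the Schwarz lemma. -/

open Complex MeasureTheory Set Metric Filter Topology
open scoped Real ContDiff Manifold ComplexConjugate

/-! ### Primitives of holomorphic functions on domains without holes. -/

/-- The Cauchy–Pompeiu formula for a compactly supported function. -/
theorem integral_dbar_div_sub {h : ℂ → ℂ} (hh : ContDiff ℝ 1 h) (hc : HasCompactSupport h) (z : ℂ) :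
    ∫ w, (fderiv ℝ h w 1 + I * fderiv ℝ h w I) / (w - z) = -(2 * π) * h z := by
  have hD : Continuous (fderiv ℝ h) := hh.continuous_fderiv (by norm_num)
  rw [← integral_add_right_eq_self (fun w => (fderiv ℝ h w 1 + I * fderiv ℝ h w I) / (w - z)) z,
    ← Complex.integral_comp_polarCoord_symm]
  set e : ℝ → ℂ := fun θ => Complex.exp (θ * I) with he
  have hsymm : ∀ p : ℝ × ℝ, Complex.polarCoord.symm p = p.1 * e p.2 := by
    intro p
    rw [Complex.polarCoord_symm_apply, he]
    simp only [Complex.exp_mul_I]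
    push_cast; ring
  have hec : Continuous e := by fun_prop
  -- In polar coordinates about $z$ the integrand times the Jacobian $r$ is $\partial_r
  -- h+(i/r)\partial_\theta h$. `A` is the radial part, which integrates to $-h(z)$ along each ray;
  -- `B` is the angular part, which integrates to $0$ by periodicity.
  set A : ℝ × ℝ → ℂ := fun p => fderiv ℝ h (p.1 * e p.2 + z) (e p.2) with hA
  set B : ℝ × ℝ → ℂ := fun p => I * fderiv ℝ h (p.1 * e p.2 + z) (I * e p.2) with hB
  have hAc : Continuous A := by
    refine Continuous.clm_apply (hD.comp (by fun_prop)) (by fun_prop)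
  have hBc : Continuous B := by
    refine continuous_const.mul (Continuous.clm_apply (hD.comp (by fun_prop)) (by fun_prop))
  obtain ⟨R, hR⟩ := (hc.isCompact.isBounded).subset_closedBall z
  have hz : ∀ p : ℝ × ℝ, max R 0 < p.1 → fderiv ℝ h (p.1 * e p.2 + z) = 0 := by
    intro p hp
    by_contra hne
    have h1 : (p.1 * e p.2 + z) ∈ tsupport h :=
      support_fderiv_subset ℝ (by simpa using hne)
    have h2 := hR h1
    simp only [mem_closedBall, dist_add_self_left, norm_mul, he, Complex.norm_exp_ofReal_mul_I,
      Complex.norm_real, mul_one] at h2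
    have := (le_max_left R 0).trans_lt hp
    exact absurd ((le_abs_self _).trans h2) (not_le.mpr this)
  have hint : ∀ G : ℝ × ℝ → ℂ, Continuous G → (∀ p : ℝ × ℝ, max R 0 < p.1 → G p = 0) →
      IntegrableOn G (Ioi 0 ×ˢ Ioo (-π) π) (volume.prod volume) := by
    intro G hG hG0
    have h1 : IntegrableOn G (Icc 0 (max R 0) ×ˢ Icc (-π) π) (volume.prod volume) :=
      hG.continuousOn.integrableOn_compact (isCompact_Icc.prod isCompact_Icc)
    refine h1.of_forall_sdiff_eq_zero (measurableSet_Ioi.prod measurableSet_Ioo) ?_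
    rintro ⟨r, θ⟩ ⟨⟨h3, h4⟩, h5⟩
    apply hG0
    by_contra h6
    exact h5 ⟨⟨h3.le, not_lt.mp h6⟩, Ioo_subset_Icc_self h4⟩
  have hAi := hint A hAc (fun p hp => by simp [hA, hz p hp])
  have hBi := hint B hBc (fun p hp => by simp [hB, hz p hp])
  have key : ∫ p in _root_.polarCoord.target, p.1 •
      ((fderiv ℝ h (Complex.polarCoord.symm p + z) 1 +
        I * fderiv ℝ h (Complex.polarCoord.symm p + z) I) / (Complex.polarCoord.symm p + z - z)) =
      ∫ p in Ioi 0 ×ˢ Ioo (-π) π, (A p + B p) ∂(volume.prod volume) := by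
    change ∫ p in Ioi 0 ×ˢ Ioo (-π) π, _ ∂(volume.prod volume) = _
    refine setIntegral_congr_fun (measurableSet_Ioi.prod measurableSet_Ioo) ?_
    rintro ⟨r, θ⟩ ⟨hr, hθ⟩
    have hr' : (r : ℂ) ≠ 0 := by exact_mod_cast (ne_of_gt hr)
    have hlin : ∀ (L : ℂ →L[ℝ] ℂ) (v : ℂ), L v = v.re * L 1 + v.im * L I := by
      intro L v
      conv_lhs => rw [← Complex.re_add_im v]
      have h1 : (v.re : ℂ) = v.re • (1 : ℂ) := by simp
      have h2 : (v.im : ℂ) * I = v.im • I := by simp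
      rw [map_add, h1, h2, map_smul, map_smul]
      simp
    simp only [hsymm, hA, hB, add_sub_cancel_right]
    set L := fderiv ℝ h (r * e θ + z)
    have heθ : e θ = Real.cos θ + Real.sin θ * I := by simp [he, Complex.exp_mul_I]
    have hene : e θ ≠ 0 := Complex.exp_ne_zero _
    rw [hlin L (e θ), hlin L (I * e θ)]
    have hre : (e θ).re = Real.cos θ := by rw [heθ]; simp [Complex.cos_ofReal_re, Complex.sin_ofReal_re]
    have him : (e θ).im = Real.sin θ := by
      rw [heθ]; simp [Complex.sin_ofReal_re]
    simp only [Complex.mul_re, Complex.mul_im, I_re, I_im, hre, him, Complex.real_smul]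
    have hsq : ((Real.cos θ : ℂ)) ^ 2 + (Real.sin θ : ℂ) ^ 2 = 1 := by
      exact_mod_cast Real.cos_sq_add_sin_sq θ
    field_simp
    rw [heθ]
    push_cast at hsq ⊢
    linear_combination (-(L 1 + I * L I)) * hsq + (L 1 * Complex.sin θ ^2 + I * L I * Complex.sin θ ^ 2 - L I * Complex.cos θ * Complex.sin θ - L I * I * Complex.sin θ ^2 ) * Complex.I_sq
  rw [key, integral_add hAi hBi]
  have hB0 : ∫ p in Ioi 0 ×ˢ Ioo (-π) π, B p ∂(volume.prod volume) = 0 := by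
    rw [setIntegral_prod _ hBi]
    refine setIntegral_eq_zero_of_forall_eq_zero ?_
    intro r hr
    have hr' : (r : ℂ) ≠ 0 := by exact_mod_cast (ne_of_gt hr)
    have hderiv : ∀ θ : ℝ, HasDerivAt (fun θ : ℝ => h (r * e θ + z) / r * I) (B (r, θ)) θ := by
      intro θ
      have h1 : HasDerivAt (fun θ : ℝ => (r * e θ + z)) (r * (I * e θ)) θ := by
        have h2 : HasDerivAt (fun θ : ℝ => (θ : ℂ) * I) (1 * I) θ :=
          (Complex.ofRealCLM.hasDerivAt (x := θ)).mul_const I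
        have := (h2.cexp.const_mul (r : ℂ)).add_const z
        refine this.congr_deriv ?_
        simp only [he, one_mul]; ring
      have h3 := ((hh.differentiable (by norm_num)) (r * e θ + z)).hasFDerivAt.comp_hasDerivAt θ h1
      have h4 := (h3.div_const (r : ℂ)).mul_const I
      refine h4.congr_deriv ?_
      simp only [hB]
      have : (r : ℂ) * (I * e θ) = r • (I * e θ) := by simp
      rw [this, map_smul, Complex.real_smul]
      field_simp
    rw [← integral_Ioc_eq_integral_Ioo, ← intervalIntegral.integral_of_le (by linarith [Real.pi_pos]),
      intervalIntegral.integral_eq_sub_of_hasDerivAt (fun θ _ => hderiv θ)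
        ((hBc.comp (by fun_prop : Continuous fun θ : ℝ => (r, θ))).intervalIntegrable _ _)]
    have : e π = e (-π) := by
      simp [he, Complex.exp_neg]
    rw [this, sub_self]
  have hAeq : ∫ p in Ioi 0 ×ˢ Ioo (-π) π, A p ∂(volume.prod volume) = -(2 * π) * h z := by
    rw [← Measure.prod_restrict] at *
    rw [integral_prod_symm _ (by rw [IntegrableOn, ← Measure.prod_restrict] at hAi; exact hAi)]
    have hin : ∀ θ : ℝ, ∫ r in Ioi (0:ℝ), A (r, θ) = - h z := by
      intro θ
      have hg : ContDiff ℝ 1 (fun r : ℝ => h (r * e θ + z)) :=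
        hh.comp ((Complex.ofRealCLM.contDiff.mul contDiff_const).add contDiff_const)
      have hgc : HasCompactSupport (fun r : ℝ => h (r * e θ + z)) := by
        refine HasCompactSupport.of_support_subset_isCompact (isCompact_closedBall (0:ℝ) R) ?_
        intro r hr
        have h2 := hR (subset_tsupport h hr)
        simpa [he, Complex.norm_exp_ofReal_mul_I] using h2
      have hd : ∀ r : ℝ, deriv (fun r : ℝ => h (r * e θ + z)) r = A (r, θ) := by
        intro r
        have h1 : HasDerivAt (fun r : ℝ => (r * e θ + z)) (1 * e θ) r :=
          ((Complex.ofRealCLM.hasDerivAt (x := r)).mul_const (e θ)).add_const z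
        have h3 := ((hh.differentiable (by norm_num)) (r * e θ + z)).hasFDerivAt.comp_hasDerivAt r h1
        rw [one_mul] at h3
        exact h3.deriv
      simp_rw [← hd]
      rw [HasCompactSupport.integral_Ioi_deriv_eq hg hgc]
      simp
    simp_rw [hin]
    simp [integral_const, Measure.real, Real.pi_pos.le]
    left; ring
  rw [hAeq, hB0, add_zero]

/-- Pole pushing. The poles $w\notin K$ for which $(z-w)^{-1}$ has a primitive along $K$ form a
relatively clopen subset of the complement of $K$, and contain every pole that is far away; the
unbounded connected set $W$ joins $w$ to such a pole. -/
theorem isExactOn_inv_sub {K W : Set ℂ} (hK : IsCompact K) (hW : IsPreconnected W)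
    (hWK : Disjoint W K) (hWu : ¬ Bornology.IsBounded W) {w : ℂ} (hw : w ∈ W) :
    IsExactOn (fun z => (z - w)⁻¹) K := by
  set E : Set ℂ := {w | IsExactOn (fun z => (z - w)⁻¹) K} with hE
  have hloc : ∀ w₀ ∉ K, ∃ ε > 0, ∀ a ∈ ball w₀ ε, a ∉ K ∧ (w₀ ∈ E ↔ a ∈ E) := by
    intro w₀ hw₀
    obtain ⟨δ, hδ, hball⟩ := Metric.isOpen_iff.mp hK.isClosed.isOpen_compl w₀ hw₀
    -- The difference of the two kernels has primitive $\log\frac{z-a}{z-b}$. The quotient lies in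
    -- the disk $|\zeta-1|<1$, so the principal branch is holomorphic there.
    have hstep : ∀ a b : ℂ, a ∉ K → b ∉ K → (∀ z ∈ K, ‖b - a‖ < ‖z - b‖) → b ∈ E → a ∈ E := by
      rintro a b ha hb hab ⟨G, hG⟩
      refine ⟨fun z => G z + Complex.log ((z - a) / (z - b)), fun z hz => ?_⟩
      have hza : z - a ≠ 0 := sub_ne_zero.mpr fun h => ha (h ▸ hz)
      have hzb : z - b ≠ 0 := sub_ne_zero.mpr fun h => hb (h ▸ hz)
      have hslit : (z - a) / (z - b) ∈ slitPlane := by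
        have h1 : (z - a) / (z - b) = 1 + (b - a) / (z - b) := by field_simp; ring
        rw [h1]
        apply Complex.mem_slitPlane_of_norm_lt_one
        rw [norm_div, div_lt_one (norm_pos_iff.mpr hzb)]
        exact hab z hz
      have h2 : HasDerivAt (fun z => (z - a) / (z - b))
          ((1 * (z - b) - (z - a) * 1) / (z - b) ^ 2) z :=
        ((hasDerivAt_id z).sub_const a).div ((hasDerivAt_id z).sub_const b) hzb
      refine ((hG z hz).add (h2.clog hslit)).congr_deriv ?_
      field_simp
      ring
    refine ⟨δ / 2, by positivity, fun a ha => ?_⟩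
    have haK : a ∉ K := hball (ball_subset_ball (by linarith) ha)
    have hd : ∀ z ∈ K, δ ≤ ‖z - w₀‖ := by
      intro z hz
      by_contra! h
      exact hball (by simpa [dist_eq_norm] using h) hz
    rw [mem_ball, dist_eq_norm] at ha
    refine ⟨haK, hstep a w₀ haK hw₀ fun z hz => ?_, hstep w₀ a hw₀ haK fun z hz => ?_⟩
    · rw [norm_sub_rev]; linarith [hd z hz]
    · have := norm_sub_le_norm_sub_add_norm_sub z a w₀
      linarith [hd z hz]
  have hopen : ∀ P : Prop, IsOpen {w | w ∉ K ∧ (w ∈ E ↔ P)} := by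
    intro P
    rw [Metric.isOpen_iff]
    rintro w₀ ⟨h1, h2⟩
    obtain ⟨ε, hε, h⟩ := hloc w₀ h1
    exact ⟨ε, hε, fun a ha => ⟨(h a ha).1, (h a ha).2.symm.trans h2⟩⟩
  have hsub := hW.subset_left_of_subset_union (hopen True) (hopen False)
    (by rw [Set.disjoint_left]; rintro x ⟨_, h1⟩ ⟨_, h2⟩; simp_all)
    (fun x hx => by
      have : x ∉ K := Set.disjoint_left.mp hWK hx
      by_cases h : x ∈ E <;> simp [h, this])
    (by
      obtain ⟨R, hR⟩ := hK.isBounded.subset_closedBall 0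
      obtain ⟨b, hb, hbR⟩ : ∃ b ∈ W, R < ‖b‖ := by
        by_contra! h
        exact hWu ((isBounded_iff_forall_norm_le).mpr ⟨R, h⟩)
      have hbK := Set.disjoint_left.mp hWK hb
      refine ⟨b, hb, hbK, ?_⟩
      simp only [iff_true]
      refine ⟨fun z => Complex.log ((b - z) / b), fun z hz => ?_⟩
      have hzR : ‖z‖ ≤ R := by simpa using hR hz
      have hb0 : b ≠ 0 := by
        rintro rfl; simp at hbR; linarith [norm_nonneg z]
      have hzb : z - b ≠ 0 := sub_ne_zero.mpr fun h => hbK (h ▸ hz)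
      have hzb' : b - z ≠ 0 := sub_ne_zero.mpr fun h => hbK (h ▸ hz)
      have hslit : (b - z) / b ∈ slitPlane := by
        have h1 : (b - z) / b = 1 + (-z) / b := by field_simp; ring
        rw [h1]
        apply Complex.mem_slitPlane_of_norm_lt_one
        rw [norm_div, div_lt_one (norm_pos_iff.mpr hb0), norm_neg]
        linarith
      have h2 : HasDerivAt (fun z => (b - z) / b) (-1 / b) z :=
        ((hasDerivAt_id z).const_sub b).div_const b
      refine (h2.clog hslit).congr_deriv ?_
      field_simp
      ring)
  exact (hsub hw).2.mpr trivial

/-- Uniform limits of exact functions on a connected open set are exact. -/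
theorem isExactOn_of_tendstoUniformlyOn {O : Set ℂ} (hO : IsOpen O) (hOc : IsPreconnected O)
    {F : ℕ → ℂ → ℂ} {f : ℂ → ℂ} (hF : ∀ n, IsExactOn (F n) O)
    (hlim : TendstoUniformlyOn F f atTop O) : IsExactOn f O := by
  rcases O.eq_empty_or_nonempty with rfl | ⟨x₀, hx₀⟩
  · exact ⟨0, by simp⟩
  choose G hG0 hG using fun n => (hF n).with_val_at x₀ 0
  have hcs : UniformCauchySeqOn (fun n x => ContinuousLinearMap.toSpanSingleton ℂ (F n x)) atTop O := by
    have h1 := hlim.uniformCauchySeqOn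
    rw [Metric.uniformCauchySeqOn_iff] at h1 ⊢
    intro ε hε
    obtain ⟨N, hN⟩ := h1 ε hε
    refine ⟨N, fun m hm n hn x hx => ?_⟩
    have := hN m hm n hn x hx
    rw [dist_eq_norm] at this ⊢
    have h2 : ContinuousLinearMap.toSpanSingleton ℂ (F m x) - ContinuousLinearMap.toSpanSingleton ℂ (F n x)
      = ContinuousLinearMap.toSpanSingleton ℂ (F m x - F n x) := by ext; simp
    rw [h2]
    simpa using this
  have hc : ∀ x ∈ O, ∃ y, Tendsto (fun n => G n x) atTop (𝓝 y) := by
    intro x hx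
    have := cauchy_map_of_uniformCauchySeqOn_fderiv hO hOc hcs
      (fun n y hy => (hG n y hy).hasFDerivAt) hx₀ hx
      (by simp only [hG0]; exact (tendsto_const_nhds (x := (0:ℂ))).cauchy_map)
    exact cauchy_map_iff_exists_tendsto.mp this
  choose! g hg using hc
  exact ⟨g, fun z hz => hasDerivAt_of_tendstoUniformlyOn hO hlim
    (Eventually.of_forall fun n x hx => hG n x hx) hg hz⟩

/-- A holomorphic function near a compact set without holes is exact on each connected open
subset. -/
theorem isExactOn_of_filled {K U O : Set ℂ} (hK : IsCompact K) (hU : IsOpen U) (hKU : K ⊆ U)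
    (hfill : ∀ w ∉ K, ∃ W, IsPreconnected W ∧ Disjoint W K ∧ ¬ Bornology.IsBounded W ∧ w ∈ W)
    (hO : IsOpen O) (hOc : IsPreconnected O) (hOK : O ⊆ K) {g : ℂ → ℂ}
    (hg : DifferentiableOn ℂ g U) : IsExactOn g O := by
  obtain ⟨T, hT, hKT, hTU⟩ := exists_compact_between hK hU hKU
  obtain ⟨χ, hχ1, hχ0, -⟩ := exists_contMDiffMap_one_nhds_of_subset_interior (n := (⊤ : ℕ∞))
    𝓘(ℝ, ℂ) hK.isClosed hKT
  have hχ : ContDiff ℝ 1 χ := χ.contMDiff.contDiff.of_le (by exact_mod_cast le_top)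
  set h : ℂ → ℂ := fun z => (χ z : ℂ) * g z with hh
  have hh0 : ∀ z ∉ T, h z = 0 := fun z hz => by simp [hh, hχ0 z hz]
  have hhC : ContDiff ℝ 1 h := by
    rw [contDiff_iff_contDiffAt]
    intro z
    by_cases hz : z ∈ U
    · have h1 : AnalyticAt ℂ g z := hg.analyticAt (hU.mem_nhds hz)
      have h2 : ContDiffAt ℝ 1 g z := (h1.contDiffAt.restrict_scalars ℝ)
      exact (Complex.ofRealCLM.contDiff.contDiffAt.comp z hχ.contDiffAt).mul h2
    · have hzT : z ∉ T := fun h => hz (hTU h)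
      have : h =ᶠ[𝓝 z] fun _ => 0 := by
        filter_upwards [hT.isClosed.isOpen_compl.mem_nhds hzT] with y hy using hh0 y hy
      exact contDiffAt_const.congr_of_eventuallyEq this
  have hhc : HasCompactSupport h := HasCompactSupport.of_support_subset_isCompact hT
    (fun z hz => by by_contra h'; exact hz (hh0 z h'))
  set c : ℂ → ℂ := fun w => fderiv ℝ h w 1 + I * fderiv ℝ h w I with hc
  have hD : Continuous (fderiv ℝ h) := hhC.continuous_fderiv (by norm_num)
  have hcc : Continuous c := (hD.clm_apply continuous_const).add
    (continuous_const.mul (hD.clm_apply continuous_const))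
  have hc0T : ∀ w ∉ T, c w = 0 := by
    intro w hw
    have : h =ᶠ[𝓝 w] fun _ => 0 := by
      filter_upwards [hT.isClosed.isOpen_compl.mem_nhds hw] with y hy using hh0 y hy
    simp [hc, this.fderiv_eq]
  -- Near $K$ the cutoff is $1$, so $h=g$ is holomorphic and its $\bar\partial$ derivative vanishes.
  -- Hence only poles off $K$ contribute to the Cauchy–Pompeiu integral.
  have hc0K : ∀ w ∈ K, ∀ᶠ y in 𝓝 w, c y = 0 := by
    intro w hw
    have h1 : ∀ᶠ y in 𝓝 w, χ y = 1 := hχ1.filter_mono (nhds_le_nhdsSet hw)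
    have h2 := h1.eventually_nhds
    filter_upwards [h2, hU.mem_nhds (hKU hw)] with y hy hyU
    have h3 : h =ᶠ[𝓝 y] g := by
      filter_upwards [hy] with x hx
      simp [hh, hx]
    have h4 : DifferentiableAt ℂ g y := hg.differentiableAt (hU.mem_nhds hyU)
    simp only [hc, h3.fderiv_eq, h4.fderiv_restrictScalars ℝ]
    simp only [ContinuousLinearMap.coe_restrictScalars']
    have : (fderiv ℂ g y) I = I * fderiv ℂ g y 1 := by
      rw [← smul_eq_mul, ← map_smul]; simp
    rw [this, ← mul_assoc, I_mul_I]; ring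
  have hgK : ∀ z ∈ K, h z = g z := by
    intro z hz
    have h1 : ∀ᶠ y in 𝓝 z, χ y = 1 := hχ1.filter_mono (nhds_le_nhdsSet hz)
    simp only [hh, h1.self_of_nhds, Complex.ofReal_one, one_mul]
  have : CompactSpace K := isCompact_iff_compactSpace.mp hK
  have hjoint : Continuous (fun p : ℂ × K => c p.1 * ((p.2 : ℂ) - p.1)⁻¹) := by
    rw [continuous_iff_continuousAt]
    rintro ⟨w, z⟩
    by_cases hw : w ∈ K
    · have : (fun p : ℂ × K => c p.1 * ((p.2 : ℂ) - p.1)⁻¹) =ᶠ[𝓝 (w, z)] fun _ => 0 := by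
        have h1 := (continuous_fst (X := ℂ) (Y := K)).continuousAt (x := (w, z)) |>.eventually (hc0K w hw)
        filter_upwards [h1] with p hp
        simp [hp]
      exact continuousAt_const.congr this.symm
    · have hne : (z : ℂ) - w ≠ 0 := sub_ne_zero.mpr fun h => hw (h ▸ z.2)
      exact (hcc.comp continuous_fst).continuousAt.mul
        (ContinuousAt.inv₀ (by fun_prop) hne)
  set Φ : C(ℂ, C(K, ℂ)) := ContinuousMap.curry ⟨_, hjoint⟩ with hΦ
  have hΦa : ∀ w z, Φ w z = c w * ((z : ℂ) - w)⁻¹ := fun w z => rfl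
  -- The Cauchy–Pompeiu integral writes $g$ on $K$ as a superposition of the kernels $(z-w)^{-1}$,
  -- $w\notin K$, each of which is exact. Exactness on `O` defines a closed subspace of $C(K)$, so
  -- it passes to the integral.
  let P : Submodule ℂ C(K, ℂ) :=
    { carrier := {F | ∃ f : ℂ → ℂ, (∀ z (hz : z ∈ O), f z = F ⟨z, hOK hz⟩) ∧ IsExactOn f O}
      add_mem' := by
        rintro F₁ F₂ ⟨f₁, h₁, G₁, hG₁⟩ ⟨f₂, h₂, G₂, hG₂⟩
        exact ⟨f₁ + f₂, fun z hz => by simp [h₁ z hz, h₂ z hz], G₁ + G₂,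
          fun z hz => (hG₁ z hz).add (hG₂ z hz)⟩
      zero_mem' := ⟨0, by simp, 0, fun z hz => hasDerivAt_const z 0⟩
      smul_mem' := by
        rintro a F ⟨f, h, G, hG⟩
        exact ⟨a • f, fun z hz => by simp [h z hz], a • G, fun z hz => (hG z hz).const_smul a⟩ }
  have hP : IsClosed (P : Set C(K, ℂ)) := by
    rw [← isSeqClosed_iff_isClosed]
    intro F F₀ hF hlim
    choose f hf hfe using hF
    classical
    refine ⟨fun z => if hz : z ∈ O then F₀ ⟨z, hOK hz⟩ else 0, fun z hz => by simp [hz], ?_⟩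
    refine isExactOn_of_tendstoUniformlyOn hO hOc hfe ?_
    rw [Metric.tendstoUniformlyOn_iff]
    intro ε hε
    filter_upwards [(Metric.tendsto_nhds.mp hlim) ε hε] with n hn z hz
    simp only [hz, dif_pos, hf n z hz]
    rw [dist_comm]
    exact (ContinuousMap.dist_apply_le_dist _).trans_lt hn
  have hΦP : ∀ w, Φ w ∈ P := by
    intro w
    by_cases hw : w ∈ K
    · have : Φ w = 0 := by
        ext z; rw [hΦa, (hc0K w hw).self_of_nhds]; simp
      rw [this]; exact P.zero_mem
    · obtain ⟨W, h1, h2, h3, h4⟩ := hfill w hw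
      obtain ⟨G, hG⟩ := isExactOn_inv_sub hK h1 h2 h3 h4
      refine ⟨fun z => c w * (z - w)⁻¹, fun z hz => by rw [hΦa], fun z => c w * G z,
        fun z hz => (hG z (hOK hz)).const_mul _⟩
  have hcs : HasCompactSupport Φ := HasCompactSupport.of_support_subset_isCompact hT
    (fun w hw => by
      by_contra h'
      exact hw (by ext z; rw [hΦa, hc0T w h']; simp))
  have hint : Integrable Φ := Φ.continuous.integrable_of_hasCompactSupport hcs
  have hmem : ∫ w, Φ w ∈ P := by
    -- Integrating the same function with values in `P` shows that its integral stays in `P`.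
    have : CompleteSpace P := hP.completeSpace_coe
    let Ψ : ℂ → P := fun w => ⟨Φ w, hΦP w⟩
    have hΨc : Continuous Ψ := Φ.continuous.subtype_mk _
    have hΨs : HasCompactSupport Ψ := HasCompactSupport.of_support_subset_isCompact hT
      (fun w hw => by
        by_contra h'
        exact hw (by ext z; change Φ w z = 0; rw [hΦa, hc0T w h']; simp))
    have hΨ : Integrable Ψ := hΨc.integrable_of_hasCompactSupport hΨs
    have := P.subtypeL.integral_comp_comm hΨ
    have h2 : ∫ w, Φ w = P.subtypeL (∫ w, Ψ w) := this
    rw [h2]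
    exact (∫ w, Ψ w).2
  obtain ⟨f, hf, G, hG⟩ := hmem
  refine ⟨fun z => (2 * π : ℂ)⁻¹ * G z, fun z hz => ((hG z hz).const_mul _).congr_deriv ?_⟩
  have hπ : (2 * π : ℂ) ≠ 0 := by
    have := Real.pi_ne_zero
    simp
  rw [hf z hz, ContinuousMap.integral_apply hint, ← hgK z (hOK hz)]
  have h1 := integral_dbar_div_sub hhC hhc z
  have h2 : ∫ w, Φ w ⟨z, hOK hz⟩ = - ∫ w, (fderiv ℝ h w 1 + I * fderiv ℝ h w I) / (w - z) := by
    rw [← integral_neg]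
    congr 1
    ext w
    rw [hΦa, div_eq_mul_inv, ← mul_neg, ← inv_neg, neg_sub]
  rw [h2, h1]
  field_simp

/-- Each point of the complement lies in an unbounded connected subset of the complement. -/
def NoHoles (U : Set ℂ) : Prop :=
  ∀ a ∉ U, ∃ C, IsPreconnected C ∧ Disjoint C U ∧ ¬ Bornology.IsBounded C ∧ a ∈ C

/-- A set together with the holes of its complement. -/
def fillHoles (K : Set ℂ) : Set ℂ :=
  {a | ¬ ∃ C, IsPreconnected C ∧ Disjoint C K ∧ ¬ Bornology.IsBounded C ∧ a ∈ C}

theorem noHoles_fillHoles (K : Set ℂ) : NoHoles (fillHoles K) := by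
  intro a ha
  simp only [fillHoles, mem_ofPred_eq, not_not] at ha
  obtain ⟨C, h1, h2, h3, h4⟩ := ha
  refine ⟨C, h1, Set.disjoint_left.mpr fun x hx hx' => hx' ⟨C, h1, h2, h3, hx⟩, h3, h4⟩

theorem fillHoles_mono {K L : Set ℂ} (h : K ⊆ L) : fillHoles K ⊆ fillHoles L := by
  rintro a ha ⟨C, h1, h2, h3, h4⟩
  exact ha ⟨C, h1, h2.mono_right h, h3, h4⟩

theorem subset_fillHoles (K : Set ℂ) : K ⊆ fillHoles K := by
  rintro a ha ⟨C, -, h2, -, h4⟩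
  exact Set.disjoint_left.mp h2 h4 ha

theorem NoHoles.fillHoles_subset {K U : Set ℂ} (hU : NoHoles U) (h : K ⊆ U) : fillHoles K ⊆ U := by
  intro a ha
  by_contra haU
  obtain ⟨C, h1, h2, h3, h4⟩ := hU a haU
  exact ha ⟨C, h1, h2.mono_right h, h3, h4⟩

theorem isCompact_fillHoles {K : Set ℂ} (hK : IsCompact K) : IsCompact (fillHoles K) := by
  apply Metric.isCompact_of_isClosed_isBounded
  · rw [← isOpen_compl_iff, Metric.isOpen_iff]
    intro a ha
    simp only [fillHoles, mem_compl_iff, mem_ofPred_eq, not_not] at ha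
    obtain ⟨C, h1, h2, h3, h4⟩ := ha
    obtain ⟨ε, hε, hb⟩ := Metric.isOpen_iff.mp hK.isClosed.isOpen_compl a
      (Set.disjoint_left.mp h2 h4)
    refine ⟨ε, hε, fun b hbε => ?_⟩
    simp only [fillHoles, mem_compl_iff, mem_ofPred_eq, not_not]
    refine ⟨C ∪ ball a ε, h1.union a h4 (mem_ball_self hε) (convex_ball a ε).isPreconnected,
      Disjoint.union_left h2 (Set.disjoint_left.mpr hb), fun h => h3 (h.subset subset_union_left),
      Or.inr hbε⟩
  · obtain ⟨R, hR⟩ := hK.isBounded.subset_closedBall 0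
    rw [isBounded_iff_forall_norm_le]
    refine ⟨max R 0, fun a ha => ?_⟩
    by_contra! h
    have ha0 : 0 < ‖a‖ := (le_max_right R 0).trans_lt h
    refine ha ⟨(fun t : ℝ => (t : ℂ) * a) '' Ici 1, ?_, ?_, ?_, ⟨1, by simp, by simp⟩⟩
    · exact (convex_Ici 1).isPreconnected.image _ (by fun_prop)
    · rw [Set.disjoint_left]
      rintro _ ⟨t, ht, rfl⟩ hx
      have h2 := hR hx
      simp only [mem_closedBall, dist_zero_right, norm_mul, Complex.norm_real, Real.norm_eq_abs] at h2
      have h3 : (1 : ℝ) ≤ |t| := le_trans ht (le_abs_self t)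
      have h4 := (le_max_left R 0).trans_lt h
      nlinarith
    · intro hb
      obtain ⟨M, hM⟩ := isBounded_iff_forall_norm_le.mp hb
      have h2 := hM _ ⟨max 1 ((M + 1) / ‖a‖), mem_Ici.mpr (le_max_left _ _), rfl⟩
      simp only [norm_mul, Complex.norm_real, Real.norm_eq_abs] at h2
      have h3 : (M + 1) / ‖a‖ ≤ |max 1 ((M + 1) / ‖a‖)| := (le_max_right _ _).trans (le_abs_self _)
      have h4 : M + 1 ≤ |max 1 ((M + 1) / ‖a‖)| * ‖a‖ := by
        rwa [div_le_iff₀ ha0] at h3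
      linarith

theorem eqOn_of_hasDerivAt {O : Set ℂ} (hO : IsOpen O) (hOc : IsPreconnected O) {f g f' : ℂ → ℂ}
    (hf : ∀ z ∈ O, HasDerivAt f (f' z) z) (hg : ∀ z ∈ O, HasDerivAt g (f' z) z) {x : ℂ}
    (hx : x ∈ O) (h : f x = g x) : EqOn f g O :=
  hO.eqOn_of_deriv_eq hOc (fun z hz => (hf z hz).differentiableAt.differentiableWithinAt)
    (fun z hz => (hg z hz).differentiableAt.differentiableWithinAt)
    (fun z hz => by rw [(hf z hz).deriv, (hg z hz).deriv]) hx h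

/-- Filling the holes of a compact $K\subseteq U$ stays inside $U$, so primitives exist on the
component of $x_0$ in the interior of each filled compact set. These components increase with $K$
and cover $U$; primitives normalized to vanish at $x_0$ agree on overlaps and glue. -/
theorem NoHoles.isExactOn {U : Set ℂ} (hU : NoHoles U) (hUo : IsOpen U) (hUc : IsPreconnected U)
    {g : ℂ → ℂ} (hg : DifferentiableOn ℂ g U) : IsExactOn g U := by
  rcases U.eq_empty_or_nonempty with rfl | ⟨x₀, hx₀⟩
  · exact ⟨0, by simp⟩
  set O : Set ℂ → Set ℂ := fun K => connectedComponentIn (interior (fillHoles K)) x₀ with hOdef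
  have hOo : ∀ K, IsOpen (O K) := fun K => isOpen_interior.connectedComponentIn
  have hOc : ∀ K, IsPreconnected (O K) := fun K => isPreconnected_connectedComponentIn
  have hOmono : ∀ {K L}, K ⊆ L → O K ⊆ O L := fun h =>
    connectedComponentIn_mono _ (interior_mono (fillHoles_mono h))
  have hx₀O : ∀ {K z}, z ∈ O K → x₀ ∈ O K := fun {K z} hz =>
    mem_connectedComponentIn (by
      by_contra h
      simp [hOdef, connectedComponentIn_eq_empty h] at hz)
  have hex : ∀ K, IsCompact K → K ⊆ U → IsExactOn g (O K) := fun K hK hKU =>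
    isExactOn_of_filled (isCompact_fillHoles hK) hUo (hU.fillHoles_subset hKU)
      (noHoles_fillHoles K |> fun h w hw => h w hw) (hOo K) (hOc K)
      ((connectedComponentIn_subset _ _).trans interior_subset) hg
  have hcover : ∀ z ∈ U, ∃ K, IsCompact K ∧ K ⊆ U ∧ z ∈ O K := by
    intro z hz
    have hpc : IsPathConnected U := hUo.isConnected_iff_isPathConnected.mp ⟨⟨x₀, hx₀⟩, hUc⟩
    obtain ⟨p, hp⟩ := hpc.joinedIn x₀ hx₀ z hz
    have hpr : IsCompact (range p) := isCompact_range p.continuous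
    obtain ⟨K, hK, hpK, hKU⟩ := exists_compact_between hpr hUo (by rintro _ ⟨t, rfl⟩; exact hp t)
    refine ⟨K, hK, hKU, ?_⟩
    refine (isPreconnected_range p.continuous).subset_connectedComponentIn ⟨0, p.source⟩
      (hpK.trans (interior_mono (subset_fillHoles K))) ⟨1, p.target⟩
  have hprim : ∀ K, ∃ G : ℂ → ℂ, IsCompact K → K ⊆ U → G x₀ = 0 ∧ ∀ z ∈ O K, HasDerivAt G (g z) z := by
    intro K
    by_cases h : IsCompact K ∧ K ⊆ U
    · obtain ⟨G, h1, h2⟩ := (hex K h.1 h.2).with_val_at x₀ 0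
      exact ⟨G, fun _ _ => ⟨h1, h2⟩⟩
    · exact ⟨0, fun h1 h2 => absurd ⟨h1, h2⟩ h⟩
  choose G hG using hprim
  choose! κ hκ using hcover
  have hagree : ∀ K L, IsCompact K → K ⊆ U → IsCompact L → L ⊆ U → ∀ z ∈ O K, z ∈ O L → G K z = G L z := by
    intro K L hK hKU hL hLU z hzK hzL
    have hKL := hK.union hL
    have hKLU := union_subset hKU hLU
    have h1 : ∀ M, IsCompact M → M ⊆ U → M ⊆ K ∪ L → z ∈ O M → G M z = G (K ∪ L) z := by
      intro M hM hMU hMKL hz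
      exact eqOn_of_hasDerivAt (hOo M) (hOc M) (hG M hM hMU).2
        (fun y hy => (hG _ hKL hKLU).2 y (hOmono hMKL hy)) (hx₀O hz)
        ((hG M hM hMU).1.trans (hG _ hKL hKLU).1.symm) hz
    rw [h1 K hK hKU subset_union_left hzK, h1 L hL hLU subset_union_right hzL]
  refine ⟨fun z => G (κ z) z, fun z hz => ?_⟩
  obtain ⟨h1, h2, h3⟩ := hκ z hz
  refine ((hG (κ z) h1 h2).2 z h3).congr_of_eventuallyEq ?_
  filter_upwards [(hOo (κ z)).mem_nhds h3, hUo.mem_nhds hz] with y hy hyU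
  obtain ⟨k1, k2, k3⟩ := hκ y hyU
  exact hagree _ _ k1 k2 h1 h2 y k3 hy

theorem IsExactOn.exists_log {U : Set ℂ} (hUo : IsOpen U) (hUc : IsPreconnected U) {f : ℂ → ℂ}
    (hf : DifferentiableOn ℂ f U) (hf0 : ∀ z ∈ U, f z ≠ 0)
    (hex : IsExactOn (fun z => deriv f z / f z) U) :
    ∃ L : ℂ → ℂ, DifferentiableOn ℂ L U ∧ ∀ z ∈ U, Complex.exp (L z) = f z := by
  rcases U.eq_empty_or_nonempty with rfl | ⟨x₀, hx₀⟩
  · exact ⟨0, by simp, by simp⟩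
  obtain ⟨L, hL0, hL⟩ := hex.with_val_at x₀ (Complex.log (f x₀))
  refine ⟨L, fun z hz => (hL z hz).differentiableAt.differentiableWithinAt, ?_⟩
  have h1 : EqOn (fun z => Complex.exp (-L z) * f z) (fun _ => 1) U := by
    refine eqOn_of_hasDerivAt (f' := fun _ => 0) hUo hUc (fun z hz => ?_)
      (fun z _ => hasDerivAt_const z 1) hx₀ ?_
    · refine (((hL z hz).neg.cexp).mul
        (hf.differentiableAt (hUo.mem_nhds hz)).hasDerivAt).congr_deriv ?_
      have := hf0 z hz
      field_simp
      simp
    · simp only [hL0, Complex.exp_neg, Complex.exp_log (hf0 x₀ hx₀)]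
      exact inv_mul_cancel₀ (hf0 x₀ hx₀)
  intro z hz
  have h2 := h1 hz
  simp only [Complex.exp_neg] at h2
  have h3 := Complex.exp_ne_zero (L z)
  field_simp at h2
  exact h2.symm

theorem exists_log_of_isExactOn {U : Set ℂ} (hUo : IsOpen U) (hUc : IsPreconnected U)
    (hex : ∀ g : ℂ → ℂ, DifferentiableOn ℂ g U → IsExactOn g U) {f : ℂ → ℂ}
    (hf : DifferentiableOn ℂ f U) (hf0 : ∀ z ∈ U, f z ≠ 0) :
    ∃ L : ℂ → ℂ, DifferentiableOn ℂ L U ∧ ∀ z ∈ U, Complex.exp (L z) = f z :=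
  IsExactOn.exists_log hUo hUc hf hf0 (hex _ ((hf.deriv hUo).div hf hf0))

/-! ### Injective holomorphic maps, Hurwitz and Montel. -/

theorem InjOn.nhds_le_map {U : Set ℂ} (hU : IsOpen U) {f : ℂ → ℂ} (hf : DifferentiableOn ℂ f U)
    (hi : InjOn f U) {z : ℂ} (hz : z ∈ U) : 𝓝 (f z) ≤ map f (𝓝 z) := by
  have ha : AnalyticAt ℂ f z := hf.analyticAt (hU.mem_nhds hz)
  refine ha.eventually_constant_or_nhds_le_map_nhds.resolve_left fun h => ?_
  have h1 : ∀ᶠ y in 𝓝 z, y = z := by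
    filter_upwards [h, hU.mem_nhds hz] with y hy hyU using hi hyU hz hy
  have h2 : ∀ᶠ y in 𝓝[≠] z, y = z := h1.filter_mono nhdsWithin_le_nhds
  obtain ⟨y, hy1, hy2⟩ := (h2.and self_mem_nhdsWithin).exists
  exact hy2 hy1

theorem InjOn.isOpen_image {U : Set ℂ} (hU : IsOpen U) {f : ℂ → ℂ} (hf : DifferentiableOn ℂ f U)
    (hi : InjOn f U) : IsOpen (f '' U) := by
  rw [isOpen_iff_mem_nhds]
  rintro _ ⟨z, hz, rfl⟩
  exact InjOn.nhds_le_map hU hf hi hz (image_mem_map (hU.mem_nhds hz))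

/-- The inverse is continuous by the open mapping theorem and differentiable wherever $f'\ne0$.
Zeros of $f'$ are isolated, so they are removable singularities of the inverse; that $f'$ has no
zeros is then a consequence of the chain rule. -/
theorem InjOn.differentiableOn_invFunOn {U : Set ℂ} (hU : IsOpen U) {f : ℂ → ℂ}
    (hf : DifferentiableOn ℂ f U) (hi : InjOn f U) :
    DifferentiableOn ℂ (Function.invFunOn f U) (f '' U) := by
  set g := Function.invFunOn f U with hg
  have hgf : ∀ z ∈ U, g (f z) = z := fun z hz => hi.leftInvOn_invFunOn hz
  have hfg : ∀ w ∈ f '' U, f (g w) = w := by rintro _ ⟨z, hz, rfl⟩; rw [hgf z hz]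
  have himo := InjOn.isOpen_image hU hf hi
  have hcont : ∀ z ∈ U, ContinuousAt g (f z) := by
    intro z hz
    rw [ContinuousAt, hgf z hz]
    intro N hN
    have h1 : f '' (N ∩ U) ∈ 𝓝 (f z) :=
      InjOn.nhds_le_map hU hf hi hz (image_mem_map (inter_mem hN (hU.mem_nhds hz)))
    change g ⁻¹' N ∈ 𝓝 (f z)
    filter_upwards [h1]
    rintro _ ⟨y, hy, rfl⟩
    rw [mem_preimage, hgf y hy.2]; exact hy.1
  have hreg : ∀ z ∈ U, deriv f z ≠ 0 → DifferentiableAt ℂ g (f z) := by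
    intro z hz hd
    refine (HasDerivAt.of_local_left_inverse (f := f) (f' := deriv f z) (hcont z hz) ?_ hd ?_).differentiableAt
    · rw [hgf z hz]; exact (hf.differentiableAt (hU.mem_nhds hz)).hasDerivAt
    · filter_upwards [himo.mem_nhds ⟨z, hz, rfl⟩] with w hw using hfg w hw
  rintro _ ⟨z, hz, rfl⟩
  apply DifferentiableAt.differentiableWithinAt
  have hda : AnalyticAt ℂ (deriv f) z := (hf.analyticAt (hU.mem_nhds hz)).deriv
  rcases hda.eventually_eq_zero_or_eventually_ne_zero with h | h
  · exfalso
    obtain ⟨ε, hε, hball⟩ := Metric.eventually_nhds_iff_ball.mp (h.and (hU.mem_nhds hz))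
    have heq : EqOn f (fun _ => f z) (ball z ε) :=
      eqOn_of_hasDerivAt (f' := fun _ => 0) isOpen_ball (convex_ball z ε).isPreconnected
        (fun y hy => by
          rw [← (hball y hy).1]
          exact (hf.differentiableAt (hU.mem_nhds (hball y hy).2)).hasDerivAt)
        (fun y _ => hasDerivAt_const y _) (mem_ball_self hε) rfl
    have h1 : z + (ε / 2 : ℝ) ∈ ball z ε := by
      simp [abs_of_pos hε]; linarith
    have h2 := hi (hball _ h1).2 hz (heq h1)
    simp at h2; linarith
  · refine (analyticAt_of_differentiable_on_punctured_nhds_of_continuousAt ?_ (hcont z hz)).differentiableAt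
    have h1 : Tendsto g (𝓝[≠] (f z)) (𝓝[≠] z) := by
      refine tendsto_nhdsWithin_iff.mpr ⟨?_, ?_⟩
      · have := hcont z hz
        rw [ContinuousAt, hgf z hz] at this
        exact this.mono_left nhdsWithin_le_nhds
      · filter_upwards [self_mem_nhdsWithin, nhdsWithin_le_nhds (himo.mem_nhds ⟨z, hz, rfl⟩)] with w hw hwU h2
        have : g w = z := h2
        exact hw (by rw [mem_singleton_iff, ← hfg w hwU, this])
    filter_upwards [h1.eventually h, nhdsWithin_le_nhds (himo.mem_nhds ⟨z, hz, rfl⟩)] with w hw hwU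
    obtain ⟨y, hy, rfl⟩ := hwU
    rw [hgf y hy] at hw
    exact hreg y hy hw

theorem InjOn.deriv_mul_deriv_invFunOn {U : Set ℂ} (hU : IsOpen U) {f : ℂ → ℂ}
    (hf : DifferentiableOn ℂ f U) (hi : InjOn f U) {z : ℂ} (hz : z ∈ U) :
    deriv (Function.invFunOn f U) (f z) * deriv f z = 1 := by
  have h1 := ((InjOn.differentiableOn_invFunOn hU hf hi).differentiableAt
    ((InjOn.isOpen_image hU hf hi).mem_nhds ⟨z, hz, rfl⟩)).hasDerivAt
  have h2 := h1.comp z (hf.differentiableAt (hU.mem_nhds hz)).hasDerivAt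
  have h3 : (Function.invFunOn f U) ∘ f =ᶠ[𝓝 z] id := by
    filter_upwards [hU.mem_nhds hz] with y hy using hi.leftInvOn_invFunOn hy
  exact (h2.congr_of_eventuallyEq h3.symm).unique (hasDerivAt_id z)

theorem InjOn.deriv_ne_zero {U : Set ℂ} (hU : IsOpen U) {f : ℂ → ℂ}
    (hf : DifferentiableOn ℂ f U) (hi : InjOn f U) {z : ℂ} (hz : z ∈ U) : deriv f z ≠ 0 :=
  fun h => by simpa [h] using InjOn.deriv_mul_deriv_invFunOn hU hf hi hz

/-- Hurwitz' theorem: a nonconstant limit of injective holomorphic functions is injective. -/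
theorem injOn_of_tendstoLocallyUniformlyOn {ι : Type*} {l : Filter ι} [l.NeBot] {U : Set ℂ}
    (hU : IsOpen U) (hUc : IsPreconnected U) {f : ι → ℂ → ℂ} {F : ℂ → ℂ}
    (hf : ∀ n, DifferentiableOn ℂ (f n) U) (hi : ∀ n, InjOn (f n) U)
    (hlim : TendstoLocallyUniformlyOn f F l U) (hF : ¬ ∃ c, ∀ z ∈ U, F z = c) : InjOn F U := by
  have hFd : DifferentiableOn ℂ F U := hlim.differentiableOn (Eventually.of_forall hf) hU
  have hFa : AnalyticOnNhd ℂ F U := hFd.analyticOnNhd hU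
  intro a ha b hb hab
  by_contra hne
  have h1 : ∀ᶠ z in 𝓝[≠] a, F z ≠ F b := by
    have h2 : AnalyticAt ℂ (fun z => F z - F b) a := (hFa a ha).sub analyticAt_const
    rcases h2.eventually_eq_zero_or_eventually_ne_zero with h | h
    · exfalso
      refine hF ⟨F b, fun z hz => ?_⟩
      exact hFa.eqOn_of_preconnected_of_eventuallyEq analyticOnNhd_const hUc ha
        (h.mono fun z hz => sub_eq_zero.mp hz) hz
    · exact h.mono fun z hz => sub_ne_zero.mp hz
  obtain ⟨ε₀, hε₀, hball⟩ := Metric.eventually_nhds_iff_ball.mp (eventually_nhdsWithin_iff.mp h1)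
  obtain ⟨ε₁, hε₁, hball₁⟩ := Metric.isOpen_iff.mp hU a ha
  obtain ⟨r, hr, hr₀, hr₁, hrb⟩ : ∃ r > 0, r < ε₀ ∧ r < ε₁ ∧ r < dist b a := by
    have : 0 < dist b a := dist_pos.mpr (Ne.symm hne)
    refine ⟨min ε₀ (min ε₁ (dist b a)) / 2, by positivity, ?_, ?_, ?_⟩
    all_goals
      have h1 := min_le_left ε₀ (min ε₁ (dist b a))
      have h2 := min_le_right ε₀ (min ε₁ (dist b a))
      have h3 := min_le_left ε₁ (dist b a)
      have h4 := min_le_right ε₁ (dist b a)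
      linarith
  have hcU : closedBall a r ⊆ U := (closedBall_subset_ball hr₁).trans hball₁
  have hKc : IsCompact (closedBall a r ∪ {b}) := (isCompact_closedBall a r).union isCompact_singleton
  have hKU : closedBall a r ∪ {b} ⊆ U := union_subset hcU (by simpa using hb)
  obtain ⟨x₁, hx₁, hmin⟩ := (isCompact_sphere a r).exists_isMinOn
    (NormedSpace.sphere_nonempty.mpr hr.le)
    ((hFd.continuousOn.mono (sphere_subset_closedBall.trans hcU)).sub continuousOn_const).norm
    (f := fun z => ‖F z - F b‖)
  set ε := ‖F x₁ - F b‖ with hε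
  have hεpos : 0 < ε := by
    rw [hε, norm_pos_iff, sub_ne_zero]
    refine hball x₁ ?_ ?_
    · rw [mem_ball, mem_sphere.mp hx₁]; exact hr₀
    · rintro rfl; simp at hx₁; linarith
  have hunif := (tendstoLocallyUniformlyOn_iff_forall_isCompact hU).mp hlim _ hKU hKc
  rw [Metric.tendstoUniformlyOn_iff] at hunif
  obtain ⟨n, hn⟩ := (hunif (ε / 8) (by positivity)).exists
  have hnb := hn b (Or.inr rfl)
  have hbn : b ∉ closedBall a r := by simpa using hrb
  have hg0 : ∀ z ∈ closedBall a r, f n z - f n b ≠ 0 := fun z hz h =>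
    hbn ((hi n) (hcU hz) hb (sub_eq_zero.mp h) ▸ hz)
  -- Injectivity of $f_n$ keeps $f_n-f_n(b)$ free of zeros on the disk, so the maximum principle
  -- applies to its reciprocal. On the circle $|f_n-f_n(b)|\ge 3\varepsilon/4$, whereas at $a$ it is
  -- below $\varepsilon/4$ because $F(a)=F(b)$.
  have hgd : DiffContOnCl ℂ (fun z => (f n z - f n b)⁻¹) (ball a r) := by
    apply DifferentiableOn.diffContOnCl
    rw [closure_ball a hr.ne']
    exact (((hf n).mono hcU).sub_const _).inv hg0
  have hmax := Complex.norm_le_of_forall_mem_frontier_norm_le (C := 4 / (3 * ε)) isBounded_ball hgd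
    (fun z hz => by
      rw [frontier_ball a hr.ne'] at hz
      have h2 : ε ≤ ‖F z - F b‖ := hmin hz
      have h3 := hn z (Or.inl (sphere_subset_closedBall hz))
      rw [dist_eq_norm] at h3 hnb
      have h4 : ‖F z - F b‖ ≤ ‖F z - f n z‖ + ‖f n z - f n b‖ + ‖F b - f n b‖ := by
        have : F z - F b = (F z - f n z) + (f n z - f n b) - (F b - f n b) := by ring
        rw [this]
        exact (norm_sub_le _ _).trans (add_le_add_left (norm_add_le _ _) _)
      have h5 : 3 * ε / 4 ≤ ‖f n z - f n b‖ := by linarith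
      rw [norm_inv, inv_le_comm₀ (by linarith) (by positivity), inv_div]
      exact h5) (subset_closure (mem_ball_self hr))
  have hna := hn a (Or.inl (mem_closedBall_self hr.le))
  rw [dist_eq_norm] at hna hnb
  have h4 : ‖f n a - f n b‖ ≤ ‖F a - f n a‖ + ‖F b - f n b‖ := by
    have : f n a - f n b = -(F a - f n a) + (F b - f n b) := by rw [hab]; ring
    rw [this]
    exact (norm_add_le _ _).trans (by rw [norm_neg])
  have h5 : 0 < ‖f n a - f n b‖ := norm_pos_iff.mpr (hg0 a (mem_closedBall_self hr.le))
  rw [norm_inv, inv_le_comm₀ h5 (by positivity), inv_div] at hmax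
  linarith

/-- Montel's theorem, in terms of ultrafilters. -/
theorem exists_tendstoLocallyUniformlyOn {ι : Type*} (l : Ultrafilter ι) {U : Set ℂ} (hU : IsOpen U)
    {f : ι → ℂ → ℂ} {M : ℝ} (hf : ∀ n, DifferentiableOn ℂ (f n) U)
    (hM : ∀ n, ∀ z ∈ U, ‖f n z‖ ≤ M) :
    ∃ F : ℂ → ℂ, TendstoLocallyUniformlyOn f F l U := by
  have hpt : ∀ z ∈ U, ∃ w, Tendsto (fun n => f n z) l (𝓝 w) := by
    intro z hz
    have h1 : ((l.map fun n => f n z : Ultrafilter ℂ) : Filter ℂ) ≤ 𝓟 (closedBall 0 M) := by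
      rw [le_principal_iff]
      exact Filter.mem_map.mpr (Filter.univ_mem' fun n => by simpa using hM n z hz)
    obtain ⟨w, -, hw⟩ := (isCompact_closedBall (0 : ℂ) M).ultrafilter_le_nhds _ h1
    exact ⟨w, hw⟩
  choose! F hF using hpt
  refine ⟨F, ?_⟩
  rw [Metric.tendstoLocallyUniformlyOn_iff]
  intro ε hε z hz
  obtain ⟨R, hR, hball⟩ := Metric.isOpen_iff.mp hU z hz
  have hM0 : 0 ≤ M := by
    obtain ⟨n⟩ := (l : Filter ι).nonempty_of_neBot
    exact (norm_nonneg _).trans (hM n z hz)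
  -- The Schwarz lemma on the ball of radius $R$ gives the Lipschitz constant $2M/R$; this `δ` makes
  -- the oscillation at most $\varepsilon/4$ for all the functions at once.
  set δ := min R (ε * R / (8 * (M + 1))) with hδ
  have hδpos : 0 < δ := by positivity
  have hlip : ∀ n, ∀ y ∈ ball z δ, dist (f n y) (f n z) ≤ ε / 4 := by
    intro n y hy
    have h1 := Complex.dist_le_div_mul_dist_of_mapsTo_ball (R₂ := 2 * M) ((hf n).mono hball)
      (fun x hx => by
        rw [mem_closedBall, dist_eq_norm]
        exact (norm_sub_le _ _).trans (by linarith [hM n x (hball hx), hM n z hz]))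
      (ball_subset_ball (min_le_left _ _) hy)
    refine h1.trans ?_
    have h2 : dist y z ≤ ε * R / (8 * (M + 1)) := (le_of_lt hy).trans (min_le_right _ _)
    calc 2 * M / R * dist y z ≤ 2 * M / R * (ε * R / (8 * (M + 1))) := by gcongr
      _ = ε / 4 * (M / (M + 1)) := by field_simp; ring
      _ ≤ ε / 4 * 1 := by
        gcongr
        rw [div_le_one (by linarith)]; linarith
      _ = ε / 4 := mul_one _
  have hlipF : ∀ y ∈ ball z δ, dist (F y) (F z) ≤ ε / 4 := by
    intro y hy
    have hyU := hball (ball_subset_ball (min_le_left _ _) hy)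
    exact le_of_tendsto ((hF y hyU).dist (hF z hz)) (Eventually.of_forall fun n => hlip n y hy)
  refine ⟨ball z δ, mem_nhdsWithin_of_mem_nhds (ball_mem_nhds z hδpos), ?_⟩
  filter_upwards [Metric.tendsto_nhds.mp (hF z hz) (ε / 4) (by positivity)] with n hn y hy
  calc dist (F y) (f n y) ≤ dist (F y) (F z) + dist (F z) (f n z) + dist (f n z) (f n y) :=
        dist_triangle4 _ _ _ _
    _ < ε := by
      rw [dist_comm (F z), dist_comm (f n z) (f n y)]
      linarith [hlipF y hy, hlip n y hy]

/-! ### The Riemann mapping theorem by Koebe's extremal argument. -/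

/-- The automorphism `z ↦ (z + q) / (1 + q̄ z)` of the unit disk. -/
noncomputable def diskMobius (q z : ℂ) : ℂ := (z + q) / (1 + conj q * z)

theorem diskMobius_den_ne_zero {q z : ℂ} (hq : ‖q‖ < 1) (hz : ‖z‖ < 1) : 1 + conj q * z ≠ 0 := by
  intro h
  have h1 : conj q * z = -1 := by linear_combination h
  have h2 : ‖q‖ * ‖z‖ = 1 := by
    rw [← Complex.norm_conj q, ← norm_mul, h1, norm_neg, norm_one]
  nlinarith [norm_nonneg q, norm_nonneg z]

theorem hasDerivAt_diskMobius {q z : ℂ} (hq : ‖q‖ < 1) (hz : ‖z‖ < 1) :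
    HasDerivAt (diskMobius q) ((1 - ‖q‖ ^ 2) / (1 + conj q * z) ^ 2) z := by
  have hd := diskMobius_den_ne_zero hq hz
  have h1 := ((hasDerivAt_id z).add_const q).div
    (((hasDerivAt_id z).const_mul (conj q)).const_add 1) hd
  refine h1.congr_deriv ?_
  simp only [id]
  have : (‖q‖ : ℂ) ^ 2 = conj q * q := by rw [Complex.conj_mul']
  rw [this]
  ring

theorem norm_diskMobius_lt {q z : ℂ} (hq : ‖q‖ < 1) (hz : ‖z‖ < 1) : ‖diskMobius q z‖ < 1 := by
  have hd := diskMobius_den_ne_zero hq hz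
  rw [diskMobius, norm_div, div_lt_one (norm_pos_iff.mpr hd), ← sq_lt_sq₀ (norm_nonneg _)
    (norm_nonneg _), Complex.sq_norm, Complex.sq_norm]
  have h1 : normSq (1 + conj q * z) - normSq (z + q) = (1 - normSq q) * (1 - normSq z) := by
    simp only [normSq_apply, add_re, add_im, mul_re, mul_im, conj_re, conj_im, one_re, one_im]
    ring
  rw [← Complex.sq_norm q, ← Complex.sq_norm z] at h1
  have h2 : 0 < (1 - ‖q‖ ^ 2) * (1 - ‖z‖ ^ 2) := by
    apply mul_pos <;> nlinarith [norm_nonneg q, norm_nonneg z]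
  linarith

theorem diskMobius_neg_diskMobius {q z : ℂ} (hq : ‖q‖ < 1) (hz : ‖z‖ < 1) :
    diskMobius (-q) (diskMobius q z) = z := by
  have hd := diskMobius_den_ne_zero hq hz
  have hd2 := diskMobius_den_ne_zero (q := -q) (by simpa using hq) (norm_diskMobius_lt hq hz)
  rw [diskMobius, div_eq_iff hd2]
  have h : diskMobius q z * (1 + conj q * z) = z + q := div_mul_cancel₀ _ hd
  apply mul_right_cancel₀ hd
  rw [map_neg]
  linear_combination (1 + z * conj q) * h

theorem mapsTo_diskMobius {q : ℂ} (hq : ‖q‖ < 1) : MapsTo (diskMobius q) (ball 0 1) (ball 0 1) :=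
  fun z hz => by simpa using norm_diskMobius_lt hq (by simpa using hz)

theorem injOn_diskMobius {q : ℂ} (hq : ‖q‖ < 1) : InjOn (diskMobius q) (ball 0 1) :=
  LeftInvOn.injOn (f₁' := diskMobius (-q))
    fun z hz => diskMobius_neg_diskMobius hq (by simpa using hz)

theorem image_diskMobius {q : ℂ} (hq : ‖q‖ < 1) : diskMobius q '' ball 0 1 = ball 0 1 := by
  refine (mapsTo_diskMobius hq).image_subset.antisymm fun z hz => ?_
  have hq' : ‖-q‖ < 1 := by simpa using hq
  refine ⟨diskMobius (-q) z, mapsTo_diskMobius hq' hz, ?_⟩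
  simpa using diskMobius_neg_diskMobius hq' (by simpa using hz)

theorem differentiableOn_diskMobius {q : ℂ} (hq : ‖q‖ < 1) :
    DifferentiableOn ℂ (diskMobius q) (ball 0 1) := fun z hz =>
  (hasDerivAt_diskMobius hq (by simpa using hz)).differentiableAt.differentiableWithinAt

@[simp] theorem diskMobius_zero_right (q : ℂ) : diskMobius q 0 = q := by simp [diskMobius]

@[simp] theorem diskMobius_neg_self (q : ℂ) : diskMobius (-q) q = 0 := by simp [diskMobius]

/-- The normalized injective holomorphic maps into the unit disk. -/
structure IsKoebeMap (U : Set ℂ) (f : ℂ → ℂ) : Prop where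
  differentiableOn : DifferentiableOn ℂ f U
  injOn : InjOn f U
  mapsTo : MapsTo f U (ball 0 1)
  map_zero : f 0 = 0

/-- Koebe's square root trick: move the omitted value $w$ to $0$ by a disk automorphism, take a
square root, and move the image of $0$ back to $0$. With $c^2=-w$ the derivative at $0$ grows by the
factor $(1+|c|^2)/(2|c|)>1$. -/
theorem IsKoebeMap.exists_norm_deriv_gt {U : Set ℂ} (hUo : IsOpen U) (hUc : IsPreconnected U)
    (h0 : 0 ∈ U) (hex : ∀ g : ℂ → ℂ, DifferentiableOn ℂ g U → IsExactOn g U) {F : ℂ → ℂ}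
    (hF : IsKoebeMap U F) {w : ℂ} (hw : w ∈ ball (0 : ℂ) 1) (hwF : w ∉ F '' U) :
    ∃ h, IsKoebeMap U h ∧ ‖deriv F 0‖ < ‖deriv h 0‖ := by
  have hw1 : ‖w‖ < 1 := by simpa using hw
  have hw1' : ‖-w‖ < 1 := by simpa using hw
  have hFn : ∀ z ∈ U, ‖F z‖ < 1 := fun z hz => by simpa using hF.mapsTo hz
  have hBd : DifferentiableOn ℂ (fun z => diskMobius (-w) (F z)) U :=
    (differentiableOn_diskMobius hw1').comp hF.differentiableOn hF.mapsTo
  have hB0 : ∀ z ∈ U, diskMobius (-w) (F z) ≠ 0 := by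
    intro z hz h
    have h1 : diskMobius w (diskMobius (-w) (F z)) = F z := by
      simpa using diskMobius_neg_diskMobius hw1' (hFn z hz)
    rw [h, diskMobius_zero_right] at h1
    exact hwF ⟨z, hz, h1.symm⟩
  obtain ⟨L, hL, hLe⟩ := exists_log_of_isExactOn hUo hUc hex hBd hB0
  set s : ℂ → ℂ := fun z => Complex.exp (L z / 2) with hs
  have hs2 : ∀ z ∈ U, s z ^ 2 = diskMobius (-w) (F z) := by
    intro z hz
    rw [hs, ← hLe z hz, ← Complex.exp_nat_mul]
    congr 1; push_cast; ring
  have hsd : DifferentiableOn ℂ s U := (hL.div_const 2).cexp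
  have hs1 : ∀ z ∈ U, ‖s z‖ < 1 := by
    intro z hz
    have h1 : ‖s z‖ ^ 2 < 1 := by
      rw [← norm_pow, hs2 z hz]; exact norm_diskMobius_lt hw1' (hFn z hz)
    nlinarith [norm_nonneg (s z)]
  have hsi : InjOn s U := by
    intro a ha b hb hab
    apply hF.injOn ha hb
    apply injOn_diskMobius hw1' (hF.mapsTo ha) (hF.mapsTo hb)
    rw [← hs2 a ha, ← hs2 b hb, hab]
  set c := s 0 with hc
  have hc1 : ‖c‖ < 1 := hs1 0 h0
  have hc1' : ‖-c‖ < 1 := by simpa using hc1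
  have hc0 : c ≠ 0 := Complex.exp_ne_zero _
  have hc2 : c ^ 2 = -w := by
    rw [hc, hs2 0 h0, hF.map_zero, diskMobius_zero_right]
  refine ⟨fun z => diskMobius (-c) (s z), ⟨?_, ?_, ?_, ?_⟩, ?_⟩
  · exact (differentiableOn_diskMobius hc1').comp hsd (fun z hz => by simpa using hs1 z hz)
  · intro a ha b hb hab
    exact hsi ha hb (injOn_diskMobius hc1' (by simpa using hs1 a ha) (by simpa using hs1 b hb) hab)
  · exact fun z hz => mapsTo_diskMobius hc1' (by simpa using hs1 z hz)
  · simp only [← hc, diskMobius_neg_self]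
  · have hFd := (hF.differentiableOn.differentiableAt (hUo.mem_nhds h0)).hasDerivAt
    have hsd0 := (hsd.differentiableAt (hUo.mem_nhds h0)).hasDerivAt
    have e1 : HasDerivAt (fun z => diskMobius (-w) (F z)) ((1 - ‖w‖ ^ 2) * deriv F 0) 0 := by
      have h1 := hasDerivAt_diskMobius hw1' (z := F 0) (by simp [hF.map_zero])
      refine (h1.comp 0 hFd).congr_deriv ?_
      simp [hF.map_zero]
    have e2 : HasDerivAt (fun z => s z ^ 2) (2 * c * deriv s 0) 0 := by
      refine (hsd0.pow 2).congr_deriv ?_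
      simp [hc]
    have e3 : 2 * c * deriv s 0 = (1 - ‖w‖ ^ 2) * deriv F 0 := by
      refine (e2.congr_of_eventuallyEq ?_).unique e1
      filter_upwards [hUo.mem_nhds h0] with z hz using (hs2 z hz).symm
    have e4 : HasDerivAt (fun z => diskMobius (-c) (s z)) (deriv s 0 / (1 - ‖c‖ ^ 2)) 0 := by
      have h1 := hasDerivAt_diskMobius hc1' (z := s 0) hc1
      refine (h1.comp 0 hsd0).congr_deriv ?_
      have : conj (-c) * s 0 = - (‖c‖ : ℂ) ^ 2 := by
        rw [← Complex.conj_mul', ← hc, map_neg]; ring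
      rw [this, norm_neg, ← sub_eq_add_neg]
      have hne : (1 - (‖c‖ : ℂ) ^ 2) ≠ 0 := by
        norm_cast
        nlinarith [norm_nonneg c]
      field_simp
    rw [e4.deriv]
    have hwc : ‖w‖ = ‖c‖ ^ 2 := by rw [← norm_pow, hc2, norm_neg]
    have hne : deriv F 0 ≠ 0 := InjOn.deriv_ne_zero hUo hF.differentiableOn hF.injOn h0
    have hpos : 0 < ‖deriv F 0‖ := norm_pos_iff.mpr hne
    have hcp : 0 < ‖c‖ := norm_pos_iff.mpr hc0
    have e5 : 2 * ‖c‖ * ‖deriv s 0‖ = (1 - ‖w‖ ^ 2) * ‖deriv F 0‖ := by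
      have := congrArg norm e3
      rw [norm_mul, norm_mul, norm_mul] at this
      have h3 : ‖(1 - (‖w‖ : ℂ) ^ 2)‖ = 1 - ‖w‖ ^ 2 := by
        have : (1 - (‖w‖ : ℂ) ^ 2) = ((1 - ‖w‖ ^ 2 : ℝ) : ℂ) := by push_cast; ring
        rw [this, Complex.norm_real, Real.norm_of_nonneg]
        nlinarith [norm_nonneg w]
      simpa [h3] using this
    have h4 : 0 < 1 - ‖c‖ ^ 2 := by nlinarith [norm_nonneg c]
    have h3 : ‖(1 - (‖c‖ : ℂ) ^ 2)‖ = 1 - ‖c‖ ^ 2 := by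
      have : (1 - (‖c‖ : ℂ) ^ 2) = ((1 - ‖c‖ ^ 2 : ℝ) : ℂ) := by push_cast; ring
      rw [this, Complex.norm_real, Real.norm_of_nonneg h4.le]
    rw [norm_div, h3, lt_div_iff₀ h4]
    rw [hwc] at e5
    have h5 : ‖deriv s 0‖ = (1 - ‖c‖ ^ 2) * ((1 + ‖c‖ ^ 2) * ‖deriv F 0‖ / (2 * ‖c‖)) := by
      field_simp
      linarith
    rw [h5, mul_comm ‖deriv F 0‖]
    apply mul_lt_mul_of_pos_left _ h4
    rw [lt_div_iff₀ (by positivity)]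
    -- The inequality $2|c|<1+|c|^2$ in the form $(1-|c|)^2>0$.
    nlinarith [mul_pos hpos (sq_pos_of_pos (sub_pos.mpr hc1))]

/-- A limit of a maximizing sequence exists by Montel. Its derivative at $0$ is the positive
supremum, so it is not constant and Hurwitz makes it injective; its image is open in the closed
disk, hence inside the open one. -/
theorem exists_isKoebeMap_max {U : Set ℂ} (hUo : IsOpen U) (hUc : IsPreconnected U)
    (h0 : 0 ∈ U) (hb : Bornology.IsBounded U) :
    ∃ F, IsKoebeMap U F ∧ ∀ h, IsKoebeMap U h → ‖deriv h 0‖ ≤ ‖deriv F 0‖ := by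
  obtain ⟨r, hr, hball⟩ := Metric.isOpen_iff.mp hUo 0 h0
  set S : Set ℝ := {x | ∃ h, IsKoebeMap U h ∧ ‖deriv h 0‖ = x} with hS
  have hbdd : BddAbove S := by
    refine ⟨1 / r, ?_⟩
    rintro _ ⟨h, hh, rfl⟩
    refine Complex.norm_deriv_le_div_of_mapsTo_ball (hh.differentiableOn.mono hball) ?_ hr
    rw [hh.map_zero]
    exact fun z hz => ball_subset_closedBall (hh.mapsTo (hball hz))
  have hpos : ∃ x ∈ S, 0 < x := by
    obtain ⟨R, hR⟩ := hb.subset_closedBall 0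
    have hR' : ∀ z ∈ U, ‖z‖ ≤ R := fun z hz => by simpa using hR hz
    have hR0 : 0 ≤ R := by simpa using hR' 0 h0
    have hd : HasDerivAt (fun z : ℂ => z / (R + 1 : ℝ)) (1 / (R + 1 : ℝ)) 0 :=
      (hasDerivAt_id (0 : ℂ)).div_const _
    refine ⟨_, ⟨fun z => z / (R + 1 : ℝ), ⟨by fun_prop, ?_, ?_, by simp⟩, rfl⟩, ?_⟩
    · intro a _ b _ hab
      have : ((R + 1 : ℝ) : ℂ) ≠ 0 := by norm_cast; linarith
      field_simp at hab
      exact hab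
    · intro z hz
      rw [mem_ball_zero_iff, norm_div, Complex.norm_real, Real.norm_of_nonneg (by linarith),
        div_lt_one (by linarith)]
      linarith [hR' z hz]
    · rw [hd.deriv, norm_pos_iff]
      have : ((R + 1 : ℝ) : ℂ) ≠ 0 := by norm_cast; linarith
      exact one_div_ne_zero this
  obtain ⟨x₀, hx₀, hx₀p⟩ := hpos
  obtain ⟨x, -, hxt, hxS⟩ := exists_seq_tendsto_sSup ⟨x₀, hx₀⟩ hbdd
  choose f hf hfx using hxS
  set l : Ultrafilter ℕ := hyperfilter ℕ
  obtain ⟨F, hF⟩ := exists_tendstoLocallyUniformlyOn l hUo (M := 1) (fun n => (hf n).differentiableOn)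
    (fun n z hz => by simpa using (ball_subset_closedBall ((hf n).mapsTo hz)))
  have hl : (l : Filter ℕ) ≤ atTop := by
    rw [← Nat.cofinite_eq_atTop]; exact hyperfilter_le_cofinite
  have hFd : DifferentiableOn ℂ F U :=
    hF.differentiableOn (Eventually.of_forall fun n => (hf n).differentiableOn) hUo
  have hpt : ∀ z ∈ U, Tendsto (fun n => f n z) l (𝓝 (F z)) := fun z hz => hF.tendsto_at hz
  have hF0 : F 0 = 0 :=
    tendsto_nhds_unique (hpt 0 h0) (by simp only [(hf _).map_zero]; exact tendsto_const_nhds)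
  have hder : ‖deriv F 0‖ = sSup S := by
    have h1 : Tendsto (fun n => deriv (f n) 0) l (𝓝 (deriv F 0)) :=
      (hF.deriv (Eventually.of_forall fun n => (hf n).differentiableOn) hUo).tendsto_at h0
    refine tendsto_nhds_unique h1.norm ?_
    simp only [hfx]
    exact hxt.mono_left hl
  have hsup : 0 < sSup S := hx₀p.trans_le (le_csSup hbdd hx₀)
  have hnc : ¬ ∃ c, ∀ z ∈ U, F z = c := by
    rintro ⟨c, hc⟩
    have : F =ᶠ[𝓝 0] fun _ => c := by
      filter_upwards [hUo.mem_nhds h0] with z hz using hc z hz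
    rw [this.deriv_eq] at hder
    simp at hder
    linarith
  have hFi : InjOn F U := injOn_of_tendstoLocallyUniformlyOn hUo hUc
    (fun n => (hf n).differentiableOn) (fun n => (hf n).injOn) hF hnc
  have hle : ∀ z ∈ U, ‖F z‖ ≤ 1 := fun z hz => le_of_tendsto (hpt z hz).norm
    (Eventually.of_forall fun n => by simpa using (ball_subset_closedBall ((hf n).mapsTo hz)))
  refine ⟨F, ⟨hFd, hFi, ?_, hF0⟩, fun h hh => hder ▸ le_csSup hbdd ⟨h, hh, rfl⟩⟩
  have ho := InjOn.isOpen_image hUo hFd hFi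
  have hsub : F '' U ⊆ closedBall 0 1 := by
    rintro _ ⟨z, hz, rfl⟩; simpa using hle z hz
  have := interior_maximal hsub ho
  rw [interior_closedBall _ one_ne_zero] at this
  exact fun z hz => this ⟨z, hz, rfl⟩

/-- The Riemann mapping theorem for a bounded domain on which holomorphic functions have
primitives. -/
theorem exists_riemannMap {U : Set ℂ} (hUo : IsOpen U) (hUc : IsPreconnected U)
    (h0 : 0 ∈ U) (hb : Bornology.IsBounded U)
    (hex : ∀ g : ℂ → ℂ, DifferentiableOn ℂ g U → IsExactOn g U) :
    ∃ φ : ℂ → ℂ, DifferentiableOn ℂ φ (ball 0 1) ∧ InjOn φ (ball 0 1) ∧ φ '' ball 0 1 = U ∧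
      φ 0 = 0 ∧ ∃ ρ : ℝ, 0 < ρ ∧ deriv φ 0 = ρ := by
  obtain ⟨F, hF, hmax⟩ := exists_isKoebeMap_max hUo hUc h0 hb
  have himg : F '' U = ball 0 1 := by
    refine hF.mapsTo.image_subset.antisymm fun w hw => ?_
    by_contra hwF
    obtain ⟨h, hh, hlt⟩ := hF.exists_norm_deriv_gt hUo hUc h0 hex hw hwF
    exact absurd (hmax h hh) (not_le.mpr hlt)
  set g := Function.invFunOn F U with hg
  have hgF : ∀ z ∈ U, g (F z) = z := fun z hz => hF.injOn.leftInvOn_invFunOn hz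
  have hFg : ∀ w ∈ ball (0 : ℂ) 1, F (g w) = w := by
    intro w hw
    rw [← himg] at hw
    obtain ⟨z, hz, rfl⟩ := hw; rw [hgF z hz]
  have hgd : DifferentiableOn ℂ g (ball 0 1) := by
    rw [← himg]; exact InjOn.differentiableOn_invFunOn hUo hF.differentiableOn hF.injOn
  have hg0 : g 0 = 0 := by have := hgF 0 h0; rwa [hF.map_zero] at this
  have hgd0 : deriv g 0 ≠ 0 := by
    intro h
    have := InjOn.deriv_mul_deriv_invFunOn hUo hF.differentiableOn hF.injOn h0
    rw [hF.map_zero, ← hg, h] at this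
    simp at this
  -- The rotation that makes the derivative at $0$ positive.
  set e : ℂ := conj (deriv g 0) / ‖deriv g 0‖ with he
  have hn0 : (‖deriv g 0‖ : ℂ) ≠ 0 := by simpa using hgd0
  have hen : ‖e‖ = 1 := by
    rw [he, norm_div, Complex.norm_conj, Complex.norm_real, norm_norm]
    exact div_self (by simpa using hgd0)
  have he0 : e ≠ 0 := by rw [← norm_pos_iff, hen]; exact one_pos
  have hmaps : MapsTo (fun z => e * z) (ball 0 1) (ball 0 1) := fun z hz => by
    simpa [hen] using hz
  refine ⟨fun z => g (e * z), hgd.comp (by fun_prop) hmaps, ?_, ?_, by simp [hg0],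
    ‖deriv g 0‖, norm_pos_iff.mpr hgd0, ?_⟩
  · intro a ha b hb hab
    have := congrArg F hab
    simp only [hFg _ (hmaps ha), hFg _ (hmaps hb)] at this
    exact mul_left_cancel₀ he0 this
  · ext w
    constructor
    · rintro ⟨z, hz, rfl⟩
      have h1 := hmaps hz
      rw [← himg] at h1
      obtain ⟨y, hy, hy2⟩ := h1
      have h2 : g (e * z) = y := by
        have h3 : F y = e * z := hy2
        rw [← h3, hgF y hy]
      change g (e * z) ∈ U
      rwa [h2]
    · intro hw
      refine ⟨e⁻¹ * F w, ?_, ?_⟩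
      · simpa [hen] using hF.mapsTo hw
      · change g (e * (e⁻¹ * F w)) = w
        rw [mul_inv_cancel_left₀ he0, hgF w hw]
  · have h1 : HasDerivAt (fun z => g (e * z)) (deriv g 0 * e) 0 := by
      have h2 : HasDerivAt (fun z : ℂ => e * z) e 0 := by
        simpa using (hasDerivAt_id (0 : ℂ)).const_mul e
      have h3 : HasDerivAt g (deriv g 0) (e * 0) := by
        rw [mul_zero]
        exact (hgd.differentiableAt (isOpen_ball.mem_nhds (mem_ball_self one_pos))).hasDerivAt
      exact h3.comp 0 h2
    rw [h1.deriv, he, mul_div_assoc', Complex.mul_conj']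
    field_simp

/-! ### The complement of a loop and its uniformizing maps. -/

theorem isPreconnected_setOf_lt_norm (R : ℝ) : IsPreconnected {z : ℂ | R < ‖z‖} := by
  have : {z : ℂ | R < ‖z‖} = (fun p : ℝ × ℝ => (p.1 : ℂ) * Complex.exp (p.2 * I)) '' (Ioi R ×ˢ univ) := by
    ext z
    simp only [mem_ofPred_eq, mem_image, mem_prod, mem_Ioi, mem_univ, and_true, Prod.exists]
    constructor
    · exact fun h => ⟨‖z‖, z.arg, h, Complex.norm_mul_exp_arg_mul_I z⟩
    · rintro ⟨r, θ, hr, rfl⟩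
      rw [norm_mul, Complex.norm_exp_ofReal_mul_I, mul_one, Complex.norm_real]
      exact lt_of_lt_of_le hr (le_abs_self r)
  rw [this]
  exact ((convex_Ioi R).isPreconnected.prod isPreconnected_univ).image _ (by fun_prop)

theorem isPreconnected_ball_diff_zero : IsPreconnected (ball (0 : ℂ) 1 \ {0}) := by
  have : ball (0 : ℂ) 1 \ {0} =
      (fun p : ℝ × ℝ => (p.1 : ℂ) * Complex.exp (p.2 * I)) '' (Ioo 0 1 ×ˢ univ) := by
    ext z
    simp only [Set.mem_sdiff, mem_ball_zero_iff, mem_singleton_iff, mem_image, mem_prod, mem_Ioo, mem_univ, and_true,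
      Prod.exists]
    constructor
    · exact fun h => ⟨‖z‖, z.arg, ⟨norm_pos_iff.mpr h.2, h.1⟩, Complex.norm_mul_exp_arg_mul_I z⟩
    · rintro ⟨r, θ, ⟨hr, hr1⟩, rfl⟩
      rw [norm_mul, Complex.norm_exp_ofReal_mul_I, mul_one, Complex.norm_real, Real.norm_of_nonneg hr.le]
      exact ⟨hr1, mul_ne_zero (by exact_mod_cast hr.ne') (Complex.exp_ne_zero _)⟩
  rw [this]
  exact ((convex_Ioo 0 1).isPreconnected.prod isPreconnected_univ).image _ (by fun_prop)

namespace Loop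

variable (γ : Loop ℂ)

theorem isCompact_toSet : IsCompact γ.toSet := γ.1.isCompact

theorem isConnected_toSet : IsConnected γ.toSet := by
  obtain ⟨e⟩ := γ.2
  have h1 : IsConnected (Set.range (fun c : Circle => ((e.symm c : γ.1) : ℂ))) :=
    isConnected_range (continuous_subtype_val.comp e.symm.continuous)
  convert h1
  ext z
  constructor
  · intro hz
    exact ⟨e ⟨z, hz⟩, by simp⟩
  · rintro ⟨c, rfl⟩
    exact (e.symm c).2

theorem isOpen_compl_toSet : IsOpen γ.toSetᶜ := γ.isCompact_toSet.isClosed.isOpen_compl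

theorem isOpen_component (z : ℂ) : IsOpen (connectedComponentIn γ.toSetᶜ z) :=
  γ.isOpen_compl_toSet.connectedComponentIn

/-- A component whose closure misses the loop would be clopen in the plane. -/
theorem exists_mem_closure_component {z : ℂ} (hz : z ∉ γ.toSet) :
    ∃ x ∈ γ.toSet, x ∈ closure (connectedComponentIn γ.toSetᶜ z) := by
  by_contra! h
  set C := connectedComponentIn γ.toSetᶜ z
  have hzC : z ∈ C := mem_connectedComponentIn hz
  have h1 : closure C ⊆ C := isPreconnected_connectedComponentIn.closure.subset_connectedComponentIn
    (subset_closure hzC) (fun x hx hxS => h x hxS hx)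
  have h2 : IsClopen C := ⟨closure_subset_iff_isClosed.mp h1, γ.isOpen_component z⟩
  obtain ⟨s, hs⟩ := γ.isConnected_toSet.nonempty
  have h3 : C = univ := h2.eq_univ ⟨z, hzC⟩
  exact connectedComponentIn_subset _ _ (h3 ▸ mem_univ s : s ∈ C) hs

theorem isPreconnected_union_toSet {C : Set ℂ} (hC : IsPreconnected C) {x : ℂ} (hx : x ∈ γ.toSet)
    (hxC : x ∈ closure C) : IsPreconnected (C ∪ γ.toSet) := by
  have h1 : IsPreconnected (insert x C) := hC.subset_closure (subset_insert _ _)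
    (insert_subset hxC subset_closure)
  have h2 := h1.union x (mem_insert _ _) hx γ.isConnected_toSet.isPreconnected
  rwa [insert_union, insert_eq_of_mem (show x ∈ C ∪ γ.toSet from Or.inr hx)] at h2

theorem isPreconnected_component_union {z : ℂ} (hz : z ∉ γ.toSet) :
    IsPreconnected (connectedComponentIn γ.toSetᶜ z ∪ γ.toSet) := by
  obtain ⟨x, hx, hxC⟩ := γ.exists_mem_closure_component hz
  exact γ.isPreconnected_union_toSet isPreconnected_connectedComponentIn hx hxC

theorem disjoint_component_toSet (z : ℂ) : Disjoint (connectedComponentIn γ.toSetᶜ z) γ.toSet :=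
  Set.disjoint_left.mpr fun _ hx => connectedComponentIn_subset _ _ hx

theorem isOpen_inner : IsOpen γ.inner := γ.isOpen_component 0

theorem isPreconnected_inner : IsPreconnected γ.inner := isPreconnected_connectedComponentIn

variable {γ}

theorem mem_component_symm {z w : ℂ} (h : z ∈ connectedComponentIn γ.toSetᶜ w) :
    connectedComponentIn γ.toSetᶜ z = connectedComponentIn γ.toSetᶜ w :=
  (connectedComponentIn_eq h).symm

/-- Every other component together with $\gamma$ is connected, because its closure meets $\gamma$.
The complement is the union of such sets, all sharing a point of $\gamma$; it is unbounded because
the component is bounded. -/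
theorem noHoles_component {w : ℂ} (hb : Bornology.IsBounded (connectedComponentIn γ.toSetᶜ w)) :
    NoHoles (connectedComponentIn γ.toSetᶜ w) := by
  intro a ha
  obtain ⟨s, hs⟩ := γ.isConnected_toSet.nonempty
  refine ⟨(connectedComponentIn γ.toSetᶜ w)ᶜ, ?_, disjoint_compl_left, fun h => ?_, ha⟩
  · have hS : γ.toSet ⊆ (connectedComponentIn γ.toSetᶜ w)ᶜ := fun x hx h =>
      connectedComponentIn_subset _ _ h hx
    refine isPreconnected_of_forall s fun y hy => ?_
    by_cases hyS : y ∈ γ.toSet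
    · exact ⟨γ.toSet, hS, hs, hyS, γ.isConnected_toSet.isPreconnected⟩
    · refine ⟨_, union_subset (fun x hx hxw => hy ?_) hS, Or.inr hs,
        Or.inl (mem_connectedComponentIn hyS), γ.isPreconnected_component_union hyS⟩
      rw [← mem_component_symm hxw, mem_component_symm hx]
      exact mem_connectedComponentIn hyS
  · refine NormedSpace.unbounded_univ ℝ ℂ ?_
    rw [← union_compl_self (connectedComponentIn γ.toSetᶜ w)]
    exact hb.union h

theorem Surrounds.zero_mem_inner (h : γ.Surrounds 0) : (0 : ℂ) ∈ γ.inner :=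
  mem_connectedComponentIn h.1

theorem Surrounds.isBounded_inner (h : γ.Surrounds 0) : Bornology.IsBounded γ.inner := h.2

theorem Surrounds.noHoles_inner (h : γ.Surrounds 0) : NoHoles γ.inner := noHoles_component h.2

theorem Surrounds.exists_isInnerMap (h : γ.Surrounds 0) : ∃ φ, γ.IsInnerMap φ := by
  obtain ⟨φ, h1, h2, h3, h4, h5⟩ := exists_riemannMap γ.isOpen_inner γ.isPreconnected_inner
    h.zero_mem_inner h.isBounded_inner
    (fun g hg => h.noHoles_inner.isExactOn γ.isOpen_inner γ.isPreconnected_inner hg)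
  exact ⟨φ, h1, h2, h3, h4, h5⟩

theorem Surrounds.isInnerMap (h : γ.Surrounds 0) : γ.IsInnerMap γ.innerMap :=
  Classical.epsilon_spec h.exists_isInnerMap

/-- The Riemann map of the interior carries the punctured disk onto this set. It is needed for the
exterior, since inversion sends $0$ to infinity. -/
theorem Surrounds.isPreconnected_inner_diff (h : γ.Surrounds 0) : IsPreconnected (γ.inner \ {0}) := by
  have hφ := h.isInnerMap
  have : γ.inner \ {0} = γ.innerMap '' (ball 0 1 \ {0}) := by
    rw [hφ.injective.image_sdiff_subset (by simp), hφ.image, image_singleton, hφ.map_zero]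
  rw [this]
  exact isPreconnected_ball_diff_zero.image _ (hφ.holomorphic.continuousOn.mono sdiff_subset)

theorem exists_setOf_lt_norm_subset (γ : Loop ℂ) : ∃ R > 0, γ.toSet ⊆ closedBall 0 R ∧
    ∀ w, R < ‖w‖ → γ.outer = connectedComponentIn γ.toSetᶜ w := by
  obtain ⟨R₀, hR₀⟩ := γ.isCompact_toSet.isBounded.subset_closedBall 0
  set R := max R₀ 1 with hR
  have hS : γ.toSet ⊆ closedBall 0 R := hR₀.trans (closedBall_subset_closedBall (le_max_left _ _))
  have hRpos : 0 < R := lt_of_lt_of_le one_pos (le_max_right _ _)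
  have hE : {z : ℂ | R < ‖z‖} ⊆ γ.toSetᶜ := fun z hz hzS => by
    have := hS hzS
    simp only [mem_closedBall, dist_zero_right] at this
    exact absurd hz (not_lt.mpr this)
  have hunb : ∀ C : Set ℂ, {z : ℂ | R < ‖z‖} ⊆ C → ¬ Bornology.IsBounded C := by
    intro C hC hb
    refine NormedSpace.unbounded_univ ℝ ℂ ((hb.union (isBounded_closedBall (x := (0:ℂ)) (r := R))).subset ?_)
    intro z _
    by_cases hz : R < ‖z‖
    · exact Or.inl (hC hz)
    · exact Or.inr (by simpa using hz)
  refine ⟨R, hRpos, hS, fun w hw => ?_⟩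
  have hsub : {z : ℂ | R < ‖z‖} ⊆ connectedComponentIn γ.toSetᶜ w :=
    (isPreconnected_setOf_lt_norm R).subset_connectedComponentIn hw hE
  ext z
  constructor
  · rintro ⟨hz, hzb⟩
    obtain ⟨b, hb, hbR⟩ : ∃ b ∈ connectedComponentIn γ.toSetᶜ z, R < ‖b‖ := by
      by_contra! h
      exact hzb (isBounded_iff_forall_norm_le.mpr ⟨R, h⟩)
    rw [← mem_component_symm (hsub hbR), mem_component_symm hb]
    exact mem_connectedComponentIn hz
  · intro hz
    refine ⟨connectedComponentIn_subset _ _ hz, ?_⟩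
    rw [mem_component_symm hz]
    exact hunb _ hsub

/-- The image of the exterior of a loop, including the point at infinity, under inversion. -/
def invOuter (γ : Loop ℂ) : Set ℂ := insert 0 (Inv.inv '' γ.outer)

theorem isOpen_outer (γ : Loop ℂ) : IsOpen γ.outer := by
  obtain ⟨R, hR, -, h⟩ := γ.exists_setOf_lt_norm_subset
  rw [h (R + 1 : ℝ) (by rw [Complex.norm_real, Real.norm_of_nonneg (by linarith)]; linarith)]
  exact γ.isOpen_component _

theorem isPreconnected_outer (γ : Loop ℂ) : IsPreconnected γ.outer := by
  obtain ⟨R, hR, -, h⟩ := γ.exists_setOf_lt_norm_subset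
  rw [h (R + 1 : ℝ) (by rw [Complex.norm_real, Real.norm_of_nonneg (by linarith)]; linarith)]
  exact isPreconnected_connectedComponentIn

theorem exists_lt_norm_mem_outer (γ : Loop ℂ) : ∃ R > 0, ∀ w, R < ‖w‖ → w ∈ γ.outer := by
  obtain ⟨R, hR, hS, h⟩ := γ.exists_setOf_lt_norm_subset
  refine ⟨R, hR, fun w hw => ?_⟩
  rw [h w hw]
  refine mem_connectedComponentIn fun hwS => ?_
  have := hS hwS
  simp only [mem_closedBall, dist_zero_right] at this
  linarith

theorem Surrounds.notMem_outer (h : γ.Surrounds 0) : ∀ z ∈ γ.inner, z ∉ γ.outer := by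
  rintro z hz ⟨-, h2⟩
  rw [mem_component_symm hz] at h2
  exact h2 h.2

theorem Surrounds.ne_zero_of_mem_outer (h : γ.Surrounds 0) {z : ℂ} (hz : z ∈ γ.outer) : z ≠ 0 := by
  rintro rfl
  exact h.notMem_outer 0 h.zero_mem_inner hz

theorem inv_mem_invOuter (γ : Loop ℂ) {z : ℂ} (hz : z ≠ 0) :
    z⁻¹ ∈ γ.invOuter ↔ z ∈ γ.outer := by
  simp [invOuter, hz]

theorem isOpen_invOuter (γ : Loop ℂ) : IsOpen γ.invOuter := by
  rw [isOpen_iff_mem_nhds]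
  intro z hz
  by_cases hz0 : z = 0
  · subst hz0
    obtain ⟨R, hR, hRo⟩ := γ.exists_lt_norm_mem_outer
    filter_upwards [ball_mem_nhds (0 : ℂ) (inv_pos.mpr hR)] with w hw
    by_cases hw0 : w = 0
    · exact Or.inl hw0
    · refine Or.inr ⟨w⁻¹, hRo _ ?_, inv_inv w⟩
      rw [norm_inv, lt_inv_comm₀ hR (norm_pos_iff.mpr hw0)]
      simpa using hw
  · rw [← inv_inv z, γ.inv_mem_invOuter (inv_ne_zero hz0)] at hz
    filter_upwards [(continuousAt_inv₀ hz0).eventually (γ.isOpen_outer.mem_nhds hz),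
      isOpen_ne.mem_nhds hz0] with w hw hw0
    rw [← inv_inv w, γ.inv_mem_invOuter (inv_ne_zero hw0)]
    exact hw

theorem Surrounds.isPreconnected_invOuter (h : γ.Surrounds 0) : IsPreconnected γ.invOuter := by
  have h1 : IsPreconnected (Inv.inv '' γ.outer) := γ.isPreconnected_outer.image _
    (continuousOn_inv₀.mono fun z hz => h.ne_zero_of_mem_outer hz)
  refine h1.subset_closure (subset_insert _ _) (insert_subset ?_ subset_closure)
  obtain ⟨R, hR, hRo⟩ := γ.exists_lt_norm_mem_outer
  rw [Metric.mem_closure_iff]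
  intro ε hε
  have hM : 0 < max R ε⁻¹ + 1 := by positivity
  refine ⟨((max R ε⁻¹ + 1 : ℝ) : ℂ)⁻¹, ⟨_, hRo _ ?_, rfl⟩, ?_⟩
  · rw [Complex.norm_real, Real.norm_of_nonneg hM.le]
    linarith [le_max_left R ε⁻¹]
  · rw [dist_zero_left, norm_inv, Complex.norm_real, Real.norm_of_nonneg hM.le, inv_lt_comm₀ hM hε]
    linarith [le_max_right R ε⁻¹]

theorem Surrounds.isBounded_invOuter (h : γ.Surrounds 0) : Bornology.IsBounded γ.invOuter := by
  obtain ⟨ε, hε, hball⟩ := Metric.isOpen_iff.mp γ.isOpen_inner 0 h.zero_mem_inner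
  rw [isBounded_iff_forall_norm_le]
  refine ⟨ε⁻¹, ?_⟩
  rintro z (rfl | ⟨w, hw, rfl⟩)
  · simp [hε.le]
  · rw [norm_inv]
    apply inv_anti₀ hε
    by_contra! hlt
    exact h.notMem_outer w (hball (by simpa using hlt)) hw

/-- Same argument as for the interior, applied to the complement of the exterior with $0$ deleted
and then inverted. The deletion affects only the component of $0$, which stays connected and still
accumulates on $\gamma$. -/
theorem Surrounds.noHoles_invOuter (h : γ.Surrounds 0) : NoHoles γ.invOuter := by
  intro a ha
  have hcompl : γ.invOuterᶜ = Inv.inv '' (γ.outerᶜ \ {0}) := by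
    ext z
    by_cases hz : z = 0
    · subst hz
      simp [invOuter]
    · rw [mem_compl_iff, ← inv_inv z, γ.inv_mem_invOuter (inv_ne_zero hz)]
      simp [hz]
  refine ⟨γ.invOuterᶜ, ?_, disjoint_compl_left, fun hb => ?_, ha⟩
  · rw [hcompl]
    refine IsPreconnected.image ?_ _ (continuousOn_inv₀.mono fun z hz => hz.2)
    obtain ⟨s, hs⟩ := γ.isConnected_toSet.nonempty
    have hS : γ.toSet ⊆ γ.outerᶜ \ {0} := fun x hx => ⟨fun h' => h'.1 hx, fun h' => by
      rw [mem_singleton_iff] at h'; exact h.1 (h' ▸ hx)⟩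
    refine isPreconnected_of_forall s fun y hy => ?_
    by_cases hyS : y ∈ γ.toSet
    · exact ⟨γ.toSet, hS, hs, hyS, γ.isConnected_toSet.isPreconnected⟩
    · have hyb : Bornology.IsBounded (connectedComponentIn γ.toSetᶜ y) := by
        by_contra h'
        exact hy.1 ⟨hyS, h'⟩
      have hcomp : ∀ x ∈ connectedComponentIn γ.toSetᶜ y, x ∉ γ.outer := by
        rintro x hx ⟨-, h2⟩
        rw [mem_component_symm hx] at h2
        exact h2 hyb
      by_cases hy0 : y ∈ γ.inner
      · obtain ⟨x, hx, hxC⟩ := γ.exists_mem_closure_component h.1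
        have hx0 : x ≠ 0 := fun h' => h.1 (h' ▸ hx)
        have hxC' : x ∈ closure (γ.inner \ {0}) := by
          rw [_root_.mem_closure_iff] at hxC ⊢
          intro N hN hxN
          obtain ⟨w, hw1, hw2⟩ := hxC (N ∩ {(0 : ℂ)}ᶜ)
            (hN.inter isOpen_compl_singleton) (mem_inter hxN hx0)
          exact ⟨w, hw1.1, hw2, hw1.2⟩
        exact ⟨(γ.inner \ {0}) ∪ γ.toSet,
          union_subset (fun x hx => ⟨h.notMem_outer x hx.1, hx.2⟩) hS, Or.inr hs,
          Or.inl ⟨hy0, hy.2⟩, γ.isPreconnected_union_toSet h.isPreconnected_inner_diff hx hxC'⟩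
      · refine ⟨_, union_subset (fun x hx => ⟨hcomp x hx, ?_⟩) hS, Or.inr hs,
          Or.inl (mem_connectedComponentIn hyS), γ.isPreconnected_component_union hyS⟩
        rintro rfl
        rw [inner, mem_component_symm hx] at hy0
        exact hy0 (mem_connectedComponentIn hyS)
  · refine NormedSpace.unbounded_univ ℝ ℂ ?_
    rw [← union_compl_self γ.invOuter]
    exact h.isBounded_invOuter.union hb

/-- `ψ` is the Riemann map of `γ.invOuter`. It corresponds to the outer map `z ↦ 1 / ψ(1/z)`. -/
structure IsInvOuterMap (γ : Loop ℂ) (ψ : ℂ → ℂ) (ρ : ℝ) : Prop where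
  holomorphic : DifferentiableOn ℂ ψ (ball 0 1)
  injective : InjOn ψ (ball 0 1)
  image : ψ '' ball 0 1 = γ.invOuter
  map_zero : ψ 0 = 0
  pos : 0 < ρ
  deriv_eq : deriv ψ 0 = (ρ : ℂ)⁻¹

theorem Surrounds.exists_isInvOuterMap (h : γ.Surrounds 0) : ∃ ψ ρ, γ.IsInvOuterMap ψ ρ := by
  obtain ⟨φ, h1, h2, h3, h4, ρ, h5, h6⟩ := exists_riemannMap γ.isOpen_invOuter
    h.isPreconnected_invOuter (mem_insert _ _) h.isBounded_invOuter
    (fun g hg => h.noHoles_invOuter.isExactOn γ.isOpen_invOuter h.isPreconnected_invOuter hg)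
  exact ⟨φ, ρ⁻¹, h1, h2, h3, h4, inv_pos.mpr h5, by rw [h6]; push_cast; rw [inv_inv]⟩

end Loop

/-! ### Subordination and uniqueness of the uniformizing maps. -/

/-- Holomorphic maps into the image of an injective map of the disk factor through it. -/
theorem exists_subordination {ψ f : ℂ → ℂ} (hψ : DifferentiableOn ℂ ψ (ball 0 1))
    (hi : InjOn ψ (ball 0 1)) (h0 : ψ 0 = 0) (hf : DifferentiableOn ℂ f (ball 0 1)) (hf0 : f 0 = 0)
    (hm : MapsTo f (ball 0 1) (ψ '' ball 0 1)) :
    ∃ η : ℂ → ℂ, DifferentiableOn ℂ η (ball 0 1) ∧ MapsTo η (ball 0 1) (ball 0 1) ∧ η 0 = 0 ∧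
      (∀ z ∈ ball (0 : ℂ) 1, ψ (η z) = f z) ∧ deriv ψ 0 * deriv η 0 = deriv f 0 := by
  set g := Function.invFunOn ψ (ball 0 1)
  have hgψ : ∀ z ∈ ball (0 : ℂ) 1, g (ψ z) = z := fun z hz => hi.leftInvOn_invFunOn hz
  have hz0 : (0 : ℂ) ∈ ball (0 : ℂ) 1 := mem_ball_self one_pos
  have hη0 : g (f 0) = 0 := by have := hgψ 0 hz0; rw [hf0]; rwa [h0] at this
  have hηd : DifferentiableOn ℂ (fun z => g (f z)) (ball 0 1) :=
    (InjOn.differentiableOn_invFunOn isOpen_ball hψ hi).comp hf hm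
  have hψη : ∀ z ∈ ball (0 : ℂ) 1, ψ (g (f z)) = f z := fun z hz => by
    obtain ⟨y, hy, hyz⟩ := hm hz
    rw [← hyz, hgψ y hy]
  refine ⟨fun z => g (f z), hηd, ?_, hη0, hψη, ?_⟩
  · intro z hz
    obtain ⟨y, hy, hyz⟩ := hm hz
    change g (f z) ∈ _
    rwa [← hyz, hgψ y hy]
  · have h1 := (hηd.differentiableAt (isOpen_ball.mem_nhds hz0)).hasDerivAt
    have h2 : HasDerivAt ψ (deriv ψ 0) (g (f 0)) := by
      rw [hη0]; exact (hψ.differentiableAt (isOpen_ball.mem_nhds hz0)).hasDerivAt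
    have h3 := h2.comp 0 h1
    have h4 := (hf.differentiableAt (isOpen_ball.mem_nhds hz0)).hasDerivAt
    refine (h3.congr_of_eventuallyEq ?_).unique h4
    filter_upwards [isOpen_ball.mem_nhds hz0] with z hz using (hψη z hz).symm

/-- Schwarz lemma for $\psi^{-1}\circ f$. All later comparisons of $\rho_0$ and $\rho_\infty$
between loops go through this monotonicity. -/
theorem norm_deriv_le_of_subordination {ψ f : ℂ → ℂ} (hψ : DifferentiableOn ℂ ψ (ball 0 1))
    (hi : InjOn ψ (ball 0 1)) (h0 : ψ 0 = 0) (hf : DifferentiableOn ℂ f (ball 0 1)) (hf0 : f 0 = 0)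
    (hm : MapsTo f (ball 0 1) (ψ '' ball 0 1)) : ‖deriv f 0‖ ≤ ‖deriv ψ 0‖ := by
  obtain ⟨η, h1, h2, h3, -, h4⟩ := exists_subordination hψ hi h0 hf hf0 hm
  rw [← h4, norm_mul]
  have := Complex.norm_deriv_le_one_of_mapsTo_ball h1
    (by rw [h3]; exact h2.mono_right ball_subset_closedBall) one_pos
  nlinarith [norm_nonneg (deriv ψ 0)]

theorem eqOn_id_of_deriv_eq_one {η : ℂ → ℂ} (hη : DifferentiableOn ℂ η (ball 0 1))
    (hm : MapsTo η (ball 0 1) (closedBall 0 1)) (h0 : η 0 = 0) (hd : deriv η 0 = 1) :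
    EqOn η id (ball 0 1) := by
  have h1 := Complex.affine_of_mapsTo_ball_of_norm_dslope_eq_div (z₀ := 0) hη (R₂ := 1)
    (by rwa [h0]) (mem_ball_self one_pos) (by simp [hd])
  intro z hz
  simpa [h0, hd] using h1 hz

namespace Loop

variable {γ : Loop ℂ}

/-- Subordination in both directions forces equal derivatives at $0$, and equality in the Schwarz
lemma makes the transition map the identity. -/
theorem IsInnerMap.eqOn {φ₁ φ₂ : ℂ → ℂ} (h₁ : γ.IsInnerMap φ₁) (h₂ : γ.IsInnerMap φ₂) :
    EqOn φ₁ φ₂ (ball 0 1) := by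
  have e12 := norm_deriv_le_of_subordination h₁.holomorphic h₁.injective h₁.map_zero h₂.holomorphic
    h₂.map_zero (by rw [h₁.image, ← h₂.image]; exact mapsTo_image _ _)
  have e21 := norm_deriv_le_of_subordination h₂.holomorphic h₂.injective h₂.map_zero h₁.holomorphic
    h₁.map_zero (by rw [h₂.image, ← h₁.image]; exact mapsTo_image _ _)
  obtain ⟨r₁, hr₁, hd₁⟩ := h₁.deriv_pos
  obtain ⟨r₂, hr₂, hd₂⟩ := h₂.deriv_pos
  obtain ⟨η, o1, o2, o3, o4, o5⟩ := exists_subordination h₁.holomorphic h₁.injective h₁.map_zero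
    h₂.holomorphic h₂.map_zero (by rw [h₁.image, ← h₂.image]; exact mapsTo_image _ _)
  rw [hd₁, hd₂] at e12 e21 o5
  rw [Complex.norm_real, Complex.norm_real, Real.norm_of_nonneg hr₁.le, Real.norm_of_nonneg hr₂.le]
    at e12 e21
  have hr : r₁ = r₂ := le_antisymm e21 e12
  have hη1 : deriv η 0 = 1 := by
    have : (r₂ : ℂ) ≠ 0 := by exact_mod_cast hr₂.ne'
    rw [hr] at o5
    exact mul_left_cancel₀ this (by rw [o5, mul_one])
  have hid := eqOn_id_of_deriv_eq_one o1 (o2.mono_right ball_subset_closedBall) o3 hη1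
  intro z hz
  have h := o4 z hz
  rwa [hid hz] at h

theorem IsInnerMap.eventuallyEq {φ : ℂ → ℂ} (h : γ.IsInnerMap φ) : γ.innerMap =ᶠ[𝓝 0] φ := by
  have h' : γ.IsInnerMap γ.innerMap := Classical.epsilon_spec ⟨φ, h⟩
  filter_upwards [isOpen_ball.mem_nhds (mem_ball_self one_pos)] with z hz using h'.eqOn h hz

theorem IsInnerMap.conformalRadius_eq {φ : ℂ → ℂ} (h : γ.IsInnerMap φ) :
    deriv φ 0 = γ.conformalRadius ∧ 0 < γ.conformalRadius := by
  obtain ⟨r, hr, hd⟩ := h.deriv_pos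
  rw [conformalRadius, h.eventuallyEq.deriv_eq, hd]
  exact ⟨by simp, by simpa using hr⟩

theorem IsInnerMap.u_eq {φ : ℂ → ℂ} (h : γ.IsInnerMap φ) (n : ℕ) :
    γ.u n = iteratedDeriv (n + 1) φ 0 / (Nat.factorial (n + 1) : ℂ) / (γ.conformalRadius : ℂ) := by
  rw [u, h.eventuallyEq.iteratedDeriv_eq]

theorem IsInvOuterMap.isOuterMap {ψ : ℂ → ℂ} {ρ : ℝ} (h : γ.IsInvOuterMap ψ ρ) (hs : γ.Surrounds 0) :
    γ.IsOuterMap (fun z => (ψ z⁻¹)⁻¹) ρ := by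
  have hmem : ∀ {z : ℂ}, 1 < ‖z‖ → z⁻¹ ∈ ball (0 : ℂ) 1 := fun {z} hz => by
    simpa using inv_lt_one_of_one_lt₀ hz
  have hz0 : ∀ {z : ℂ}, 1 < ‖z‖ → z ≠ 0 := fun {z} hz => norm_pos_iff.mp (one_pos.trans hz)
  have hne : ∀ w ∈ ball (0 : ℂ) 1, w ≠ 0 → ψ w ≠ 0 := fun w hw hw0 hψ =>
    hw0 (h.injective hw (mem_ball_self one_pos) (hψ.trans h.map_zero.symm))
  refine ⟨?_, ?_, ?_, h.pos, ?_⟩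
  · refine DifferentiableOn.inv (h.holomorphic.comp ?_ fun z hz => hmem hz)
      fun z hz => hne _ (hmem hz) (inv_ne_zero (hz0 hz))
    exact differentiableOn_inv.mono fun z hz => hz0 hz
  · intro a ha b hb hab
    exact inv_injective (h.injective (hmem ha) (hmem hb) (inv_injective hab))
  · ext w
    constructor
    · rintro ⟨z, hz, rfl⟩
      have h1 : ψ z⁻¹ ∈ γ.invOuter := h.image ▸ mem_image_of_mem ψ (hmem hz)
      have h2 := hne _ (hmem hz) (inv_ne_zero (hz0 hz))
      change (ψ z⁻¹)⁻¹ ∈ _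
      rwa [← γ.inv_mem_invOuter (inv_ne_zero h2), inv_inv]
    · intro hw
      have hw0 := hs.ne_zero_of_mem_outer hw
      have h1 := (γ.inv_mem_invOuter hw0).mpr hw
      rw [← h.image] at h1
      obtain ⟨y, hy, hyw⟩ := h1
      have hy0 : y ≠ 0 := by
        rintro rfl
        rw [h.map_zero] at hyw
        exact inv_ne_zero hw0 hyw.symm
      refine ⟨y⁻¹, ?_, ?_⟩
      · change 1 < ‖y⁻¹‖
        rw [norm_inv]
        exact (one_lt_inv₀ (norm_pos_iff.mpr hy0)).mpr (by simpa using hy)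
      · simp [hyw]
  · have h1 : HasDerivAt ψ (ρ : ℂ)⁻¹ 0 := by
      rw [← h.deriv_eq]
      exact (h.holomorphic.differentiableAt (isOpen_ball.mem_nhds (mem_ball_self one_pos))).hasDerivAt
    have h2 := hasDerivAt_iff_tendsto_slope.mp h1
    have hρ : (ρ : ℂ)⁻¹ ≠ 0 := inv_ne_zero (by exact_mod_cast h.pos.ne')
    have h3 := (h2.comp tendsto_inv₀_cobounded').inv₀ hρ
    rw [inv_inv] at h3
    refine h3.congr fun z => ?_
    simp [slope_def_field, h.map_zero, div_eq_mul_inv, mul_comm]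

theorem IsOuterMap.isInvOuterMap {φ : ℂ → ℂ} {ρ : ℝ} (h : γ.IsOuterMap φ ρ) (hs : γ.Surrounds 0) :
    γ.IsInvOuterMap (fun w => (Function.update (fun w => (φ w⁻¹)⁻¹) 0 0) w) ρ := by
  set ψ : ℂ → ℂ := Function.update (fun w => (φ w⁻¹)⁻¹) 0 0
  have hψ0 : ψ 0 = 0 := Function.update_self _ _ _
  have hψ : ∀ w ≠ 0, ψ w = (φ w⁻¹)⁻¹ := fun w hw => Function.update_of_ne hw _ _
  have hmem : ∀ {w : ℂ}, w ∈ ball (0 : ℂ) 1 → w ≠ 0 → 1 < ‖w⁻¹‖ := fun {w} hw hw0 => by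
    rw [norm_inv]
    exact (one_lt_inv₀ (norm_pos_iff.mpr hw0)).mpr (by simpa using hw)
  have hout : ∀ {w : ℂ}, w ∈ ball (0 : ℂ) 1 → w ≠ 0 → φ w⁻¹ ∈ γ.outer := fun hw hw0 =>
    h.image ▸ mem_image_of_mem φ (hmem hw hw0)
  have hd0 : HasDerivAt ψ (ρ : ℂ)⁻¹ 0 := by
    rw [hasDerivAt_iff_tendsto_slope]
    have hρ : (ρ : ℂ) ≠ 0 := by exact_mod_cast h.pos.ne'
    have h3 := (h.tendsto.comp tendsto_inv₀_nhdsNE_zero).inv₀ hρ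
    refine h3.congr' ?_
    filter_upwards [self_mem_nhdsWithin] with w hw
    simp [slope_def_field, hψ0, hψ w hw, div_eq_mul_inv, mul_comm]
  have hopen : IsOpen {z : ℂ | 1 < ‖z‖} := isOpen_lt continuous_const continuous_norm
  refine ⟨?_, ?_, ?_, hψ0, h.pos, hd0.deriv⟩
  · intro w hw
    apply DifferentiableAt.differentiableWithinAt
    by_cases hw0 : w = 0
    · exact hw0 ▸ hd0.differentiableAt
    · have h1 : DifferentiableAt ℂ (fun w => (φ w⁻¹)⁻¹) w := by
        have h2 : DifferentiableAt ℂ φ w⁻¹ := h.holomorphic.differentiableAt (hopen.mem_nhds (hmem hw hw0))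
        exact (h2.comp w (differentiableAt_inv hw0)).inv (hs.ne_zero_of_mem_outer (hout hw hw0))
      refine h1.congr_of_eventuallyEq ?_
      filter_upwards [isOpen_ne.mem_nhds hw0] with y hy using hψ y hy
  · intro a ha b hb hab
    change ψ a = ψ b at hab
    by_cases ha0 : a = 0 <;> by_cases hb0 : b = 0
    · rw [ha0, hb0]
    · rw [ha0, hψ0, hψ b hb0] at hab
      exact absurd hab.symm (inv_ne_zero (hs.ne_zero_of_mem_outer (hout hb hb0)))
    · rw [hb0, hψ0, hψ a ha0] at hab
      exact absurd hab (inv_ne_zero (hs.ne_zero_of_mem_outer (hout ha ha0)))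
    · rw [hψ a ha0, hψ b hb0] at hab
      exact inv_injective (h.injective (hmem ha ha0) (hmem hb hb0) (inv_injective hab))
  · ext w
    constructor
    · rintro ⟨z, hz, rfl⟩
      change ψ z ∈ _
      by_cases hz0 : z = 0
      · rw [hz0, hψ0]; exact mem_insert _ _
      · rw [hψ z hz0, γ.inv_mem_invOuter (hs.ne_zero_of_mem_outer (hout hz hz0))]
        exact hout hz hz0
    · intro hw
      by_cases hw0 : w = 0
      · exact ⟨0, mem_ball_self one_pos, hψ0.trans hw0.symm⟩
      · rw [← inv_inv w, γ.inv_mem_invOuter (inv_ne_zero hw0), ← h.image] at hw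
        obtain ⟨y, hy, hyw⟩ := hw
        have hy0 : y ≠ 0 := norm_pos_iff.mp (one_pos.trans hy)
        refine ⟨y⁻¹, ?_, ?_⟩
        · simpa using inv_lt_one_of_one_lt₀ (show 1 < ‖y‖ from hy)
        · change ψ y⁻¹ = w
          rw [hψ _ (inv_ne_zero hy0), inv_inv, hyw, inv_inv]

theorem IsInvOuterMap.norm_deriv {ψ : ℂ → ℂ} {ρ : ℝ} (h : γ.IsInvOuterMap ψ ρ) :
    ‖deriv ψ 0‖ = ρ⁻¹ := by
  rw [h.deriv_eq, norm_inv, Complex.norm_real, Real.norm_of_nonneg h.pos.le]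

theorem IsInvOuterMap.le {ψ ψ' : ℂ → ℂ} {ρ ρ' : ℝ} (h : γ.IsInvOuterMap ψ ρ)
    (h' : γ.IsInvOuterMap ψ' ρ') : ρ ≤ ρ' := by
  have := norm_deriv_le_of_subordination h.holomorphic h.injective h.map_zero h'.holomorphic
    h'.map_zero (by rw [h.image, ← h'.image]; exact mapsTo_image _ _)
  rw [h.norm_deriv, h'.norm_deriv] at this
  exact (inv_le_inv₀ h'.pos h.pos).mp this

theorem Surrounds.exists_isOuterMap (hs : γ.Surrounds 0) : ∃ φ, γ.IsOuterMap φ γ.transfiniteDiameter := by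
  obtain ⟨ψ, ρ, h⟩ := hs.exists_isInvOuterMap
  exact Classical.epsilon_spec (p := fun ρ => ∃ φ, γ.IsOuterMap φ ρ) ⟨ρ, _, h.isOuterMap hs⟩

theorem Surrounds.exists_isInvOuterMap' (hs : γ.Surrounds 0) :
    ∃ ψ, γ.IsInvOuterMap ψ γ.transfiniteDiameter := by
  obtain ⟨φ, h⟩ := hs.exists_isOuterMap
  exact ⟨_, h.isInvOuterMap hs⟩

theorem IsOuterMap.eq_transfiniteDiameter (hs : γ.Surrounds 0) {φ : ℂ → ℂ} {ρ : ℝ}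
    (h : γ.IsOuterMap φ ρ) : ρ = γ.transfiniteDiameter := by
  obtain ⟨ψ, h'⟩ := hs.exists_isInvOuterMap'
  exact ((h.isInvOuterMap hs).le h').antisymm (h'.le (h.isInvOuterMap hs))

theorem Surrounds.transfiniteDiameter_pos (hs : γ.Surrounds 0) : 0 < γ.transfiniteDiameter := by
  obtain ⟨φ, h⟩ := hs.exists_isOuterMap
  exact h.pos

end Loop

/-! ### Weak Bloch and Koebe theorems. -/

/-- A weak form of Bloch's theorem. -/
theorem exists_ball_subset_image {p : ℂ → ℂ} (hp : DifferentiableOn ℂ p (ball 0 1))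
    (hd : deriv p 0 ≠ 0) : ∃ c, ball c (‖deriv p 0‖ / 96) ⊆ p '' ball 0 1 := by
  have hp' : DifferentiableOn ℂ (deriv p) (ball 0 1) := hp.deriv isOpen_ball
  have hsub : closedBall (0 : ℂ) (1 / 2) ⊆ ball 0 1 := closedBall_subset_ball (by norm_num)
  -- Landau's choice of centre: maximizing $(\tfrac12-|z|)|p'(z)|$ gives $|p'|\le 2|p'(a)|$ on the
  -- disk about $a$ of radius half of $\tfrac12-|a|$.
  obtain ⟨a, ha, hmax⟩ := (isCompact_closedBall (0 : ℂ) (1 / 2)).exists_isMaxOn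
    ⟨0, mem_closedBall_self (by norm_num)⟩
    (f := fun z => (1 / 2 - ‖z‖) * ‖deriv p z‖)
    ((continuousOn_const.sub continuous_norm.continuousOn).mul (hp'.continuousOn.mono hsub).norm)
  have hM : ‖deriv p 0‖ / 2 ≤ (1 / 2 - ‖a‖) * ‖deriv p a‖ := by
    have h1 : (1 / 2 - ‖(0:ℂ)‖) * ‖deriv p 0‖ ≤ (1 / 2 - ‖a‖) * ‖deriv p a‖ :=
      hmax (mem_closedBall_self (by norm_num))
    rw [norm_zero] at h1; linarith
  have hdpos : 0 < ‖deriv p 0‖ := norm_pos_iff.mpr hd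
  have haa : ‖a‖ ≤ 1 / 2 := by simpa using ha
  have ha2 : 0 < 1 / 2 - ‖a‖ := by
    by_contra h
    nlinarith [norm_nonneg (deriv p a)]
  set D := ‖deriv p a‖ with hDdef
  have hD : 0 < D := by
    by_contra h
    nlinarith
  set δ := (1 / 2 - ‖a‖) / 2 with hδ
  have hδ0 : 0 < δ := by positivity
  have hball : ball a δ ⊆ closedBall 0 (1 / 2) := fun z hz => by
    have h1 : ‖z - a‖ < δ := by simpa [dist_eq_norm] using hz
    have h2 : ‖z‖ ≤ ‖z - a‖ + ‖a‖ := by simpa using norm_add_le (z - a) a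
    simp only [mem_closedBall, dist_zero_right]
    linarith
  have hbound : ∀ z ∈ ball a δ, ‖deriv p z‖ ≤ 2 * D := by
    intro z hz
    have h1 : ‖z - a‖ < δ := by simpa [dist_eq_norm] using hz
    have h2 : ‖z‖ ≤ ‖z - a‖ + ‖a‖ := by simpa using norm_add_le (z - a) a
    have h3 : (1 / 2 - ‖z‖) * ‖deriv p z‖ ≤ (1 / 2 - ‖a‖) * D := hmax (hball hz)
    have h4 : δ ≤ 1 / 2 - ‖z‖ := by linarith
    have h5 : δ * ‖deriv p z‖ ≤ δ * (2 * D) := by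
      have := mul_le_mul_of_nonneg_right h4 (norm_nonneg (deriv p z))
      have h6 : (1 / 2 - ‖a‖) * D = δ * (2 * D) := by rw [hδ]; ring
      linarith
    exact le_of_mul_le_mul_left h5 hδ0
  -- The Lipschitz bound $3D/\delta$ for $p'$ then gives $|p'-p'(a)|\le D/2$ on this disk, so
  -- $|p-p(a)|\ge Ds/2$ on its boundary and the image contains a ball of radius
  -- $Ds/4=(\tfrac12-|a|)D/48\ge|p'(0)|/96$.
  set s := δ / 6 with hs
  have hs0 : 0 < s := by positivity
  have hsδ : closedBall a s ⊆ ball a δ := closedBall_subset_ball (by linarith)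
  have hdev : ∀ z ∈ closedBall a s, ‖deriv p z - deriv p a‖ ≤ D / 2 := by
    intro z hz
    have h1 := Complex.dist_le_div_mul_dist_of_mapsTo_ball (R₂ := 3 * D)
      (hp'.mono (hball.trans hsub)) (fun y hy => by
        rw [mem_closedBall, dist_eq_norm]
        exact (norm_sub_le _ _).trans (by linarith [hbound y hy])) (hsδ hz)
    rw [dist_eq_norm] at h1
    refine h1.trans ?_
    calc 3 * D / δ * dist z a ≤ 3 * D / δ * s := by gcongr; exact hz
      _ = D / 2 := by rw [hs]; field_simp; norm_num
  have hsU : closedBall a s ⊆ ball 0 1 := (hsδ.trans hball).trans hsub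
  have hlower : ∀ z ∈ sphere a s, D * s / 2 ≤ ‖p z - p a‖ := by
    intro z hz
    have h1 := (convex_closedBall a s).norm_image_sub_le_of_norm_hasDerivWithin_le
      (f := fun z => p z - deriv p a * z) (f' := fun z => deriv p z - deriv p a)
      (fun y hy => by
        have h2 := (hp.differentiableAt (isOpen_ball.mem_nhds (hsU hy))).hasDerivAt
        have h3 := h2.sub ((hasDerivAt_id y).const_mul (deriv p a))
        rw [mul_one] at h3
        exact h3.hasDerivWithinAt) hdev (mem_closedBall_self hs0.le) (sphere_subset_closedBall hz)
    have hza : ‖z - a‖ = s := by simpa [dist_eq_norm] using hz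
    rw [hza] at h1
    have h2 : ‖deriv p a * (z - a)‖ ≤
        ‖p z - p a‖ + ‖p z - deriv p a * z - (p a - deriv p a * a)‖ := by
      have : deriv p a * (z - a) = (p z - p a) - (p z - deriv p a * z - (p a - deriv p a * a)) := by ring
      rw [this]; exact norm_sub_le _ _
    rw [norm_mul, hza] at h2
    linarith
  have hfreq : ∃ᶠ z in 𝓝 a, p z ≠ p a := by
    intro h
    have h1 : p =ᶠ[𝓝 a] fun _ => p a := h.mono fun z hz => not_not.mp hz
    have h2 : D = 0 := by rw [hDdef, h1.deriv_eq]; simp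
    exact hD.ne' h2
  have hdc : DiffContOnCl ℂ p (ball a s) := by
    apply DifferentiableOn.diffContOnCl
    rw [closure_ball a hs0.ne']
    exact hp.mono hsU
  have := hdc.ball_subset_image_closedBall hs0 hlower hfreq
  refine ⟨p a, (ball_subset_ball ?_).trans (this.trans (image_mono hsU))⟩
  have : D * s / 2 / 2 = (1 / 2 - ‖a‖) * D / 48 := by rw [hs, hδ]; ring
  rw [this]; linarith

/-- A weak form of the Koebe one quarter theorem. -/
theorem norm_deriv_le_of_notMem_image {ψ : ℂ → ℂ} (hψ : DifferentiableOn ℂ ψ (ball 0 1))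
    (hi : InjOn ψ (ball 0 1)) (h0 : ψ 0 = 0) {w : ℂ} (hw : w ∉ ψ '' ball 0 1) :
    ‖deriv ψ 0‖ ≤ 400 * ‖w‖ := by
  have hz0 : (0 : ℂ) ∈ ball (0 : ℂ) 1 := mem_ball_self one_pos
  have hw0 : w ≠ 0 := fun h => hw ⟨0, hz0, h0.trans h.symm⟩
  -- Since $e^L=1-\psi/w$ is injective, the image of $L$ contains no two points differing by $2\pi
  -- i$, so no disk of radius above $\pi$. Bloch's theorem thus bounds $|L'(0)|=|\psi'(0)|/|w|$; the
  -- constant $400$ works because $400/96>4>\pi$.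
  obtain ⟨L, hL, hLe⟩ := exists_log_of_isExactOn isOpen_ball (convex_ball (0 : ℂ) 1).isPreconnected
    (fun g hg => hg.isExactOn_ball) (f := fun z => 1 - ψ z / w)
    ((differentiableOn_const 1).sub (hψ.div_const w)) (fun z hz h => by
      have h1 : ψ z / w = 1 := (sub_eq_zero.mp h).symm
      rw [div_eq_one_iff_eq hw0] at h1
      exact hw ⟨z, hz, h1⟩)
  have hLi : ∀ y ∈ ball (0 : ℂ) 1, ∀ z ∈ ball (0 : ℂ) 1, Complex.exp (L y) = Complex.exp (L z) → y = z := by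
    intro y hy z hz h
    rw [hLe y hy, hLe z hz, sub_right_inj, div_left_inj' hw0] at h
    exact hi hy hz h
  have hd : ‖deriv L 0‖ = ‖deriv ψ 0‖ / ‖w‖ := by
    have h1 := (hL.differentiableAt (isOpen_ball.mem_nhds hz0)).hasDerivAt.cexp
    have h2 := ((hψ.differentiableAt (isOpen_ball.mem_nhds hz0)).hasDerivAt.div_const w).const_sub 1
    have h3 := (h1.congr_of_eventuallyEq (by
      filter_upwards [isOpen_ball.mem_nhds hz0] with z hz using (hLe z hz).symm)).unique h2
    rw [hLe 0 hz0, h0, zero_div, sub_zero, one_mul] at h3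
    rw [h3, norm_neg, norm_div]
  have hwpos : 0 < ‖w‖ := norm_pos_iff.mpr hw0
  by_contra! hlt
  have hbig : 400 < ‖deriv L 0‖ := by rw [hd, lt_div_iff₀ hwpos]; exact hlt
  obtain ⟨c, hc⟩ := exists_ball_subset_image hL (by
    intro h; rw [h, norm_zero] at hbig; linarith)
  have hπ : π < ‖deriv L 0‖ / 96 := by
    have := Real.pi_lt_four
    linarith
  have hmem : ∀ t : ℝ, |t| = π → c + t * I ∈ ball c (‖deriv L 0‖ / 96) := by
    intro t ht
    simp [ht, hπ]
  obtain ⟨y, hy, hyL⟩ := hc (hmem π (abs_of_pos Real.pi_pos))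
  obtain ⟨z, hz, hzL⟩ := hc (hmem (-π) (by rw [abs_neg, abs_of_pos Real.pi_pos]))
  have hyz : y = z := hLi y hy z hz (by
    rw [hyL, hzL, Complex.exp_eq_exp_iff_exists_int]
    exact ⟨1, by push_cast; ring⟩)
  rw [hyz, hzL] at hyL
  have h1 := congrArg Complex.im hyL
  simp at h1
  linarith [Real.pi_pos]

/-! ### Size, scaling and translation of loops. -/

namespace Loop

variable {γ : Loop ℂ}

theorem mem_outer_of_subset_closedBall {a : ℝ} (h : γ.toSet ⊆ closedBall 0 a) {w : ℂ} (hw : a < ‖w‖) :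
    w ∈ γ.outer := by
  have hE : {z : ℂ | a < ‖z‖} ⊆ γ.toSetᶜ := fun z hz hzS => by
    have h1 := h hzS
    simp only [mem_closedBall, dist_zero_right] at h1
    exact absurd hz (not_lt.mpr h1)
  refine ⟨hE hw, fun hb => ?_⟩
  refine NormedSpace.unbounded_univ ℝ ℂ ((hb.union (isBounded_closedBall (x := (0:ℂ)) (r := a))).subset ?_)
  intro z _
  by_cases hz : a < ‖z‖
  · exact Or.inl ((isPreconnected_setOf_lt_norm a).subset_connectedComponentIn hw hE hz)
  · exact Or.inr (by simpa using hz)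

/-- After inversion the exterior contains the disk of radius $1/a$; compare derivatives at $0$ with
$z\mapsto z/a$. -/
theorem Surrounds.transfiniteDiameter_le (hs : γ.Surrounds 0) {a : ℝ} (ha : 0 < a)
    (h : γ.toSet ⊆ closedBall 0 a) : γ.transfiniteDiameter ≤ a := by
  obtain ⟨ψ, hψ⟩ := hs.exists_isInvOuterMap'
  have h1 := norm_deriv_le_of_subordination (f := fun z => (a : ℂ)⁻¹ * z) hψ.holomorphic hψ.injective
    hψ.map_zero (by fun_prop) (by simp) (fun z hz => by
      rw [hψ.image]
      by_cases hz0 : z = 0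
      · simp [hz0, invOuter]
      · have ha' : (a : ℂ)⁻¹ * z ≠ 0 := mul_ne_zero (inv_ne_zero (by exact_mod_cast ha.ne')) hz0
        change (a : ℂ)⁻¹ * z ∈ _
        rw [← inv_inv ((a : ℂ)⁻¹ * z), γ.inv_mem_invOuter (inv_ne_zero ha')]
        apply mem_outer_of_subset_closedBall h
        rw [mul_inv, inv_inv, norm_mul, Complex.norm_real, Real.norm_of_nonneg ha.le, norm_inv]
        have h2 : 1 < ‖z‖⁻¹ := (one_lt_inv₀ (norm_pos_iff.mpr hz0)).mpr (by simpa using hz)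
        nlinarith)
  have h2 : deriv (fun z : ℂ => (a : ℂ)⁻¹ * z) 0 = (a : ℂ)⁻¹ := by
    simp
  rw [h2, hψ.norm_deriv, norm_inv, Complex.norm_real, Real.norm_of_nonneg ha.le] at h1
  exact (inv_le_inv₀ ha hψ.pos).mp h1

/-- The inverted exterior omits $z^{-1}$, so the weak Koebe theorem applies. With the preceding
bound, $\rho_\infty$ is comparable to the largest modulus on the loop. -/
theorem Surrounds.norm_le_transfiniteDiameter (hs : γ.Surrounds 0) {z : ℂ} (hz : z ∈ γ.toSet) :
    ‖z‖ ≤ 400 * γ.transfiniteDiameter := by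
  obtain ⟨ψ, hψ⟩ := hs.exists_isInvOuterMap'
  have hz0 : z ≠ 0 := fun h => hs.1 (h ▸ hz)
  have h1 := norm_deriv_le_of_notMem_image hψ.holomorphic hψ.injective hψ.map_zero (w := z⁻¹) (by
    rw [hψ.image, γ.inv_mem_invOuter hz0]
    exact fun h => h.1 hz)
  rw [hψ.norm_deriv, norm_inv] at h1
  have := norm_pos_iff.mpr hz0
  have := hψ.pos
  field_simp at h1
  linarith

/-- The image of a planar loop under a homeomorphism of the plane. -/
noncomputable def image (e : ℂ ≃ₜ ℂ) (γ : Loop ℂ) : Loop ℂ := γ.map e e.continuous e.injective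

theorem toSet_image (e : ℂ ≃ₜ ℂ) (γ : Loop ℂ) : (γ.image e).toSet = e '' γ.toSet := by
  simp [toSet, image, map]

theorem isBounded_image_homeomorph (e : ℂ ≃ₜ ℂ) {S : Set ℂ} :
    Bornology.IsBounded (e '' S) ↔ Bornology.IsBounded S := by
  have h : ∀ (e : ℂ ≃ₜ ℂ) (S : Set ℂ), Bornology.IsBounded S → Bornology.IsBounded (e '' S) := by
    intro e S hS
    exact (hS.isCompact_closure.image e.continuous).isBounded.subset (image_mono subset_closure)
  refine ⟨fun hS => ?_, h e S⟩
  have := h e.symm _ hS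
  rwa [← image_comp, Homeomorph.symm_comp_self, image_id] at this

theorem component_image (e : ℂ ≃ₜ ℂ) (γ : Loop ℂ) (z : ℂ) :
    connectedComponentIn (γ.image e).toSetᶜ (e z) = e '' connectedComponentIn γ.toSetᶜ z := by
  have hc : (γ.image e).toSetᶜ = e '' γ.toSetᶜ := by
    rw [toSet_image, image_compl_eq e.bijective]
  by_cases hz : z ∈ γ.toSetᶜ
  · rw [e.image_connectedComponentIn hz, hc]
  · rw [connectedComponentIn_eq_empty hz, image_empty, connectedComponentIn_eq_empty]
    rwa [hc, e.injective.mem_set_image]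

theorem surrounds_image (e : ℂ ≃ₜ ℂ) (γ : Loop ℂ) (z : ℂ) :
    (γ.image e).Surrounds (e z) ↔ γ.Surrounds z := by
  rw [Surrounds, component_image, isBounded_image_homeomorph, toSet_image,
    e.injective.mem_set_image, Surrounds]

theorem outer_image (e : ℂ ≃ₜ ℂ) (γ : Loop ℂ) : (γ.image e).outer = e '' γ.outer := by
  ext w
  obtain ⟨z, rfl⟩ := e.surjective w
  rw [e.injective.mem_set_image, outer, mem_ofPred_eq, component_image, isBounded_image_homeomorph,
    toSet_image, e.injective.mem_set_image]
  rfl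

/-- The loop scaled by a nonzero factor. -/
noncomputable def scale (r : ℝ) (hr : r ≠ 0) (γ : Loop ℂ) : Loop ℂ :=
  γ.image (Homeomorph.mulLeft₀ (r : ℂ) (by exact_mod_cast hr))

/-- The translate of a loop. -/
noncomputable def translate (p : ℂ) (γ : Loop ℂ) : Loop ℂ := γ.image (Homeomorph.addRight p)

theorem toSet_translate (p : ℂ) (γ : Loop ℂ) : (γ.translate p).toSet = (· + p) '' γ.toSet :=
  toSet_image _ _

theorem toSet_scale (r : ℝ) (hr : r ≠ 0) (γ : Loop ℂ) :
    (γ.scale r hr).toSet = ((r : ℂ) * ·) '' γ.toSet :=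
  toSet_image _ _

theorem surrounds_scale (r : ℝ) (hr : r ≠ 0) (γ : Loop ℂ) :
    (γ.scale r hr).Surrounds 0 ↔ γ.Surrounds 0 := by
  have := surrounds_image (Homeomorph.mulLeft₀ (r : ℂ) (by exact_mod_cast hr)) γ 0
  rw [show Homeomorph.mulLeft₀ (r : ℂ) (by exact_mod_cast hr) 0 = 0 from mul_zero _] at this
  exact this

theorem inner_scale (r : ℝ) (hr : r ≠ 0) (γ : Loop ℂ) :
    (γ.scale r hr).inner = ((r : ℂ) * ·) '' γ.inner := by
  have := component_image (Homeomorph.mulLeft₀ (r : ℂ) (by exact_mod_cast hr)) γ 0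
  rw [show Homeomorph.mulLeft₀ (r : ℂ) (by exact_mod_cast hr) 0 = 0 from mul_zero _] at this
  exact this

theorem outer_scale (r : ℝ) (hr : r ≠ 0) (γ : Loop ℂ) :
    (γ.scale r hr).outer = ((r : ℂ) * ·) '' γ.outer := outer_image _ _

theorem IsInnerMap.scale {φ : ℂ → ℂ} (h : γ.IsInnerMap φ) {r : ℝ} (hr : 0 < r) :
    (γ.scale r hr.ne').IsInnerMap (fun z => r * φ z) := by
  have hr' : (r : ℂ) ≠ 0 := by exact_mod_cast hr.ne'
  obtain ⟨ρ, hρ, hd⟩ := h.deriv_pos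
  refine ⟨h.holomorphic.const_mul _, fun a ha b hb hab => h.injective ha hb (mul_left_cancel₀ hr' hab),
    ?_, by simp [h.map_zero], r * ρ, by positivity, ?_⟩
  · rw [inner_scale, ← h.image, image_image]
  · rw [deriv_const_mul_field, hd]; push_cast; rfl

theorem IsOuterMap.scale {φ : ℂ → ℂ} {ρ : ℝ} (h : γ.IsOuterMap φ ρ) {r : ℝ} (hr : 0 < r) :
    (γ.scale r hr.ne').IsOuterMap (fun z => r * φ z) (r * ρ) := by
  have hr' : (r : ℂ) ≠ 0 := by exact_mod_cast hr.ne'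
  refine ⟨h.holomorphic.const_mul _, fun a ha b hb hab => h.injective ha hb (mul_left_cancel₀ hr' hab),
    ?_, mul_pos hr h.pos, ?_⟩
  · rw [outer_scale, ← h.image, image_image]
  · have := h.tendsto.const_mul (r : ℂ)
    push_cast
    refine this.congr fun z => by ring

theorem Surrounds.u_scale (hs : γ.Surrounds 0) {r : ℝ} (hr : 0 < r) : (γ.scale r hr.ne').u = γ.u := by
  have hr' : (r : ℂ) ≠ 0 := by exact_mod_cast hr.ne'
  have h := hs.isInnerMap
  have h' := h.scale hr
  have e1 : ((γ.scale r hr.ne').conformalRadius : ℂ) = r * γ.conformalRadius := by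
    rw [← h'.conformalRadius_eq.1, deriv_const_mul_field, h.conformalRadius_eq.1]
  ext n
  rw [h'.u_eq, h.u_eq, e1]
  have e2 : iteratedDeriv (n + 1) (fun z => (r : ℂ) * γ.innerMap z) 0 =
      r * iteratedDeriv (n + 1) γ.innerMap 0 := iteratedDeriv_const_mul_field _ _
  rw [e2]
  field_simp

theorem Surrounds.transfiniteDiameter_scale (hs : γ.Surrounds 0) {r : ℝ} (hr : 0 < r) :
    (γ.scale r hr.ne').transfiniteDiameter = r * γ.transfiniteDiameter := by
  obtain ⟨φ, h⟩ := hs.exists_isOuterMap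
  exact ((h.scale hr).eq_transfiniteDiameter ((surrounds_scale _ _ _).mpr hs)).symm

theorem surrounds_translate (p : ℂ) (γ : Loop ℂ) :
    (γ.translate (-p)).Surrounds 0 ↔ γ.Surrounds p := by
  have := surrounds_image (Homeomorph.addRight (-p)) γ p
  rw [show Homeomorph.addRight (-p) p = 0 from add_neg_cancel p] at this
  exact this

theorem surrounds_of_mem_inner (hs : γ.Surrounds 0) {p : ℂ} (hp : p ∈ γ.inner) : γ.Surrounds p := by
  refine ⟨connectedComponentIn_subset _ _ hp, ?_⟩
  rw [mem_component_symm hp]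
  exact hs.2

theorem inner_translate {p : ℂ} (hp : p ∈ γ.inner) :
    (γ.translate (-p)).inner = (· + -p) '' γ.inner := by
  have := component_image (Homeomorph.addRight (-p)) γ p
  rw [show Homeomorph.addRight (-p) p = 0 from add_neg_cancel p, mem_component_symm hp] at this
  exact this

theorem IsOuterMap.translate {φ : ℂ → ℂ} {ρ : ℝ} (h : γ.IsOuterMap φ ρ) (p : ℂ) :
    (γ.translate p).IsOuterMap (fun z => φ z + p) ρ := by
  refine ⟨h.holomorphic.add_const _, fun a ha b hb hab => h.injective ha hb (add_right_cancel hab),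
    ?_, h.pos, ?_⟩
  · rw [Loop.translate, outer_image, ← h.image, image_image]; rfl
  · have h1 : Tendsto (fun z : ℂ => p * z⁻¹) (Bornology.cobounded ℂ) (𝓝 0) := by
      simpa using tendsto_inv₀_cobounded.const_mul p
    have := h.tendsto.add h1
    rw [add_zero] at this
    exact this.congr fun z => by rw [add_div, div_eq_mul_inv p]

theorem transfiniteDiameter_translate (hs : γ.Surrounds 0) {p : ℂ} (hp : p ∈ γ.inner) :
    (γ.translate (-p)).transfiniteDiameter = γ.transfiniteDiameter := by
  obtain ⟨φ, h⟩ := hs.exists_isOuterMap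
  exact ((h.translate (-p)).eq_transfiniteDiameter
    ((surrounds_translate _ _).mpr (surrounds_of_mem_inner hs hp))).symm

/-- Change of the base point in the interior of a loop. -/
theorem IsInnerMap.translate {φ : ℂ → ℂ} (h : γ.IsInnerMap φ) {q : ℂ} (hq : q ∈ ball (0 : ℂ) 1) :
    ∃ e : ℂ, ‖e‖ = 1 ∧ (γ.translate (-φ q)).IsInnerMap (fun z => φ (diskMobius q (e * z)) + -φ q) ∧
      (γ.translate (-φ q)).conformalRadius = (1 - ‖q‖ ^ 2) * ‖deriv φ q‖ := by
  have hq1 : ‖q‖ < 1 := by simpa using hq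
  have hne : deriv φ q ≠ 0 := InjOn.deriv_ne_zero isOpen_ball h.holomorphic h.injective hq
  have hn0 : (‖deriv φ q‖ : ℂ) ≠ 0 := by simpa using hne
  set e : ℂ := conj (deriv φ q) / ‖deriv φ q‖ with he
  have hen : ‖e‖ = 1 := by
    rw [he, norm_div, Complex.norm_conj, Complex.norm_real, norm_norm]
    exact div_self (by simpa using hne)
  have he0 : e ≠ 0 := by rw [← norm_pos_iff, hen]; exact one_pos
  have hem : MapsTo (fun z => e * z) (ball 0 1) (ball 0 1) := fun z hz => by simpa [hen] using hz
  have heim : (fun z => e * z) '' ball 0 1 = ball 0 1 := by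
    refine hem.image_subset.antisymm fun z hz => ⟨e⁻¹ * z, by simpa [hen] using hz, ?_⟩
    exact mul_inv_cancel_left₀ he0 z
  have hMm := mapsTo_diskMobius hq1
  -- The automorphism contributes $1-|q|^2$, and the rotation `e` turns $\varphi'(q)$ into its
  -- modulus.
  have hd : HasDerivAt (fun z => φ (diskMobius q (e * z)) + -φ q)
      ((((1 - ‖q‖ ^ 2) * ‖deriv φ q‖ : ℝ) : ℂ)) 0 := by
    have h1 : HasDerivAt (fun z : ℂ => e * z) e 0 := by
      simpa using (hasDerivAt_id (0 : ℂ)).const_mul e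
    have h2 : HasDerivAt (diskMobius q) (1 - ‖q‖ ^ 2) (e * 0) := by
      have := hasDerivAt_diskMobius hq1 (z := e * 0) (by simp)
      simpa using this
    have h3 : HasDerivAt φ (deriv φ q) (diskMobius q (e * 0)) := by
      rw [mul_zero, diskMobius_zero_right]
      exact (h.holomorphic.differentiableAt (isOpen_ball.mem_nhds hq)).hasDerivAt
    have h4 := ((h3.comp (e * 0) h2).comp 0 h1).add_const (-φ q)
    refine h4.congr_deriv ?_
    rw [he]
    push_cast
    field_simp
    linear_combination (1 - (‖q‖ : ℂ) ^ 2) * Complex.mul_conj' (deriv φ q)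
  have hpos : 0 < (1 - ‖q‖ ^ 2) * ‖deriv φ q‖ := by
    apply mul_pos _ (norm_pos_iff.mpr hne)
    nlinarith [norm_nonneg q]
  have hmem : φ q ∈ γ.inner := h.image ▸ mem_image_of_mem φ hq
  have hinner : (γ.translate (-φ q)).IsInnerMap (fun z => φ (diskMobius q (e * z)) + -φ q) := by
    refine ⟨?_, ?_, ?_, by simp, _, hpos, hd.deriv⟩
    · exact (h.holomorphic.comp ((differentiableOn_diskMobius hq1).comp (by fun_prop) hem)
        (hMm.comp hem)).add_const _
    · intro a ha b hb hab
      exact mul_left_cancel₀ he0 (injOn_diskMobius hq1 (hem ha) (hem hb)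
        (h.injective (hMm (hem ha)) (hMm (hem hb)) (add_right_cancel hab)))
    · rw [inner_translate hmem, ← h.image]
      conv_rhs => rw [← image_diskMobius hq1, ← heim]
      simp only [image_image]
  refine ⟨e, hen, hinner, ?_⟩
  have h5 := hinner.conformalRadius_eq.1
  rw [hd.deriv] at h5
  exact_mod_cast h5.symm

end Loop

/-! ### Semicontinuity of the conformal radius and the transfinite diameter. -/

namespace Loop

instance : SecondCountableTopology (Loop ℂ) :=
  inferInstanceAs (SecondCountableTopology {K : TopologicalSpace.Compacts ℂ // Nonempty (K ≃ₜ Circle)})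

theorem isOpen_setOf_toSet_subset {U : Set ℂ} (hU : IsOpen U) : IsOpen {γ : Loop ℂ | γ.toSet ⊆ U} :=
  (TopologicalSpace.Compacts.isOpen_subsets_of_isOpen hU).preimage continuous_subtype_val

theorem isOpen_setOf_disjoint {C : Set ℂ} (hC : IsClosed C) :
    IsOpen {γ : Loop ℂ | Disjoint γ.toSet C} := by
  simpa only [← subset_compl_iff_disjoint_right] using isOpen_setOf_toSet_subset hC.isOpen_compl

theorem isOpen_setOf_notMem (z : ℂ) : IsOpen {γ : Loop ℂ | z ∉ γ.toSet} := by
  simpa using isOpen_setOf_disjoint (isClosed_singleton (x := z))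

/-- A path in the exterior from $z$ to a distant point is compact, so nearby loops avoid it too. -/
theorem isOpen_setOf_mem_outer (z : ℂ) : IsOpen {γ : Loop ℂ | z ∈ γ.outer} := by
  rw [isOpen_iff_mem_nhds]
  intro γ hz
  obtain ⟨R, hR, hS, -⟩ := γ.exists_setOf_lt_norm_subset
  set w : ℂ := ((R + 2 : ℝ) : ℂ) with hw
  have hwn : ‖w‖ = R + 2 := by rw [hw, Complex.norm_real, Real.norm_of_nonneg (by linarith)]
  have hwo : w ∈ γ.outer := mem_outer_of_subset_closedBall hS (by linarith)
  have hpc : IsPathConnected γ.outer :=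
    γ.isOpen_outer.isConnected_iff_isPathConnected.mp ⟨⟨z, hz⟩, γ.isPreconnected_outer⟩
  obtain ⟨f, hf⟩ := hpc.joinedIn z hz w hwo
  have hopen : IsOpen {γ' : Loop ℂ | γ'.toSet ⊆ ball 0 (R + 1) ∧ Disjoint γ'.toSet (range f)} :=
    (isOpen_setOf_toSet_subset isOpen_ball).inter
      (isOpen_setOf_disjoint (isCompact_range f.continuous).isClosed)
  have hmem : γ ∈ {γ' : Loop ℂ | γ'.toSet ⊆ ball 0 (R + 1) ∧ Disjoint γ'.toSet (range f)} := by
    refine ⟨hS.trans (closedBall_subset_ball (by linarith)), Set.disjoint_right.mpr ?_⟩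
    rintro _ ⟨t, rfl⟩
    exact (hf t).1
  filter_upwards [hopen.mem_nhds hmem] with γ' hγ'
  have h1 : w ∈ γ'.outer :=
    mem_outer_of_subset_closedBall (hγ'.1.trans ball_subset_closedBall) (by linarith)
  have hsub : range f ⊆ γ'.toSetᶜ := subset_compl_iff_disjoint_left.mpr hγ'.2
  have h2 : z ∈ connectedComponentIn γ'.toSetᶜ w :=
    (isPreconnected_range f.continuous).subset_connectedComponentIn ⟨1, f.target⟩ hsub ⟨0, f.source⟩
  refine ⟨hsub ⟨0, f.source⟩, ?_⟩
  rw [mem_component_symm h2]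
  exact h1.2

theorem measurableSet_setOf_surrounds : MeasurableSet {γ : Loop ℂ | γ.Surrounds 0} := by
  have : {γ : Loop ℂ | γ.Surrounds 0} = {γ | 0 ∉ γ.toSet} \ {γ | 0 ∈ γ.outer} := by
    ext γ
    simp only [mem_ofPred_eq, Set.mem_sdiff, Surrounds, outer]
    tauto
  rw [this]
  exact (isOpen_setOf_notMem 0).measurableSet.diff (isOpen_setOf_mem_outer 0).measurableSet

variable {γ : Loop ℂ}

theorem mapsTo_inner {f : ℂ → ℂ} (hf : ContinuousOn f (ball 0 1)) (h0 : f 0 = 0)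
    (hd : Disjoint γ.toSet (f '' ball 0 1)) : MapsTo f (ball 0 1) γ.inner := fun z hz =>
  (((convex_ball (0 : ℂ) 1).isPreconnected).image f hf).subset_connectedComponentIn
    ⟨0, mem_ball_self one_pos, h0⟩ (subset_compl_iff_disjoint_left.mpr hd) ⟨z, hz, rfl⟩

theorem mapsTo_invOuter {f : ℂ → ℂ} (hf : ContinuousOn f (ball 0 1)) (h0 : f 0 = 0)
    (hi : InjOn f (ball 0 1)) (hd : Disjoint γ.toSet (Inv.inv '' (f '' ball 0 1 \ {0}))) :
    MapsTo f (ball 0 1) γ.invOuter := by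
  have hne : ∀ z ∈ ball (0 : ℂ) 1 \ {0}, f z ≠ 0 := fun z hz hz0 =>
    hz.2 (hi hz.1 (mem_ball_self one_pos) (hz0.trans h0.symm))
  set S : Set ℂ := (fun z => (f z)⁻¹) '' (ball 0 1 \ {0}) with hS
  have hpre : IsPreconnected S := isPreconnected_ball_diff_zero.image _
    ((hf.mono sdiff_subset).inv₀ hne)
  have hsub : S ⊆ γ.toSetᶜ := by
    rintro _ ⟨z, hz, rfl⟩ hmem
    exact Set.disjoint_left.mp hd hmem ⟨f z, ⟨⟨z, hz.1, rfl⟩, hne z hz⟩, rfl⟩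
  obtain ⟨R, hR, hout⟩ := γ.exists_lt_norm_mem_outer
  obtain ⟨a, ha, haR⟩ : ∃ a ∈ ball (0 : ℂ) 1 \ {0}, R < ‖(f a)⁻¹‖ := by
    have h1 : Tendsto (fun z => ‖f z‖) (𝓝[≠] 0) (𝓝 0) := by
      have := (hf.continuousAt (ball_mem_nhds 0 one_pos)).norm
      rw [ContinuousAt, h0, norm_zero] at this
      exact this.mono_left nhdsWithin_le_nhds
    have h2 := h1.eventually_lt_const (inv_pos.mpr hR)
    have h3 : ∀ᶠ z in 𝓝[≠] (0 : ℂ), z ∈ ball (0 : ℂ) 1 :=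
      nhdsWithin_le_nhds (ball_mem_nhds 0 one_pos)
    obtain ⟨a, h2, h3, h4⟩ := (h2.and (h3.and self_mem_nhdsWithin)).exists
    refine ⟨a, ⟨h3, h4⟩, ?_⟩
    rw [norm_inv]
    exact (lt_inv_comm₀ hR (norm_pos_iff.mpr (hne a ⟨h3, h4⟩))).mpr h2
  have hao := hout _ haR
  intro z hz
  by_cases hz0 : z = 0
  · rw [hz0, h0]; exact mem_insert _ _
  refine mem_insert_of_mem _ ⟨(f z)⁻¹, ?_, inv_inv _⟩
  have h2 : (f z)⁻¹ ∈ connectedComponentIn γ.toSetᶜ (f a)⁻¹ :=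
    hpre.subset_connectedComponentIn ⟨a, ha, rfl⟩ hsub ⟨z, ⟨hz, hz0⟩, rfl⟩
  refine ⟨hsub ⟨z, ⟨hz, hz0⟩, rfl⟩, ?_⟩
  rw [mem_component_symm h2]
  exact hao.2

theorem isClosed_inv_image {K : Set ℂ} (hK : IsCompact K) : IsClosed (Inv.inv '' (K \ {0})) := by
  rw [← isOpen_compl_iff, isOpen_iff_mem_nhds]
  intro z hz
  have hiff : ∀ w ≠ (0 : ℂ), w ∈ (Inv.inv '' (K \ {0}))ᶜ ↔ w⁻¹ ∉ K := by
    intro w hw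
    rw [mem_compl_iff, not_iff_not]
    constructor
    · rintro ⟨x, hx, rfl⟩; rw [inv_inv]; exact hx.1
    · exact fun h => ⟨w⁻¹, ⟨h, inv_ne_zero hw⟩, inv_inv w⟩
  by_cases hz0 : z = 0
  · subst hz0
    obtain ⟨M, hM0, hM⟩ := hK.isBounded.exists_pos_norm_le
    filter_upwards [ball_mem_nhds (0 : ℂ) (inv_pos.mpr hM0)] with w hw
    by_cases hw0 : w = 0
    · rwa [hw0]
    rw [hiff w hw0]
    intro h
    have h1 := hM _ h
    rw [norm_inv] at h1
    have h2 : ‖w‖ < M⁻¹ := by simpa using hw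
    have h3 := (lt_inv_comm₀ (norm_pos_iff.mpr hw0) hM0).mp h2
    linarith
  · filter_upwards [(continuousAt_inv₀ hz0).preimage_mem_nhds
      (hK.isClosed.isOpen_compl.mem_nhds ((hiff z hz0).mp hz)), isOpen_ne.mem_nhds hz0] with w hw hw0
    exact (hiff w hw0).mpr hw

/-- The slightly shrunk exterior $\psi(\{|z|\le r\})$ is compact, so nearby loops, seen after
inversion, stay off it. Subordination gives $r/\rho\le1/\rho'$ for their transfinite diameters
$\rho'$. -/
theorem Surrounds.eventually_transfiniteDiameter_lt (hs : γ.Surrounds 0) {c : ℝ}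
    (hc : γ.transfiniteDiameter < c) :
    ∀ᶠ γ' in 𝓝 γ, γ'.Surrounds 0 → γ'.transfiniteDiameter < c := by
  obtain ⟨ψ, hψ⟩ := hs.exists_isInvOuterMap'
  have hρ := hψ.pos
  -- Any $r$ between $\rho/c$ and $1$ works: then $\rho'\le\rho/r<c$.
  obtain ⟨r, hr0, hr1⟩ := exists_between ((div_lt_one (hρ.trans hc)).mpr hc)
  have hr : 0 < r := (div_pos hρ (hρ.trans hc)).trans hr0
  have hsub : MapsTo (fun z : ℂ => (r : ℂ) * z) (ball 0 1) (ball 0 1) := fun z hz => by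
    have hz' : ‖z‖ < 1 := by simpa using hz
    rw [mem_ball_zero_iff, norm_mul, Complex.norm_real, Real.norm_of_nonneg hr.le]
    nlinarith [norm_nonneg z]
  have hcb : closedBall (0 : ℂ) r ⊆ ball 0 1 := closedBall_subset_ball hr1
  have hK : IsCompact (ψ '' closedBall 0 r) :=
    (isCompact_closedBall 0 r).image_of_continuousOn (hψ.holomorphic.continuousOn.mono hcb)
  have hdisj : Disjoint γ.toSet (Inv.inv '' (ψ '' closedBall 0 r \ {0})) := by
    rw [Set.disjoint_right]
    rintro _ ⟨w, ⟨⟨z, hz, rfl⟩, hw⟩, rfl⟩ hmem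
    have h1 : ψ z ∈ γ.invOuter := hψ.image ▸ mem_image_of_mem ψ (hcb hz)
    rw [← inv_inv (ψ z), γ.inv_mem_invOuter (inv_ne_zero hw)] at h1
    exact h1.1 hmem
  filter_upwards [(isOpen_setOf_disjoint (isClosed_inv_image hK)).mem_nhds hdisj] with γ' hγ' hs'
  obtain ⟨ψ', hψ'⟩ := hs'.exists_isInvOuterMap'
  have hr' : (r : ℂ) ≠ 0 := by exact_mod_cast hr.ne'
  have hfd : DifferentiableOn ℂ (fun z => ψ ((r : ℂ) * z)) (ball 0 1) :=
    hψ.holomorphic.comp (by fun_prop) hsub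
  have hmaps : MapsTo (fun z => ψ ((r : ℂ) * z)) (ball 0 1) γ'.invOuter := by
    refine mapsTo_invOuter hfd.continuousOn (by simp [hψ.map_zero])
      (fun a ha b hb hab => mul_left_cancel₀ hr' (hψ.injective (hsub ha) (hsub hb) hab))
      (hγ'.mono_right (image_mono (sdiff_subset_sdiff_left ?_)))
    rintro _ ⟨z, hz, rfl⟩
    refine ⟨_, ?_, rfl⟩
    have hz' : ‖z‖ < 1 := by simpa using hz
    rw [mem_closedBall_zero_iff, norm_mul, Complex.norm_real, Real.norm_of_nonneg hr.le]
    nlinarith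
  have h1 := norm_deriv_le_of_subordination hψ'.holomorphic hψ'.injective hψ'.map_zero hfd
    (by simp [hψ.map_zero]) (by rwa [hψ'.image])
  have h2 : deriv (fun z => ψ ((r : ℂ) * z)) 0 = r * deriv ψ 0 := by
    rw [deriv_comp_mul_left]; simp
  rw [h2, norm_mul, hψ.norm_deriv, hψ'.norm_deriv, Complex.norm_real, Real.norm_of_nonneg hr.le] at h1
  have hρ' := hψ'.pos
  rw [div_lt_iff₀ (hρ.trans hc)] at hr0
  have h3 : r * γ'.transfiniteDiameter ≤ γ.transfiniteDiameter := by
    rw [← div_eq_mul_inv, ← one_div, div_le_div_iff₀ hρ hρ'] at h1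
    linarith
  by_contra! h4
  nlinarith

/-- The interior analogue: $\phi_+(\{|z|\le r\})$ lies in the interior of all nearby loops
surrounding $0$, so their conformal radius is at least $r\rho_0$. -/
theorem Surrounds.eventually_lt_conformalRadius (hs : γ.Surrounds 0) {c : ℝ}
    (hc : c < γ.conformalRadius) :
    ∀ᶠ γ' in 𝓝 γ, γ'.Surrounds 0 → c < γ'.conformalRadius := by
  have hφ := hs.isInnerMap
  obtain ⟨hρe, hρ⟩ := hφ.conformalRadius_eq
  obtain ⟨r, hr0, hr1⟩ : ∃ r, max 0 (c / γ.conformalRadius) < r ∧ r < 1 :=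
    exists_between (max_lt one_pos ((div_lt_one hρ).mpr hc))
  have hr : 0 < r := (le_max_left _ _).trans_lt hr0
  have hrc : c < r * γ.conformalRadius := by
    have := (le_max_right _ _).trans_lt hr0
    rwa [div_lt_iff₀ hρ] at this
  have hsub : MapsTo (fun z : ℂ => (r : ℂ) * z) (ball 0 1) (ball 0 r) := fun z hz => by
    have hz' : ‖z‖ < 1 := by simpa using hz
    rw [mem_ball_zero_iff, norm_mul, Complex.norm_real, Real.norm_of_nonneg hr.le]
    nlinarith
  have hcb : closedBall (0 : ℂ) r ⊆ ball 0 1 := closedBall_subset_ball hr1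
  have hK : IsCompact (γ.innerMap '' closedBall 0 r) :=
    (isCompact_closedBall 0 r).image_of_continuousOn (hφ.holomorphic.continuousOn.mono hcb)
  have hdisj : Disjoint γ.toSet (γ.innerMap '' closedBall 0 r) := by
    refine Disjoint.mono_right ?_ (γ.disjoint_component_toSet 0).symm
    rintro _ ⟨z, hz, rfl⟩
    exact (hφ.image ▸ mem_image_of_mem _ (hcb hz) : γ.innerMap z ∈ γ.inner)
  filter_upwards [(isOpen_setOf_disjoint hK.isClosed).mem_nhds hdisj] with γ' hγ' hs'
  have hφ' := hs'.isInnerMap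
  obtain ⟨hρe', hρ'⟩ := hφ'.conformalRadius_eq
  have hfd : DifferentiableOn ℂ (fun z => γ.innerMap ((r : ℂ) * z)) (ball 0 1) :=
    hφ.holomorphic.comp (by fun_prop) (hsub.mono_right (ball_subset_ball hr1.le))
  have hmaps : MapsTo (fun z => γ.innerMap ((r : ℂ) * z)) (ball 0 1) γ'.inner := by
    refine mapsTo_inner hfd.continuousOn (by simp [hφ.map_zero]) (hγ'.mono_right ?_)
    rintro _ ⟨z, hz, rfl⟩
    exact ⟨_, ball_subset_closedBall (hsub hz), rfl⟩
  have h1 := norm_deriv_le_of_subordination hφ'.holomorphic hφ'.injective hφ'.map_zero hfd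
    (by simp [hφ.map_zero]) (by rwa [hφ'.image])
  have h2 : deriv (fun z => γ.innerMap ((r : ℂ) * z)) 0 = r * deriv γ.innerMap 0 := by
    rw [deriv_comp_mul_left]; simp
  rw [h2, hρe, hρe', norm_mul, Complex.norm_real, Complex.norm_real, Complex.norm_real,
    Real.norm_of_nonneg hr.le, Real.norm_of_nonneg hρ.le, Real.norm_of_nonneg hρ'.le] at h1
  linarith

theorem measurable_transfiniteDiameter :
    Measurable fun γ : {γ : Loop ℂ // γ.Surrounds 0} => γ.1.transfiniteDiameter :=
  UpperSemicontinuous.measurable fun γ _ hc => by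
    filter_upwards [continuous_subtype_val.continuousAt.eventually
      (γ.2.eventually_transfiniteDiameter_lt hc)] with γ' h using h γ'.2

theorem measurable_conformalRadius :
    Measurable fun γ : {γ : Loop ℂ // γ.Surrounds 0} => γ.1.conformalRadius :=
  LowerSemicontinuous.measurable fun γ _ hc => by
    filter_upwards [continuous_subtype_val.continuousAt.eventually
      (γ.2.eventually_lt_conformalRadius hc)] with γ' h using h γ'.2

end Loop

/-! ### Measurability of the coefficients and of marked points. -/

theorem TendstoLocallyUniformlyOn.tendsto_iteratedDeriv {ι : Type*} {l : Filter ι} {U : Set ℂ}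
    (hU : IsOpen U) {f : ι → ℂ → ℂ} {F : ℂ → ℂ} (h : TendstoLocallyUniformlyOn f F l U)
    (hf : ∀ᶠ i in l, DifferentiableOn ℂ (f i) U) {z : ℂ} (hz : z ∈ U) (n : ℕ) :
    Tendsto (fun i => iteratedDeriv n (f i) z) l (𝓝 (iteratedDeriv n F z)) := by
  have key : ∀ n : ℕ, TendstoLocallyUniformlyOn (fun i => iteratedDeriv n (f i)) (iteratedDeriv n F) l U ∧
      ∀ᶠ i in l, DifferentiableOn ℂ (iteratedDeriv n (f i)) U := by
    intro n
    induction n with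
    | zero => simpa only [iteratedDeriv_zero] using ⟨h, hf⟩
    | succ n ih =>
      simp only [iteratedDeriv_succ]
      exact ⟨ih.1.deriv ih.2 hU, ih.2.mono fun i hi => hi.deriv hU⟩
  exact (key n).1.tendsto_at hz

/-- A continuous function on the closed unit disk, holomorphic inside, that vanishes at `0`. -/
def IsDiskMap (f : ℂ → ℂ) : Prop := DiffContOnCl ℂ f (ball 0 1) ∧ f 0 = 0

theorem IsDiskMap.isCompact_image {f : ℂ → ℂ} (hf : IsDiskMap f) :
    IsCompact (f '' closedBall 0 1) :=
  (isCompact_closedBall 0 1).image_of_continuousOn hf.1.continuousOn_ball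

theorem IsDiskMap.norm_deriv_sub_le {f g : ℂ → ℂ} (hf : IsDiskMap f) (hg : IsDiskMap g) {ε : ℝ}
    (h : ∀ z ∈ closedBall (0 : ℂ) 1, ‖f z - g z‖ ≤ ε) : ‖deriv f 0 - deriv g 0‖ ≤ ε := by
  have h0 : (0 : ℂ) ∈ ball (0 : ℂ) 1 := mem_ball_self one_pos
  have h1 := norm_deriv_le_of_forall_mem_sphere_norm_le one_pos (hf.1.sub hg.1)
    (fun z hz => h z (sphere_subset_closedBall hz))
  rwa [deriv_sub (hf.1.differentiableAt isOpen_ball h0) (hg.1.differentiableAt isOpen_ball h0),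
    div_one] at h1

/-- The space of continuous functions on the closed disk is separable, and so is its subspace of
disk maps. The countable family allows a measurable choice of approximate uniformizing maps. -/
theorem exists_dense_isDiskMap : ∃ F : ℕ → ℂ → ℂ, (∀ j, IsDiskMap (F j)) ∧
    ∀ f, IsDiskMap f → ∀ ε > 0, ∃ j, ∀ z ∈ closedBall (0 : ℂ) 1, ‖F j z - f z‖ < ε := by
  have : CompactSpace (closedBall (0 : ℂ) 1) := isCompact_iff_compactSpace.mp (isCompact_closedBall _ _)
  let H := {g : C(closedBall (0 : ℂ) 1, ℂ) // ∃ f, IsDiskMap f ∧ ∀ z, g z = f z}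
  have : Nonempty H := ⟨0, 0, ⟨diffContOnCl_const, rfl⟩, fun z => rfl⟩
  choose F hF hFe using fun j => (TopologicalSpace.denseSeq H j).2
  refine ⟨F, hF, fun f hf ε hε => ?_⟩
  let g : H := ⟨⟨(closedBall (0 : ℂ) 1).domRestrict f, hf.1.continuousOn_ball.domRestrict⟩, f, hf, fun z => rfl⟩
  obtain ⟨j, hj⟩ := (TopologicalSpace.denseRange_denseSeq H).exists_dist_lt g hε
  refine ⟨j, fun z hz => ?_⟩
  have h1 := (ContinuousMap.dist_lt_iff hε).mp hj ⟨z, hz⟩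
  rw [dist_comm, dist_eq_norm] at h1
  have h2 := hFe j ⟨z, hz⟩
  rw [← h2]
  exact h1

theorem disjoint_image_of_near {S K : Set ℂ} (hS : IsCompact S) {f : ℂ → ℂ}
    (hK : IsCompact (f '' K)) (h : Disjoint S (f '' K)) :
    ∃ δ > 0, Disjoint S (cthickening δ (f '' K)) := by
  obtain ⟨δ, hδ, hd⟩ := h.exists_cthickenings hS hK.isClosed
  exact ⟨δ, hδ, hd.mono_left (self_subset_cthickening _)⟩

theorem image_subset_cthickening {K : Set ℂ} {f g : ℂ → ℂ} {δ : ℝ}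
    (h : ∀ z ∈ K, ‖g z - f z‖ ≤ δ) : g '' K ⊆ cthickening δ (f '' K) := by
  rintro _ ⟨z, hz, rfl⟩
  exact mem_cthickening_of_dist_le _ (f z) _ _ ⟨z, hz, rfl⟩ (by rw [dist_eq_norm]; exact h z hz)

namespace Loop

variable {γ : Loop ℂ}

/-- Write $f_m=\varphi\circ\eta_m$ with $\eta_m$ a self-map of the disk fixing $0$. Then
$\eta_m'(0)\to1$, so every ultrafilter limit of $\eta_m$ is the identity by equality in the Schwarz
lemma, and $f_m\to\varphi$ with all derivatives at $0$. -/
theorem IsInnerMap.tendsto_iteratedDeriv {φ : ℂ → ℂ} (hφ : γ.IsInnerMap φ)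
    (hb : Bornology.IsBounded γ.inner) {f : ℕ → ℂ → ℂ}
    (hf : ∀ m, DifferentiableOn ℂ (f m) (ball 0 1)) (hf0 : ∀ m, f m 0 = 0)
    (hm : ∀ m, MapsTo (f m) (ball 0 1) γ.inner)
    (hd : Tendsto (fun m => deriv (f m) 0) atTop (𝓝 (deriv φ 0))) (n : ℕ) :
    Tendsto (fun m => iteratedDeriv n (f m) 0) atTop (𝓝 (iteratedDeriv n φ 0)) := by
  have h00 : (0 : ℂ) ∈ ball (0 : ℂ) 1 := mem_ball_self one_pos
  have hφ0 : deriv φ 0 ≠ 0 := InjOn.deriv_ne_zero isOpen_ball hφ.holomorphic hφ.injective h00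
  obtain ⟨M, hM⟩ := hb.exists_norm_le
  choose η hη1 hη2 hη3 hη4 hη5 using fun m => exists_subordination hφ.holomorphic hφ.injective
    hφ.map_zero (hf m) (hf0 m) (by rw [hφ.image]; exact hm m)
  rw [tendsto_iff_ultrafilter]
  intro l hl
  obtain ⟨E, hE⟩ := exists_tendstoLocallyUniformlyOn l isOpen_ball hη1 (M := 1)
    (fun m z hz => by simpa using (mem_ball_zero_iff.mp (hη2 m hz)).le)
  obtain ⟨F, hF⟩ := exists_tendstoLocallyUniformlyOn l isOpen_ball hf (M := M)
    (fun m z hz => hM _ (hm m hz))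
  have hEd : DifferentiableOn ℂ E (ball 0 1) :=
    hE.differentiableOn (Eventually.of_forall hη1) isOpen_ball
  have hE0 : E 0 = 0 := by
    have := hE.tendsto_at h00
    simp only [hη3] at this
    exact (tendsto_nhds_unique this tendsto_const_nhds)
  have hE1 : deriv E 0 = 1 := by
    have h1 := (hE.deriv (Eventually.of_forall hη1) isOpen_ball).tendsto_at h00
    have h2 : Tendsto (fun m => (deriv φ 0)⁻¹ * deriv (f m) 0) l (𝓝 ((deriv φ 0)⁻¹ * deriv φ 0)) :=
      (hd.mono_left hl).const_mul _
    rw [inv_mul_cancel₀ hφ0] at h2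
    refine tendsto_nhds_unique h1 (h2.congr fun m => ?_)
    rw [← hη5 m, inv_mul_cancel_left₀ hφ0]
    rfl
  have hEm : MapsTo E (ball 0 1) (closedBall 0 1) := fun z hz =>
    isClosed_closedBall.mem_of_tendsto (hE.tendsto_at hz)
      (Eventually.of_forall fun m => ball_subset_closedBall (hη2 m hz))
  have hEid := eqOn_id_of_deriv_eq_one hEd hEm hE0 hE1
  have hFφ : EqOn F φ (ball 0 1) := by
    intro z hz
    have h1 := hE.tendsto_at hz
    rw [hEid hz] at h1
    have h2 : Tendsto (fun m => φ (η m z)) l (𝓝 (φ z)) :=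
      (hφ.holomorphic.continuousOn.continuousAt (isOpen_ball.mem_nhds hz)).tendsto.comp h1
    exact tendsto_nhds_unique (hF.tendsto_at hz) (h2.congr fun m => hη4 m z hz)
  have h1 := hF.tendsto_iteratedDeriv isOpen_ball (Eventually.of_forall hf) h00 n
  rwa [(hFφ.eventuallyEq_of_mem (isOpen_ball.mem_nhds h00)).iteratedDeriv_eq n] at h1

theorem IsInnerMap.isDiskMap_dilate {φ : ℂ → ℂ} (hφ : γ.IsInnerMap φ) {t : ℝ} (ht0 : 0 ≤ t)
    (ht : t < 1) : IsDiskMap (fun z => φ (t * z)) ∧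
      Disjoint γ.toSet ((fun z => φ (t * z)) '' closedBall 0 1) ∧
      deriv (fun z => φ (t * z)) 0 = t * deriv φ 0 := by
  have hsub : MapsTo (fun z : ℂ => (t : ℂ) * z) (closedBall 0 1) (ball 0 1) := fun z hz => by
    have hz' : ‖z‖ ≤ 1 := by simpa using hz
    rw [mem_ball_zero_iff, norm_mul, Complex.norm_real, Real.norm_of_nonneg ht0]
    nlinarith
  refine ⟨⟨DifferentiableOn.diffContOnCl ?_, by simp [hφ.map_zero]⟩, ?_, ?_⟩
  · rw [closure_ball _ one_ne_zero]
    exact hφ.holomorphic.comp (by fun_prop) hsub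
  · refine Disjoint.mono_right ?_ (γ.disjoint_component_toSet 0).symm
    rintro _ ⟨z, hz, rfl⟩
    exact (hφ.image ▸ mem_image_of_mem _ (hsub hz) : φ (t * z) ∈ γ.inner)
  · rw [deriv_comp_mul_left]; simp

theorem Surrounds.exists_isDiskMap (hs : γ.Surrounds 0) {F : ℕ → ℂ → ℂ} (hF : ∀ j, IsDiskMap (F j))
    (hFd : ∀ f, IsDiskMap f → ∀ ε > 0, ∃ j, ∀ z ∈ closedBall (0 : ℂ) 1, ‖F j z - f z‖ < ε)
    {ε : ℝ} (hε : 0 < ε) :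
    ∃ j, Disjoint γ.toSet (F j '' closedBall 0 1) ∧ ‖deriv (F j) 0 - γ.conformalRadius‖ < ε := by
  have hφ := hs.isInnerMap
  obtain ⟨hρe, hρ⟩ := hφ.conformalRadius_eq
  -- A dilate $\varphi(tz)$ extends continuously to the closed disk and keeps off the loop; $t$ is
  -- so close to $1$ that the derivative at $0$ changes by less than $\varepsilon/2$.
  obtain ⟨t, ht0, ht1⟩ : ∃ t, max 0 (1 - ε / 2 / γ.conformalRadius) < t ∧ t < 1 :=
    exists_between (max_lt one_pos (by have : 0 < ε / 2 / γ.conformalRadius := by positivity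
                                       linarith))
  have ht : 0 < t := (le_max_left _ _).trans_lt ht0
  have ht2 : 1 - t < ε / 2 / γ.conformalRadius := by
    have := (le_max_right _ _).trans_lt ht0
    linarith
  rw [lt_div_iff₀ hρ] at ht2
  obtain ⟨h1, h2, h3⟩ := hφ.isDiskMap_dilate ht.le ht1
  obtain ⟨δ, hδ, hd⟩ := disjoint_image_of_near γ.isCompact_toSet h1.isCompact_image h2
  obtain ⟨j, hj⟩ := hFd _ h1 (min δ (ε / 2)) (by positivity)
  refine ⟨j, hd.mono_right (image_subset_cthickening fun z hz =>
    (hj z hz).le.trans (min_le_left _ _)), ?_⟩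
  have h4 := (hF j).norm_deriv_sub_le h1 fun z hz => (hj z hz).le.trans (min_le_right _ _)
  rw [h3, hρe] at h4
  have h5 : ‖(t : ℂ) * γ.conformalRadius - γ.conformalRadius‖ = (1 - t) * γ.conformalRadius := by
    rw [show (t : ℂ) * γ.conformalRadius - γ.conformalRadius =
      (-((1 - t) * γ.conformalRadius) : ℝ) by push_cast; ring, Complex.norm_real, norm_neg,
      Real.norm_of_nonneg (mul_nonneg (by linarith) hρ.le)]
  calc _ ≤ ‖deriv (F j) 0 - t * γ.conformalRadius‖ + ‖(t : ℂ) * γ.conformalRadius - γ.conformalRadius‖ :=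
        norm_sub_le_norm_sub_add_norm_sub _ _ _
    _ < ε := by rw [h5]; linarith

/-- At precision $1/(m+1)$ take the first map of the dense family that avoids the loop and whose
derivative at $0$ is that close to $\rho_0$. Both conditions are measurable in the loop, and the
Taylor coefficients of the chosen maps converge. -/
theorem measurable_u (n : ℕ) : Measurable fun γ : {γ : Loop ℂ // γ.Surrounds 0} => γ.1.u n := by
  classical
  obtain ⟨F, hF, hFd⟩ := exists_dense_isDiskMap
  let p : ℕ → {γ : Loop ℂ // γ.Surrounds 0} → ℕ → Prop := fun m γ j =>
    Disjoint γ.1.toSet (F j '' closedBall 0 1) ∧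
      ‖deriv (F j) 0 - γ.1.conformalRadius‖ < 1 / ((m : ℝ) + 1)
  have hp : ∀ m γ, ∃ j, p m γ j := fun m γ =>
    γ.2.exists_isDiskMap hF hFd Nat.one_div_pos_of_nat
  have hpm : ∀ m j, MeasurableSet {γ | p m γ j} := fun m j =>
    ((isOpen_setOf_disjoint (hF j).isCompact_image.isClosed).preimage
      continuous_subtype_val).measurableSet.inter
    (measurableSet_lt (measurable_const.sub
      (Complex.measurable_ofReal.comp measurable_conformalRadius)).norm measurable_const)
  have hfind : ∀ m, Measurable fun γ => Nat.find (hp m γ) := fun m => measurable_find (hp m) (hpm m)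
  have hlim : Measurable fun γ : {γ : Loop ℂ // γ.Surrounds 0} =>
      iteratedDeriv (n + 1) γ.1.innerMap 0 := by
    refine measurable_of_tendsto_metrizable
      (f := fun m γ => iteratedDeriv (n + 1) (F (Nat.find (hp m γ))) 0)
      (fun m => (measurable_from_top (f := fun j => iteratedDeriv (n + 1) (F j) 0)).comp (hfind m)) ?_
    rw [tendsto_pi_nhds]
    intro γ
    have hφ := γ.2.isInnerMap
    refine hφ.tendsto_iteratedDeriv γ.2.isBounded_inner (fun m => (hF _).1.differentiableOn)
      (fun m => (hF _).2) (fun m => mapsTo_inner (hF _).1.differentiableOn.continuousOn (hF _).2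
        ((Nat.find_spec (hp m γ)).1.mono_right (image_mono ball_subset_closedBall))) ?_ _
    rw [hφ.conformalRadius_eq.1, tendsto_iff_norm_sub_tendsto_zero]
    exact squeeze_zero (fun _ => norm_nonneg _) (fun m => (Nat.find_spec (hp m γ)).2.le)
      tendsto_one_div_add_atTop_nhds_zero_nat
  exact (hlim.div_const _).div (Complex.measurable_ofReal.comp measurable_conformalRadius)

/-- This replaces the uniformizing map, which depends on the loop, by any disk map avoiding the
loop, a condition stable under perturbation. Dilating $\varphi$ gives one direction, Schwarz the
other. The requirement $s\ne0$ leaves room to move $f(s)$ while keeping $f(0)=0$. -/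
theorem Surrounds.mem_image_ball_iff (hs : γ.Surrounds 0) {r : ℝ} (hr0 : 0 < r) (hr : r < 1) {p : ℂ} :
    p ∈ γ.innerMap '' ball 0 r ↔ ∃ f, IsDiskMap f ∧ Disjoint γ.toSet (f '' closedBall 0 1) ∧
      ∃ s : ℂ, s ≠ 0 ∧ ‖s‖ < r ∧ f s = p := by
  have hφ := hs.isInnerMap
  constructor
  · rintro ⟨q, hq, rfl⟩
    rw [mem_ball_zero_iff] at hq
    by_cases hq0 : q = 0
    · refine ⟨0, ⟨diffContOnCl_const, rfl⟩, ?_, (r / 2 : ℝ), by simpa using hr0.ne', ?_, ?_⟩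
      · rw [Set.disjoint_right]
        rintro _ ⟨z, -, rfl⟩
        exact hs.1
      · rw [Complex.norm_real, Real.norm_of_nonneg (by linarith)]; linarith
      · rw [hq0, hφ.map_zero]; rfl
    · obtain ⟨t, ht0, ht1⟩ := exists_between ((div_lt_one hr0).mpr hq)
      have ht : 0 < t := (by positivity : 0 ≤ ‖q‖ / r).trans_lt ht0
      obtain ⟨h1, h2, -⟩ := hφ.isDiskMap_dilate ht.le ht1
      have ht' : (t : ℂ) ≠ 0 := by exact_mod_cast ht.ne'
      refine ⟨_, h1, h2, q / t, div_ne_zero hq0 ht', ?_, ?_⟩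
      · rw [norm_div, Complex.norm_real, Real.norm_of_nonneg ht.le, div_lt_iff₀ ht]
        rw [div_lt_iff₀ hr0] at ht0
        linarith
      · simp only [mul_div_cancel₀ q ht']
  · rintro ⟨f, hf, hd, s, -, hs', rfl⟩
    obtain ⟨η, hη1, hη2, hη3, hη4, -⟩ := exists_subordination hφ.holomorphic hφ.injective hφ.map_zero
      hf.1.differentiableOn hf.2 (by
        rw [hφ.image]
        exact mapsTo_inner hf.1.differentiableOn.continuousOn hf.2
          (hd.mono_right (image_mono ball_subset_closedBall)))
    have hs1 : s ∈ ball (0 : ℂ) 1 := by rw [mem_ball_zero_iff]; linarith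
    refine ⟨η s, ?_, hη4 s hs1⟩
    rw [mem_ball_zero_iff]
    exact (Complex.norm_le_norm_of_mapsTo_ball hη1 (hη2.mono_right ball_subset_closedBall) hη3
      (by linarith)).trans_lt hs'

theorem isOpen_setOf_mem_image_ball {r : ℝ} (hr0 : 0 < r) (hr : r < 1) :
    IsOpen {x : {γ : Loop ℂ // γ.Surrounds 0} × ℂ | x.2 ∈ x.1.1.innerMap '' ball 0 r} := by
  rw [isOpen_iff_mem_nhds]
  rintro ⟨γ, p⟩ hp
  rw [mem_ofPred_eq, γ.2.mem_image_ball_iff hr0 hr] at hp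
  obtain ⟨f, hf, hd, s, hs0, hs, rfl⟩ := hp
  obtain ⟨δ, hδ, hδd⟩ := disjoint_image_of_near γ.1.isCompact_toSet hf.isCompact_image hd
  have h1 : ∀ᶠ γ' in 𝓝 γ, Disjoint γ'.1.toSet (cthickening δ (f '' closedBall 0 1)) :=
    continuous_subtype_val.continuousAt.eventually
      ((isOpen_setOf_disjoint isClosed_cthickening).mem_nhds hδd)
  have hspos := norm_pos_iff.mpr hs0
  have h2 : ∀ᶠ p' in 𝓝 (f s), ‖p' - f s‖ < δ * ‖s‖ := by
    filter_upwards [ball_mem_nhds (f s) (by positivity : 0 < δ * ‖s‖)] with p' hp'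
    rwa [mem_ball, dist_eq_norm] at hp'
  filter_upwards [Filter.Eventually.prod_nhds h1 h2] with x hx
  obtain ⟨hx1, hx2⟩ := hx
  rw [x.1.2.mem_image_ball_iff hr0 hr]
  -- A linear correction moves the value at $s$ to the new point and changes $f$ by at most $\delta$
  -- on the closed disk.
  refine ⟨fun z => f z + (x.2 - f s) / s * z, ⟨hf.1.add (DifferentiableOn.diffContOnCl (by fun_prop)),
    by simp [hf.2]⟩, hx1.mono_right (image_subset_cthickening fun z hz => ?_), s, hs0, hs, ?_⟩
  · rw [add_sub_cancel_left, norm_mul, norm_div]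
    have hz' : ‖z‖ ≤ 1 := by simpa using hz
    calc _ ≤ ‖x.2 - f s‖ / ‖s‖ * 1 := by gcongr
      _ ≤ δ := by rw [mul_one, div_le_iff₀ hspos]; exact hx2.le
  · field_simp
    ring

end Loop

/-! ### Invariance of the planar measure and finiteness of a scale band. -/

namespace Loop

theorem continuous_image (e : ℂ ≃ₜ ℂ) : Continuous (Loop.image e) :=
  (e.continuous.compacts_map.comp continuous_subtype_val).subtype_mk _

theorem continuous_scale (r : ℝ) (hr : r ≠ 0) : Continuous (Loop.scale r hr) := continuous_image _

theorem continuous_translate : Continuous fun x : Loop ℂ × ℂ => x.1.translate x.2 := by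
  have h1 : Continuous fun x : Loop ℂ × ℂ => x.1.1 := continuous_subtype_val.comp continuous_fst
  have h2 : Continuous (Function.uncurry fun (x : Loop ℂ × ℂ) (z : ℂ) => z + x.2) :=
    continuous_snd.add (continuous_snd.comp continuous_fst)
  exact (h1.compacts_map' h2).subtype_mk _

end Loop

namespace LoopMeasureFamily

variable {μ : LoopMeasureFamily}

/-- Conformal restriction for a surjective embedding of the plane into itself: every loop lies in
the range, so the restriction is the whole measure. -/
theorem ConformalRestriction.onPlane_map_image (hr : μ.ConformalRestriction) (e : ℂ ≃ₜ ℂ)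
    (he : Differentiable ℂ e) : μ.onPlane.map (Loop.image e) = μ.onPlane := by
  have hf : RiemannSurface.IsConformalEmbedding (S₁ := RiemannSurface.plane)
      (S₂ := RiemannSurface.plane) e := ⟨he.mdifferentiable, e.injective⟩
  have h := hr _ _ _ hf
  have hu : {γ : Loop RiemannSurface.plane | γ.toSet ⊆ Set.range e} = univ :=
    eq_univ_of_forall fun γ => by
      exact (subset_univ γ.toSet).trans_eq e.surjective.range_eq.symm
  have h2 : (μ RiemannSurface.plane).restrict {γ : Loop RiemannSurface.plane | γ.toSet ⊆ Set.range e} =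
      μ RiemannSurface.plane := by
    rw [hu, Measure.restrict_univ]
  exact h.symm.trans h2

theorem ConformalRestriction.onPlane_map_scale (hr : μ.ConformalRestriction) (r : ℝ) (h : r ≠ 0) :
    μ.onPlane.map (Loop.scale r h) = μ.onPlane :=
  hr.onPlane_map_image _ (differentiable_id.const_mul _)

theorem ConformalRestriction.onPlane_map_translate (hr : μ.ConformalRestriction) (p : ℂ) :
    μ.onPlane.map (Loop.translate p) = μ.onPlane :=
  hr.onPlane_map_image _ (differentiable_id.add_const _)

/-- The loops in `{0 < |z| < A}` that surround `0` and are not contained in `{|z| < a}`. -/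
def annularEvent (a A : ℝ) : Set (Loop ℂ) :=
  {γ | γ.toSet ⊆ {z | 0 < ‖z‖ ∧ ‖z‖ < A} ∧ ¬ γ.toSet ⊆ {z | ‖z‖ < a} ∧ γ.Surrounds 0}

theorem measurableSet_annularEvent (a A : ℝ) : MeasurableSet (annularEvent a A) := by
  refine (Loop.isOpen_setOf_toSet_subset ?_).measurableSet.inter
    (((Loop.isOpen_setOf_toSet_subset ?_).measurableSet.compl).inter
      Loop.measurableSet_setOf_surrounds)
  · exact (isOpen_lt continuous_const continuous_norm).inter (isOpen_lt continuous_norm continuous_const)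
  · exact isOpen_lt continuous_norm continuous_const

theorem ConformalRestriction.onPlane_annularEvent_mul (hr : μ.ConformalRestriction) (a A : ℝ) {s : ℝ}
    (hs : 0 < s) : μ.onPlane (annularEvent (a * s) (A * s)) = μ.onPlane (annularEvent a A) := by
  conv_lhs => rw [← hr.onPlane_map_scale s hs.ne', Measure.map_apply
    (Loop.continuous_scale _ _).measurable (measurableSet_annularEvent _ _)]
  congr 1
  ext γ
  have hn : ∀ z : ℂ, ‖(s : ℂ) * z‖ = ‖z‖ * s := fun z => by
    rw [norm_mul, Complex.norm_real, Real.norm_of_nonneg hs.le, mul_comm]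
  simp only [annularEvent, mem_ofPred_eq, Loop.toSet_scale, Loop.surrounds_scale,
    image_subset_iff, preimage_ofPred_eq, hn, mul_lt_mul_iff_left₀ hs, mul_pos_iff_of_pos_right hs]

/-- The loops surrounding `0` with transfinite diameter in `[1, e)`. -/
def band : Set (Loop ℂ) := {γ | γ.Surrounds 0 ∧ γ.transfiniteDiameter ∈ Ico 1 (Real.exp 1)}

/-- In the band, $1\le\max_\gamma|z|\le400e$. Finitely many scaled copies of the annular event of
nontriviality cover it, and each has the same finite measure. -/
theorem ConformalRestriction.onPlane_band_lt_top (hr : μ.ConformalRestriction) (hn : μ.Nontrivial) :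
    μ.onPlane band < ⊤ := by
  obtain ⟨a, A, ha, haA, -, hfin⟩ := hn
  have hy : 1 < A / a := (one_lt_div ha).mpr haA
  obtain ⟨N, hN⟩ := pow_unbounded_of_one_lt (2 * (400 * Real.exp 1)) hy
  have hcover : band ⊆ ⋃ k ∈ Finset.range N,
      annularEvent (a * ((A / a) ^ k / (2 * a))) (A * ((A / a) ^ k / (2 * a))) := by
    rintro γ ⟨hs, hρ1, hρe⟩
    obtain ⟨z, hz, hmax⟩ := γ.isCompact_toSet.exists_isMaxOn γ.isConnected_toSet.nonempty
      continuous_norm.continuousOn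
    have hmax' : ∀ w ∈ γ.toSet, ‖w‖ ≤ ‖z‖ := fun w hw => hmax hw
    have h0 : ∀ w ∈ γ.toSet, 0 < ‖w‖ := fun w hw => norm_pos_iff.mpr fun h => hs.1 (h ▸ hw)
    have h1 : γ.transfiniteDiameter ≤ ‖z‖ :=
      hs.transfiniteDiameter_le (h0 z hz) fun w hw => by simpa using hmax' w hw
    have h2 := hs.norm_le_transfiniteDiameter hz
    -- With $y=A/a$ and scale factor $y^k/(2a)$, the two radii become $y^k/2$ and $y^{k+1}/2$, which
    -- bracket the largest modulus $|z|$.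
    obtain ⟨k, hk1, hk2⟩ := exists_nat_pow_near (x := 2 * ‖z‖) (by linarith) hy
    have hkN : k < N := by
      refine (pow_lt_pow_iff_right₀ hy).mp (hk1.trans_lt (lt_of_le_of_lt ?_ hN))
      nlinarith
    have e1 : a * ((A / a) ^ k / (2 * a)) = (A / a) ^ k / 2 := by field_simp
    have e2 : A * ((A / a) ^ k / (2 * a)) = (A / a) ^ (k + 1) / 2 := by rw [pow_succ]; field_simp
    refine mem_biUnion (Finset.mem_coe.mpr (Finset.mem_range.mpr hkN)) ⟨fun w hw => ⟨h0 w hw, ?_⟩,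
      fun h => ?_, hs⟩
    · rw [e2]
      linarith [hmax' w hw]
    · have h3 := h hz
      rw [mem_ofPred_eq, e1] at h3
      linarith
  refine (measure_mono hcover).trans_lt (measure_biUnion_lt_top (Finset.finite_toSet _) fun k _ => ?_)
  rw [hr.onPlane_annularEvent_mul a A (by have := ha.trans haA; positivity)]
  exact hfin

theorem Nontrivial.zero_ne_zero (hn : μ.Nontrivial) : μ.zero ≠ 0 := by
  obtain ⟨a, A, -, -, hpos, -⟩ := hn
  intro h
  have h1 : μ.zero (annularEvent a A) = μ.onPlane (annularEvent a A) := by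
    rw [zero, Measure.restrict_apply (measurableSet_annularEvent a A)]
    congr 1
    exact inter_eq_left.mpr fun γ hγ => hγ.2.2
  rw [h] at h1
  exact hpos.ne h1

theorem aemeasurable_u_transfiniteDiameter (μ : LoopMeasureFamily) :
    AEMeasurable (fun γ : Loop ℂ => (γ.u, γ.transfiniteDiameter)) μ.zero :=
  aemeasurable_restrict_of_measurable_subtype Loop.measurableSet_setOf_surrounds
    ((measurable_pi_lambda _ Loop.measurable_u).prodMk Loop.measurable_transfiniteDiameter)

theorem ConformalRestriction.zero_map_scale (hr : μ.ConformalRestriction) {r : ℝ} (h : 0 < r) :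
    μ.zero.map (Loop.scale r h.ne') = μ.zero := by
  have hm : Measurable (Loop.scale r h.ne') := (Loop.continuous_scale _ _).measurable
  have hp : Loop.scale r h.ne' ⁻¹' {γ | γ.Surrounds 0} = {γ | γ.Surrounds 0} := by
    ext γ; exact Loop.surrounds_scale _ _ _
  have := Measure.restrict_map hm (μ := μ.onPlane) Loop.measurableSet_setOf_surrounds
  rw [hp, hr.onPlane_map_scale] at this
  exact this.symm

/-- Scaling a loop leaves $u$ unchanged and multiplies $\rho_\infty$ by $r$. -/
theorem ConformalRestriction.map_mul (hr : μ.ConformalRestriction) {r : ℝ} (h : 0 < r) :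
    (μ.zero.map fun γ => (γ.u, γ.transfiniteDiameter)).map (Prod.map id (r * ·)) =
      μ.zero.map fun γ => (γ.u, γ.transfiniteDiameter) := by
  have hF := μ.aemeasurable_u_transfiniteDiameter
  have hm : Measurable (Loop.scale r h.ne') := (Loop.continuous_scale _ _).measurable
  rw [AEMeasurable.map_map_of_aemeasurable (by fun_prop) hF]
  conv_rhs => rw [← hr.zero_map_scale h]
  rw [AEMeasurable.map_map_of_aemeasurable (by rwa [hr.zero_map_scale h]) hm.aemeasurable]
  refine Measure.map_congr ?_
  filter_upwards [ae_restrict_mem Loop.measurableSet_setOf_surrounds] with γ hs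
  simp only [Function.comp_apply, Prod.map, id]
  rw [Loop.Surrounds.u_scale hs h, Loop.Surrounds.transfiniteDiameter_scale hs h]

theorem measurableSet_band : MeasurableSet band := by
  have h := Loop.measurable_transfiniteDiameter (measurableSet_Ico (a := (1 : ℝ)) (b := Real.exp 1))
  have h2 := Loop.measurableSet_setOf_surrounds.subtype_image h
  convert h2 using 1
  ext γ
  constructor
  · exact fun hγ => ⟨⟨γ, hγ.1⟩, hγ.2, rfl⟩
  · rintro ⟨γ', h, rfl⟩
    exact ⟨γ'.2, h⟩

theorem map_prod_Ico (μ : LoopMeasureFamily) {A : Set (ℕ → ℂ)} (hA : MeasurableSet A) :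
    μ.zero.map (fun γ => (γ.u, γ.transfiniteDiameter)) (A ×ˢ Ico 1 (Real.exp 1)) =
      (μ.onPlane.restrict band).map Loop.u A := by
  have hu : AEMeasurable Loop.u μ.zero := μ.aemeasurable_u_transfiniteDiameter.fst
  have hsub : band ⊆ {γ | γ.Surrounds 0} := fun γ h => h.1
  have hu' : AEMeasurable Loop.u (μ.onPlane.restrict band) := hu.mono_measure
    (Measure.restrict_mono hsub le_rfl)
  rw [Measure.map_apply_of_aemeasurable μ.aemeasurable_u_transfiniteDiameter
    (hA.prod measurableSet_Ico), Measure.map_apply_of_aemeasurable hu' hA, zero,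
    Measure.restrict_apply' Loop.measurableSet_setOf_surrounds, Measure.restrict_apply' measurableSet_band]
  congr 1
  ext γ
  simp only [band, mem_inter_iff, mem_preimage, mem_prod, mem_ofPred_eq]
  tauto

end LoopMeasureFamily

/-! ### Splitting off the Haar measure. -/

namespace LoopMeasureFamily

theorem haarPos_eq_map_exp : haarPos = (volume : Measure ℝ).map Real.exp := by
  ext B hB
  have h1 : Real.exp '' (Real.exp ⁻¹' B) = B ∩ Ioi 0 := by
    rw [image_preimage_eq_inter_range, Real.range_exp]
  rw [haarPos, withDensity_apply _ hB, Measure.restrict_restrict hB, ← h1,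
    lintegral_image_eq_lintegral_abs_deriv_mul (hB.preimage Real.measurable_exp)
      (fun x _ => (Real.hasDerivAt_exp x).hasDerivWithinAt) Real.exp_injective.injOn,
    Measure.map_apply Real.measurable_exp hB]
  have h2 : ∀ x : ℝ, ENNReal.ofReal |Real.exp x| * ENNReal.ofReal (1 / Real.exp x) = 1 := fun x => by
    rw [abs_of_pos (Real.exp_pos x), ← ENNReal.ofReal_mul (Real.exp_pos x).le,
      mul_one_div_cancel (Real.exp_pos x).ne', ENNReal.ofReal_one]
  simp only [h2, setLIntegral_one]

instance : SFinite haarPos := by rw [haarPos_eq_map_exp]; infer_instance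

theorem haarPos_Ico : haarPos (Ico 1 (Real.exp 1)) = 1 := by
  rw [haarPos_eq_map_exp, Measure.map_apply Real.measurable_exp measurableSet_Ico]
  have : Real.exp ⁻¹' Ico 1 (Real.exp 1) = Ico 0 1 := by
    ext x
    simp
  rw [this, Real.volume_Ico]
  simp

/-- A measure on `X × ℝ` that is invariant under the translations of the second factor. -/
theorem eq_prod_volume {X : Type*} [MeasurableSpace X] {m : Measure (X × ℝ)}
    (hinv : ∀ t : ℝ, m.map (Prod.map id (t + ·)) = m) (hfin : m (univ ×ˢ Ico 0 1) < ⊤) :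
    m = ((m.restrict (univ ×ˢ Ico 0 1)).map Prod.fst).prod volume := by
  have hU : MeasurableSet ((univ : Set X) ×ˢ Ico (0 : ℝ) 1) := MeasurableSet.univ.prod measurableSet_Ico
  have hfin' : IsFiniteMeasure ((m.restrict (univ ×ˢ Ico 0 1)).map Prod.fst) := by
    have : IsFiniteMeasure (m.restrict (univ ×ˢ Ico 0 1)) := ⟨by simpa using hfin⟩
    infer_instance
  have htrans : ∀ (A : Set X) (B : Set ℝ) (t : ℝ), MeasurableSet A → MeasurableSet B →
      m (A ×ˢ ((t + ·) ⁻¹' B)) = m (A ×ˢ B) := by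
    intro A B t hA hB
    conv_rhs => rw [← hinv t]
    rw [Measure.map_apply (by fun_prop) (hA.prod hB)]
    rfl
  refine (Measure.prod_eq fun A B hA hB => ?_).symm
  -- For fixed $A$ the slice $B\mapsto m(A\times B)$ is translation invariant and locally finite,
  -- hence a multiple of Lebesgue measure; evaluating at $[0,1)$ identifies the multiple.
  set l : Measure ℝ := (m.restrict (A ×ˢ univ)).map Prod.snd with hl
  have hlB : ∀ B, MeasurableSet B → l B = m (A ×ˢ B) := by
    intro B hB
    rw [hl, Measure.map_apply measurable_snd hB, Measure.restrict_apply (measurable_snd hB)]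
    congr 1
    ext x
    simp [and_comm]
  have hl1 : l.IsAddLeftInvariant := ⟨fun t => by
    ext B hB
    rw [Measure.map_apply (measurable_const_add t) hB, hlB _ (measurable_const_add t hB), hlB _ hB,
      htrans A B t hA hB]⟩
  have hl2 : IsFiniteMeasureOnCompacts l := ⟨fun K hK => by
    obtain ⟨M, hM⟩ := hK.isBounded.exists_norm_le
    obtain ⟨N, hN⟩ := exists_nat_gt M
    have hsub : K ⊆ ⋃ k ∈ Finset.Ico (-(N : ℤ)) (N + 1), Ico (k : ℝ) (k + 1) := by
      intro x hx
      have h1 := abs_le.mp (hM x hx)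
      refine mem_biUnion (Finset.mem_coe.mpr (Finset.mem_Ico.mpr ⟨?_, ?_⟩ : ⌊x⌋ ∈ _))
        ⟨Int.floor_le x, Int.lt_floor_add_one x⟩
      · rw [Int.le_floor]; push_cast; linarith
      · rw [Int.floor_lt]; push_cast; linarith
    refine (measure_mono hsub).trans_lt (measure_biUnion_lt_top (Finset.finite_toSet _) fun k _ => ?_)
    have h2 : Ico (k : ℝ) (k + 1) = ((-k : ℝ) + ·) ⁻¹' Ico 0 1 := by
      ext x; simp only [mem_Ico, mem_preimage]; constructor <;> rintro ⟨h, h'⟩ <;> constructor <;> linarith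
    rw [hlB _ measurableSet_Ico, h2, htrans A _ _ hA measurableSet_Ico]
    exact (measure_mono (prod_mono (subset_univ _) le_rfl)).trans_lt hfin⟩
  have h := Measure.isAddLeftInvariant_eq_smul l (volume : Measure ℝ)
  set c := l.addHaarScalarFactor (volume : Measure ℝ)
  have h1 : l (Ico 0 1) = c := by
    rw [h]
    simp
  have h2 : ((m.restrict (univ ×ˢ Ico 0 1)).map Prod.fst) A = c := by
    rw [← h1, hlB _ measurableSet_Ico, Measure.map_apply measurable_fst hA,
      Measure.restrict_apply (measurable_fst hA)]
    congr 1
    ext x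
    simp
  rw [h2, ← hlB B hB, h]
  rfl

/-- The logarithm turns multiplicative into additive invariance and $[1,e)$ into $[0,1)$; the
exponential carries the product decomposition back. -/
theorem eq_prod_haarPos {X : Type*} [MeasurableSpace X] {m : Measure (X × ℝ)}
    (hinv : ∀ t : ℝ, 0 < t → m.map (Prod.map id (t * ·)) = m)
    (hfin : m (univ ×ˢ Ico 1 (Real.exp 1)) < ⊤) (hpos : ∀ᵐ x ∂m, 0 < x.2) :
    ∃ ν : Measure X, IsFiniteMeasure ν ∧ m = ν.prod haarPos := by
  have hlog : Measurable (Prod.map id Real.log : X × ℝ → X × ℝ) :=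
    measurable_id.prodMap Real.measurable_log
  set m' := m.map (Prod.map id Real.log) with hm'
  have h1 : ∀ t : ℝ, m'.map (Prod.map id (t + ·)) = m' := by
    intro t
    conv_rhs => rw [hm', ← hinv _ (Real.exp_pos t)]
    rw [hm', Measure.map_map (by fun_prop) hlog, Measure.map_map hlog (by fun_prop)]
    refine Measure.map_congr ?_
    filter_upwards [hpos] with x hx
    simp only [Function.comp_apply, Prod.map]
    rw [Real.log_mul (Real.exp_pos t).ne' hx.ne', Real.log_exp]
  have h2 : m' (univ ×ˢ Ico 0 1) < ⊤ := by
    rw [hm', Measure.map_apply hlog (MeasurableSet.univ.prod measurableSet_Ico)]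
    refine lt_of_le_of_lt (measure_mono_ae ?_) hfin
    filter_upwards [hpos] with x hx h
    refine ⟨mem_univ _, ?_, ?_⟩
    · exact (Real.log_nonneg_iff hx).mp h.2.1
    · exact (Real.log_lt_iff_lt_exp hx).mp h.2.2
  have h3 : m = m'.map (Prod.map id Real.exp) := by
    rw [hm', Measure.map_map (by fun_prop) hlog]
    conv_lhs => rw [← Measure.map_id (μ := m)]
    refine Measure.map_congr ?_
    filter_upwards [hpos] with x hx
    simp [Prod.map, Real.exp_log hx]
  have hfin' : IsFiniteMeasure ((m'.restrict (univ ×ˢ Ico 0 1)).map Prod.fst) := by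
    have : IsFiniteMeasure (m'.restrict (univ ×ˢ Ico 0 1)) := ⟨by simpa using h2⟩
    infer_instance
  refine ⟨_, hfin', ?_⟩
  conv_lhs => rw [h3, eq_prod_volume h1 h2]
  rw [haarPos_eq_map_exp, ← Measure.map_prod_map _ _ measurable_id Real.measurable_exp, Measure.map_id]

variable {μ : LoopMeasureFamily}

/-- The interval $[1,e)$ has mass $1$ for $d\rho/\rho$. This gives uniqueness of $\nu_0$ and a
concrete description of it for the moment computation. -/
theorem Decomposes.eq_map_band {ν : Measure (ℕ → ℂ)} (h : μ.Decomposes ν) :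
    ν = (μ.onPlane.restrict band).map Loop.u := by
  ext A hA
  rw [← μ.map_prod_Ico hA, h, Measure.prod_prod, haarPos_Ico, mul_one]

theorem ConformalRestriction.existsUnique_decomposes (hr : μ.ConformalRestriction)
    (hn : μ.Nontrivial) :
    ∃! ν : Measure (ℕ → ℂ), IsFiniteMeasure ν ∧ ν ≠ 0 ∧ μ.Decomposes ν := by
  have hF := μ.aemeasurable_u_transfiniteDiameter
  obtain ⟨ν, hν, h⟩ := eq_prod_haarPos (m := μ.zero.map fun γ => (γ.u, γ.transfiniteDiameter))
    (fun t ht => hr.map_mul ht) (by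
      rw [μ.map_prod_Ico MeasurableSet.univ]
      refine (measure_mono (subset_univ _)).trans_lt ?_
      have : IsFiniteMeasure (μ.onPlane.restrict band) := ⟨by simpa using hr.onPlane_band_lt_top hn⟩
      exact measure_lt_top _ _)
    ((ae_map_iff hF (measurableSet_lt measurable_const measurable_snd)).mpr (by
      filter_upwards [ae_restrict_mem Loop.measurableSet_setOf_surrounds] with γ hs
      exact Loop.Surrounds.transfiniteDiameter_pos hs))
  refine ⟨ν, ⟨hν, ?_, h⟩, fun ν' hν' => (hν'.2.2.eq_map_band).trans (Decomposes.eq_map_band h).symm⟩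
  rintro rfl
  rw [Measure.zero_prod] at h
  exact hn.zero_ne_zero ((Measure.map_eq_zero_iff hF).mp h)

end LoopMeasureFamily

/-! ### Areas of images of disks and power series. -/

/-- Change of variables for an injective holomorphic map. -/
theorem lintegral_image_eq_lintegral_norm_deriv_sq_mul {U S : Set ℂ} (hU : IsOpen U) {f : ℂ → ℂ}
    (hf : DifferentiableOn ℂ f U) (hi : InjOn f U) (hSU : S ⊆ U) (hS : MeasurableSet S)
    (g : ℂ → ENNReal) :
    ∫⁻ p in f '' S, g p = ∫⁻ q in S, ENNReal.ofReal (‖deriv f q‖ ^ 2) * g (f q) := by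
  have h := lintegral_image_eq_lintegral_abs_det_fderiv_mul volume hS
    (f' := fun q => (ContinuousLinearMap.toSpanSingleton ℂ (deriv f q)).restrictScalars ℝ)
    (fun q hq => ((hf.differentiableAt (hU.mem_nhds (hSU hq))).hasDerivAt.hasFDerivAt.restrictScalars
      ℝ).hasFDerivWithinAt) (hi.mono hSU) g
  rw [h]
  refine lintegral_congr fun q => ?_
  congr 2
  simp only [ContinuousLinearMap.det, ContinuousLinearMap.coe_restrictScalars,
    LinearMap.det_restrictScalars, Algebra.norm_complex_apply]
  have : LinearMap.det (ContinuousLinearMap.toSpanSingleton ℂ (deriv f q) : ℂ →ₗ[ℂ] ℂ) = deriv f q :=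
    ContinuousLinearMap.det_toSpanSingleton _
  rw [this, abs_of_nonneg (normSq_nonneg _), normSq_eq_norm_sq]

/-- The coefficients of the Taylor series at `0`. -/
noncomputable def taylorCoeff (f : ℂ → ℂ) (n : ℕ) : ℂ := (n.factorial : ℂ)⁻¹ * iteratedDeriv n f 0

theorem hasSum_taylorCoeff {f : ℂ → ℂ} (hf : DifferentiableOn ℂ f (ball 0 1)) {z : ℂ} (hz : ‖z‖ < 1) :
    HasSum (fun n => taylorCoeff f n * z ^ n) (f z) := by
  have h := hasSum_taylorSeries_on_ball hf (z := z) (by simpa using hz)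
  refine h.congr_fun ?_
  intro n
  simp [taylorCoeff]
  ring

theorem summable_norm_taylorCoeff {f : ℂ → ℂ} (hf : DifferentiableOn ℂ f (ball 0 1)) {ρ : ℝ}
    (hρ0 : 0 ≤ ρ) (hρ : ρ < 1) : Summable fun n => ‖taylorCoeff f n‖ * ρ ^ n := by
  have h := (hasSum_taylorCoeff hf (z := ρ)
    (by rwa [Complex.norm_real, Real.norm_of_nonneg hρ0])).summable.norm
  refine h.congr fun n => ?_
  rw [norm_mul, norm_pow, Complex.norm_real, Real.norm_of_nonneg hρ0]

/-- Parseval's identity on a circle. -/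
theorem hasSum_norm_taylorCoeff_sq {f : ℂ → ℂ} (hf : DifferentiableOn ℂ f (ball 0 1)) {ρ : ℝ}
    (hρ0 : 0 ≤ ρ) (hρ : ρ < 1) :
    HasSum (fun n => ‖taylorCoeff f n‖ ^ 2 * ρ ^ (2 * n)) (Real.circleAverage (fun z => ‖f z‖ ^ 2) 0 ρ) := by
  have hsum := summable_norm_taylorCoeff hf hρ0 hρ
  -- Truncations of $f(\rho z)$. Parseval is known for polynomials on the unit circle, and dominated
  -- convergence passes to the limit.
  set P : ℕ → Polynomial ℂ := fun N =>
    ∑ k ∈ Finset.range N, Polynomial.C (taylorCoeff f k * (ρ : ℂ) ^ k) * Polynomial.X ^ k with hP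
  have hcoeff : ∀ N k, (P N).coeff k = if k < N then taylorCoeff f k * (ρ : ℂ) ^ k else 0 := by
    intro N k
    simp only [hP, Polynomial.finsetSum_coeff, Polynomial.coeff_C_mul_X_pow, Finset.sum_ite_eq,
      Finset.mem_range]
  have hpars : ∀ N, ∑ k ∈ Finset.range N, ‖taylorCoeff f k‖ ^ 2 * ρ ^ (2 * k) =
      Real.circleAverage (fun z => ‖(P N).eval z‖ ^ 2) 0 1 := by
    intro N
    rw [← Polynomial.sum_sq_norm_coeff_eq_circleAverage]
    have hsub : (P N).support ⊆ Finset.range N := fun k hk => by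
      by_contra h
      rw [Finset.mem_range] at h
      rw [Polynomial.mem_support_iff, hcoeff, if_neg h] at hk
      exact hk rfl
    rw [Finset.sum_subset hsub (fun k _ hk => by
      rw [Polynomial.notMem_support_iff.mp hk]; simp)]
    refine Finset.sum_congr rfl fun k hk => ?_
    rw [hcoeff, if_pos (Finset.mem_range.mp hk), norm_mul, norm_pow, Complex.norm_real,
      Real.norm_of_nonneg hρ0, mul_pow, ← pow_mul, mul_comm 2 k]
  rw [hasSum_iff_tendsto_nat_of_nonneg (fun n => by positivity)]
  simp_rw [hpars]
  have hcirc : ∀ θ, ‖circleMap 0 1 θ‖ = 1 := fun θ => by simp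
  have hmap : ∀ θ, circleMap 0 ρ θ = ρ * circleMap 0 1 θ := fun θ => by simp [circleMap]
  have heval : ∀ N z, (P N).eval z = ∑ k ∈ Finset.range N, taylorCoeff f k * ((ρ : ℂ) * z) ^ k := by
    intro N z
    simp [hP, Polynomial.eval_finsetSum, mul_pow, mul_assoc]
  simp only [Real.circleAverage]
  refine Tendsto.const_smul ?_ _
  refine intervalIntegral.tendsto_integral_filter_of_dominated_convergence
    (fun _ => (∑' n, ‖taylorCoeff f n‖ * ρ ^ n) ^ 2) ?_ ?_ intervalIntegrable_const ?_
  · refine Eventually.of_forall fun N => Continuous.aestronglyMeasurable ?_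
    fun_prop
  · refine Eventually.of_forall fun N => ae_of_all _ fun θ _ => ?_
    rw [Real.norm_of_nonneg (by positivity)]
    gcongr
    rw [heval]
    refine (norm_sum_le _ _).trans ((Finset.sum_le_sum fun k _ => ?_).trans
      (hsum.sum_le_tsum (Finset.range N) fun k _ => by positivity))
    rw [norm_mul, norm_pow, norm_mul, hcirc, mul_one, Complex.norm_real, Real.norm_of_nonneg hρ0]
  · refine ae_of_all _ fun θ _ => ?_
    simp_rw [heval, hmap]
    refine ((hasSum_taylorCoeff hf ?_).tendsto_sum_nat.norm.pow 2)
    rw [norm_mul, hcirc, mul_one, Complex.norm_real, Real.norm_of_nonneg hρ0]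
    exact hρ

theorem setLIntegral_Ioo_circleMap {g : ℂ → ℝ} {ρ : ℝ} (hρ : 0 ≤ ρ)
    (hg : ContinuousOn g (sphere 0 ρ)) (hg0 : ∀ z, 0 ≤ g z) :
    ∫⁻ θ in Ioo (-π) π, ENNReal.ofReal (g (circleMap 0 ρ θ)) =
      ENNReal.ofReal (2 * π * Real.circleAverage g 0 ρ) := by
  have hc : Continuous fun θ => g (circleMap 0 ρ θ) :=
    hg.comp_continuous (continuous_circleMap _ _) (fun θ => circleMap_mem_sphere _ hρ _)
  have h1 : ∫ θ in (-π)..π, g (circleMap 0 ρ θ) = ∫ θ in (0 : ℝ)..(2 * π), g (circleMap 0 ρ θ) := by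
    have hper : Function.Periodic (fun θ => g (circleMap 0 ρ θ)) (2 * π) := fun θ => by
      simp only [periodic_circleMap 0 ρ θ]
    have := hper.intervalIntegral_add_eq (-π) 0
    rwa [zero_add, show -π + 2 * π = π by ring] at this
  rw [restrict_Ioo_eq_restrict_Ioc, ← ofReal_integral_eq_lintegral_ofReal
    (hc.integrableOn_Ioc) (ae_of_all _ fun θ => hg0 _),
    ← intervalIntegral.integral_of_le (by linarith [Real.pi_pos]), h1, Real.circleAverage, smul_eq_mul,
    mul_inv_cancel_left₀ (by positivity)]

theorem setLIntegral_Ioo_pow {r : ℝ} (hr : 0 < r) (n : ℕ) :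
    ∫⁻ ρ in Ioo 0 r, ENNReal.ofReal (2 * π * ρ ^ (2 * n + 1)) =
      ENNReal.ofReal (π / (n + 1) * (r ^ 2) ^ (n + 1)) := by
  have hc : Continuous fun ρ : ℝ => 2 * π * ρ ^ (2 * n + 1) := by fun_prop
  rw [restrict_Ioo_eq_restrict_Ioc, ← ofReal_integral_eq_lintegral_ofReal hc.integrableOn_Ioc
    ((ae_restrict_iff' measurableSet_Ioc).mpr (ae_of_all _ fun ρ hρ => by
      have := hρ.1.le
      change 0 ≤ 2 * π * ρ ^ (2 * n + 1)
      positivity)),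
    ← intervalIntegral.integral_of_le hr.le, intervalIntegral.integral_const_mul, integral_pow]
  congr 1
  have : (n : ℝ) + 1 ≠ 0 := by positivity
  push_cast
  rw [zero_pow (by omega), sub_zero, ← pow_mul, show 2 * n + 1 + 1 = 2 * (n + 1) by ring]
  field_simp
  ring

/-- Integration over a disk in polar coordinates, for functions whose means over circles are given
by a power series. -/
theorem lintegral_ball_of_circle {r : ℝ} (hr : 0 < r) {g : ℂ → ENNReal}
    (hg : Measurable ((ball 0 r).indicator g)) (c : ℕ → ENNReal)
    (h : ∀ ρ ∈ Ioo 0 r, ∫⁻ θ in Ioo (-π) π, g (circleMap 0 ρ θ) =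
      ∑' n, c n * ENNReal.ofReal (2 * π * ρ ^ (2 * n))) :
    ∫⁻ z in ball 0 r, g z = ∑' n, c n * ENNReal.ofReal (π / (n + 1) * (r ^ 2) ^ (n + 1)) := by
  set G := (ball (0 : ℂ) r).indicator g
  have hpolar : ∀ p : ℝ × ℝ, Complex.polarCoord.symm p = circleMap 0 p.1 p.2 := fun p => by
    rw [Complex.polarCoord_symm_apply, circleMap, zero_add, Complex.exp_mul_I, ofReal_cos, ofReal_sin]
  have hmeas : Measurable fun p : ℝ × ℝ => ENNReal.ofReal p.1 * G (circleMap 0 p.1 p.2) := by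
    refine measurable_fst.ennreal_ofReal.mul (hg.comp (Continuous.measurable ?_))
    unfold circleMap
    fun_prop
  calc ∫⁻ z in ball 0 r, g z = ∫⁻ z, G z := (lintegral_indicator measurableSet_ball _).symm
    _ = ∫⁻ p in Ioi (0 : ℝ) ×ˢ Ioo (-π) π, ENNReal.ofReal p.1 * G (circleMap 0 p.1 p.2) := by
      rw [← Complex.lintegral_comp_polarCoord_symm]
      simp only [hpolar, smul_eq_mul]
      rfl
    _ = ∫⁻ ρ in Ioi (0 : ℝ), ∫⁻ θ in Ioo (-π) π, ENNReal.ofReal ρ * G (circleMap 0 ρ θ) := by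
      rw [Measure.volume_eq_prod, ← Measure.prod_restrict, lintegral_prod _ hmeas.aemeasurable]
    _ = ∫⁻ ρ in Ioi (0 : ℝ), (Ioo 0 r).indicator
          (fun ρ => ∑' n, c n * ENNReal.ofReal (2 * π * ρ ^ (2 * n + 1))) ρ := by
      refine setLIntegral_congr_fun measurableSet_Ioi fun ρ hρ => ?_
      have hρ0 : 0 < ρ := hρ
      rw [lintegral_const_mul' _ _ ENNReal.ofReal_ne_top]
      by_cases hρr : ρ < r
      · rw [indicator_of_mem (show ρ ∈ Ioo 0 r from ⟨hρ0, hρr⟩)]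
        have hG : ∀ θ, G (circleMap 0 ρ θ) = g (circleMap 0 ρ θ) := fun θ =>
          indicator_of_mem (by simpa [abs_of_pos hρ0] using hρr) _
        simp only [hG]
        rw [h ρ ⟨hρ0, hρr⟩, ← ENNReal.tsum_mul_left]
        refine tsum_congr fun n => ?_
        rw [mul_left_comm, ← ENNReal.ofReal_mul hρ0.le]
        congr 2
        ring
      · rw [indicator_of_notMem (fun h => hρr h.2)]
        have hG : ∀ θ, G (circleMap 0 ρ θ) = 0 := fun θ =>
          indicator_of_notMem (by simpa [abs_of_pos hρ0] using hρr) _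
        simp [hG]
    _ = ∫⁻ ρ in Ioo 0 r, ∑' n, c n * ENNReal.ofReal (2 * π * ρ ^ (2 * n + 1)) := by
      rw [setLIntegral_indicator measurableSet_Ioo, inter_eq_left.mpr (fun x hx => hx.1)]
    _ = ∑' n, c n * ENNReal.ofReal (π / (n + 1) * (r ^ 2) ^ (n + 1)) := by
      rw [lintegral_tsum (fun n => by fun_prop)]
      refine tsum_congr fun n => ?_
      rw [lintegral_const_mul _ (by fun_prop), setLIntegral_Ioo_pow hr]

theorem ContinuousOn.measurable_indicator_isOpen {U : Set ℂ} (hU : IsOpen U) {g : ℂ → ENNReal}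
    (hg : ContinuousOn g U) : Measurable (U.indicator g) := by
  classical
  rw [← piecewise_eq_indicator]
  exact hg.measurable_piecewise continuousOn_const hU.measurableSet

theorem lintegral_ball_norm_sq {f : ℂ → ℂ} (hf : DifferentiableOn ℂ f (ball 0 1)) {r : ℝ}
    (hr0 : 0 < r) (hr : r < 1) :
    ∫⁻ z in ball 0 r, ENNReal.ofReal (‖f z‖ ^ 2) =
      ∑' n, ENNReal.ofReal (‖taylorCoeff f n‖ ^ 2) * ENNReal.ofReal (π / (n + 1) * (r ^ 2) ^ (n + 1)) := by
  have hc : ContinuousOn (fun z => ‖f z‖ ^ 2) (ball 0 1) := hf.continuousOn.norm.pow 2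
  refine lintegral_ball_of_circle hr0 ?_ _ fun ρ hρ => ?_
  · exact (ENNReal.continuous_ofReal.comp_continuousOn
      (hc.mono (ball_subset_ball hr.le))).measurable_indicator_isOpen isOpen_ball
  · have hρ1 : ρ < 1 := hρ.2.trans hr
    have hs := hasSum_norm_taylorCoeff_sq hf hρ.1.le hρ1
    rw [setLIntegral_Ioo_circleMap (g := fun z => ‖f z‖ ^ 2) hρ.1.le
      (hc.mono fun z hz => by rw [mem_sphere_zero_iff_norm] at hz; simpa [hz] using hρ1)
      (fun z => by positivity), ← (hs.mul_left (2 * π)).tsum_eq,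
      ENNReal.ofReal_tsum_of_nonneg (fun n => by have := hρ.1.le; positivity) (hs.mul_left _).summable]
    refine tsum_congr fun n => ?_
    rw [← ENNReal.ofReal_mul (by positivity)]
    congr 1
    ring

/-- Hyperbolic area of a disk, from $(1-\rho^2)^{-2}=\sum_n(n+1)\rho^{2n}$. It is left as a series
so that coefficients can be compared. -/
theorem lintegral_ball_poincare {r : ℝ} (hr0 : 0 < r) (hr : r < 1) :
    ∫⁻ z in ball (0 : ℂ) r, ENNReal.ofReal (((1 - ‖z‖ ^ 2) ^ 2)⁻¹) =
      ∑' n : ℕ, ENNReal.ofReal ((n : ℝ) + 1) * ENNReal.ofReal (π / (n + 1) * (r ^ 2) ^ (n + 1)) := by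
  have hc : ContinuousOn (fun z : ℂ => ((1 - ‖z‖ ^ 2) ^ 2)⁻¹) (ball 0 1) := by
    refine ContinuousOn.inv₀ (by fun_prop) fun z hz => ?_
    have : ‖z‖ < 1 := by simpa using hz
    have : 0 < 1 - ‖z‖ ^ 2 := by nlinarith [norm_nonneg z]
    positivity
  refine lintegral_ball_of_circle hr0 ?_ _ fun ρ hρ => ?_
  · exact (ENNReal.continuous_ofReal.comp_continuousOn
      (hc.mono (ball_subset_ball hr.le))).measurable_indicator_isOpen isOpen_ball
  · have hρ1 : ρ < 1 := hρ.2.trans hr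
    have hρ2 : ‖ρ ^ 2‖ < 1 := by
      rw [Real.norm_of_nonneg (by positivity)]
      have := hρ.1
      nlinarith
    have hs : HasSum (fun n : ℕ => ((n : ℝ) + 1) * (ρ ^ 2) ^ n) (((1 - ρ ^ 2) ^ 2)⁻¹) := by
      have h1 := hasSum_coe_mul_geometric_of_norm_lt_one hρ2
      have h2 := h1.add (hasSum_geometric_of_norm_lt_one hρ2)
      have e1 : (fun n : ℕ => ((n : ℝ) + 1) * (ρ ^ 2) ^ n) =
          fun n : ℕ => (n : ℝ) * (ρ ^ 2) ^ n + (ρ ^ 2) ^ n := by ext n; ring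
      have e2 : ((1 - ρ ^ 2) ^ 2)⁻¹ = ρ ^ 2 / (1 - ρ ^ 2) ^ 2 + (1 - ρ ^ 2)⁻¹ := by
        have : 1 - ρ ^ 2 ≠ 0 := by
          have := (abs_lt.mp hρ2).2
          linarith
        field_simp
        ring
      rw [e1, e2]
      exact h2
    have hn : ∀ θ, ‖circleMap 0 ρ θ‖ = ρ := fun θ => by simp [abs_of_pos hρ.1]
    simp only [hn]
    rw [setLIntegral_const, Real.volume_Ioo, ← ENNReal.ofReal_mul (by positivity), mul_comm,
      ← (hs.mul_left (π - -π)).tsum_eq,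
      ENNReal.ofReal_tsum_of_nonneg (fun n => by
        have := hρ.1.le
        have := Real.pi_pos
        exact mul_nonneg (by linarith) (by positivity)) (hs.mul_left _).summable]
    refine tsum_congr fun n => ?_
    rw [← ENNReal.ofReal_mul (by positivity)]
    congr 1
    ring

theorem eq_zero_of_hasSum_mul_pow {c : ℕ → ℝ}
    (h : ∀ x ∈ Ioo (0 : ℝ) 1, HasSum (fun n => c n * x ^ n) 0) (n : ℕ) : c n = 0 := by
  induction n using Nat.strong_induction_on with
  | _ n ih =>
    -- By induction the lower coefficients vanish; dividing by $x^n$ and letting $x\to0^+$ isolates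
    -- $c_n$.
    have h1 : ∀ x ∈ Ioo (0 : ℝ) 1, HasSum (fun k => c (k + n) * x ^ k) 0 := by
      intro x hx
      have h2 := (hasSum_nat_add_iff' n).mpr (h x hx)
      rw [Finset.sum_eq_zero (fun i hi => by rw [ih i (Finset.mem_range.mp hi), zero_mul]), sub_zero] at h2
      have h3 := h2.mul_right (x ^ n)⁻¹
      rw [zero_mul] at h3
      refine h3.congr_fun fun k => ?_
      have := hx.1.ne'
      rw [pow_add]
      field_simp
    have hlim : Tendsto (fun x : ℝ => ∑' k, c (k + n) * x ^ k) (𝓝[>] 0) (𝓝 (∑' k, c (k + n) * 0 ^ k)) := by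
      have hs := (h1 (1 / 2) (by norm_num)).summable.norm
      refine tendsto_tsum_of_dominated_convergence hs (fun k => ?_) ?_
      · exact ((Continuous.tendsto (by fun_prop) 0).mono_left nhdsWithin_le_nhds :
          Tendsto (fun x : ℝ => c (k + n) * x ^ k) (𝓝[>] 0) _)
      · filter_upwards [Ioo_mem_nhdsGT (show (0 : ℝ) < 1 / 2 by norm_num)] with x hx k
        rw [norm_mul, norm_mul, norm_pow, norm_pow]
        gcongr
        rw [Real.norm_of_nonneg hx.1.le, Real.norm_of_nonneg (by norm_num)]
        exact hx.2.le
    have h0 : Tendsto (fun x : ℝ => ∑' k, c (k + n) * x ^ k) (𝓝[>] 0) (𝓝 0) := by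
      refine tendsto_const_nhds.congr' ?_
      filter_upwards [Ioo_mem_nhdsGT (show (0 : ℝ) < 1 by norm_num)] with x hx
      exact ((h1 x hx).tsum_eq).symm
    have h4 := tendsto_nhds_unique hlim h0
    rw [tsum_eq_single 0 (fun k hk => by rw [zero_pow hk, mul_zero])] at h4
    simpa using h4

/-- Power series with coefficients in `[0, ∞]` that agree and are finite have the same coefficients. -/
theorem ENNReal.eq_of_tsum_mul_pow_eq {α β : ℕ → ENNReal}
    (h : ∀ x ∈ Ioo (0 : ℝ) 1, ∑' n, α n * ENNReal.ofReal (x ^ n) = ∑' n, β n * ENNReal.ofReal (x ^ n))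
    (hfin : ∀ x ∈ Ioo (0 : ℝ) 1, ∑' n, β n * ENNReal.ofReal (x ^ n) ≠ ⊤) : α = β := by
  have key : ∀ γ : ℕ → ENNReal, (∀ x ∈ Ioo (0 : ℝ) 1, ∑' n, γ n * ENNReal.ofReal (x ^ n) ≠ ⊤) →
      (∀ n, γ n ≠ ⊤) ∧ ∀ x ∈ Ioo (0 : ℝ) 1, HasSum (fun n => (γ n).toReal * x ^ n)
        (∑' n, γ n * ENNReal.ofReal (x ^ n)).toReal := by
    intro γ hγ
    refine ⟨fun n hn => ?_, fun x hx => ?_⟩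
    · have h1 := ENNReal.ne_top_of_tsum_ne_top (hγ (1 / 2) (by norm_num)) n
      rw [hn, ENNReal.top_mul (by simp)] at h1
      exact h1 rfl
    · have h1 := ENNReal.hasSum_toReal (hγ x hx)
      rw [ENNReal.tsum_toReal_eq (ENNReal.ne_top_of_tsum_ne_top (hγ x hx))]
      refine h1.congr_fun fun n => ?_
      have := hx.1.le
      rw [ENNReal.toReal_mul, ENNReal.toReal_ofReal (by positivity)]
  obtain ⟨hα, hα'⟩ := key α fun x hx => by rw [h x hx]; exact hfin x hx
  obtain ⟨hβ, hβ'⟩ := key β hfin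
  ext n
  rw [← ENNReal.toReal_eq_toReal_iff' (hα n) (hβ n), ← sub_eq_zero]
  refine eq_zero_of_hasSum_mul_pow (c := fun n => (α n).toReal - (β n).toReal) (fun x hx => ?_) n
  have := (hα' x hx).sub (hβ' x hx)
  rw [h x hx, sub_self] at this
  exact this.congr_fun fun n => by ring

/-! ### Marked points and mass transport. -/

namespace Loop

variable {γ : Loop ℂ}

theorem toSet_injective : Function.Injective (toSet : Loop ℂ → Set ℂ) := fun _ _ h =>
  Subtype.ext (TopologicalSpace.Compacts.ext h)

theorem translate_translate_neg (γ : Loop ℂ) (p : ℂ) : (γ.translate (-p)).translate (- -p) = γ := by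
  apply toSet_injective
  rw [toSet_translate, toSet_translate, image_image]
  simp

/-- If $p=\phi_+(q)$, the old base point $0$ becomes $-p$ after translation, and its preimage under
the new uniformizing map is $-q$ up to rotation. Thus both preimages have the same modulus. -/
theorem Surrounds.neg_mem_image_translate (hs : γ.Surrounds 0) {r : ℝ} (hr : r ≤ 1) {p : ℂ}
    (hp : p ∈ γ.innerMap '' ball 0 r) :
    -p ∈ (γ.translate (-p)).innerMap '' ball 0 r := by
  obtain ⟨q, hq, rfl⟩ := hp
  have hq1 : q ∈ ball (0 : ℂ) 1 := ball_subset_ball hr hq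
  have hφ := hs.isInnerMap
  obtain ⟨e, he, hT, -⟩ := hφ.translate hq1
  have hmem : γ.innerMap q ∈ γ.inner := hφ.image ▸ mem_image_of_mem _ hq1
  have hT' := ((surrounds_translate _ _).mpr (surrounds_of_mem_inner hs hmem)).isInnerMap
  have he0 : e ≠ 0 := by rw [← norm_pos_iff, he]; exact one_pos
  have hn : ‖e⁻¹ * -q‖ = ‖q‖ := by simp [he]
  refine ⟨e⁻¹ * -q, by rw [mem_ball_zero_iff, hn]; simpa using hq, ?_⟩
  rw [hT'.eqOn hT (by rw [mem_ball_zero_iff, hn]; simpa using hq1)]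
  have h1 : diskMobius q (e * (e⁻¹ * -q)) = 0 := by
    rw [mul_inv_cancel_left₀ he0]
    have := diskMobius_neg_self (-q)
    rwa [neg_neg] at this
  simp only [h1, hφ.map_zero, zero_add]

/-- The transported function must be measurable on all pairs, including loops that do not surround
$0$. -/
theorem exists_measurable_eq_conformalRadius :
    ∃ R : Loop ℂ → ℝ, Measurable R ∧ ∀ γ : Loop ℂ, γ.Surrounds 0 → R γ = γ.conformalRadius := by
  obtain ⟨R, hR, h⟩ := (MeasurableEmbedding.subtype_coe
    measurableSet_setOf_surrounds).exists_measurable_extend measurable_conformalRadius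
      (fun _ => ⟨0⟩)
  exact ⟨R, hR, fun γ hγ => congrFun h ⟨γ, hγ⟩⟩

theorem Surrounds.taylorCoeff_deriv (hs : γ.Surrounds 0) (n : ℕ) :
    taylorCoeff (deriv γ.innerMap) n = (n + 1) * γ.u n * γ.conformalRadius := by
  have hρ : (γ.conformalRadius : ℂ) ≠ 0 := by
    exact_mod_cast hs.isInnerMap.conformalRadius_eq.2.ne'
  rw [hs.isInnerMap.u_eq, taylorCoeff, ← iteratedDeriv_succ', Nat.factorial_succ]
  have h1 : ((n : ℂ) + 1) ≠ 0 := by exact_mod_cast Nat.succ_ne_zero n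
  have h2 : (n.factorial : ℂ) ≠ 0 := by exact_mod_cast n.factorial_ne_zero
  push_cast
  field_simp

end Loop

namespace LoopMeasureFamily

/-- The pairs of a loop in `band` and a point in the image of the disk of radius `r` under the
uniformizing map of its interior. -/
def marked (r : ℝ) : Set (Loop ℂ × ℂ) := {x | x.1 ∈ band ∧ x.2 ∈ x.1.innerMap '' ball 0 r}

theorem measurableSet_marked {r : ℝ} (hr0 : 0 < r) (hr : r < 1) : MeasurableSet (marked r) := by
  have h := ((MeasurableEmbedding.subtype_coe Loop.measurableSet_setOf_surrounds).prodMap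
    (MeasurableEmbedding.id (α := ℂ))).measurableSet_image.mpr
    (Loop.isOpen_setOf_mem_image_ball hr0 hr).measurableSet
  convert (measurable_fst measurableSet_band).inter h using 1
  ext ⟨γ, p⟩
  constructor
  · exact fun hx => ⟨hx.1, ⟨⟨γ, hx.1.1⟩, p⟩, hx.2, rfl⟩
  · rintro ⟨h1, ⟨⟨γ', h'⟩, p'⟩, h2, h3⟩
    obtain ⟨rfl, rfl⟩ := Prod.ext_iff.mp h3
    exact ⟨h1, h2⟩

theorem translate_mem_marked {r : ℝ} (hr : r ≤ 1) {γ : Loop ℂ} {p : ℂ} (h : (γ, p) ∈ marked r) :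
    (γ.translate (-p), -p) ∈ marked r := by
  obtain ⟨⟨hs, hρ⟩, hp⟩ := h
  have hmem : p ∈ γ.inner := by
    rw [← hs.isInnerMap.image]
    exact image_mono (ball_subset_ball hr) hp
  refine ⟨⟨(Loop.surrounds_translate _ _).mpr (Loop.surrounds_of_mem_inner hs hmem), ?_⟩,
    hs.neg_mem_image_translate hr hp⟩
  rw [Loop.transfiniteDiameter_translate hs hmem]
  exact hρ

theorem translate_mem_marked_iff {r : ℝ} (hr : r ≤ 1) {γ : Loop ℂ} {p : ℂ} :
    (γ.translate (-p), -p) ∈ marked r ↔ (γ, p) ∈ marked r := by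
  refine ⟨fun h => ?_, translate_mem_marked hr⟩
  have := translate_mem_marked hr h
  rwa [Loop.translate_translate_neg, neg_neg] at this

variable {μ : LoopMeasureFamily}

/-- The mass transport principle for marked points in loops. -/
theorem ConformalRestriction.lintegral_translate (hr : μ.ConformalRestriction) (hn : μ.Nontrivial)
    {G : Loop ℂ × ℂ → ENNReal} (hG : Measurable G)
    (h0 : ∀ γ p, γ ∉ band → G (γ, p) = 0) (h0' : ∀ γ p, γ ∉ band → G (γ.translate (-p), -p) = 0) :
    ∫⁻ γ in band, (∫⁻ p, G (γ, p)) ∂μ.onPlane =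
      ∫⁻ γ in band, (∫⁻ p, G (γ.translate (-p), -p)) ∂μ.onPlane := by
  -- Exchanging the integrals needs an s-finite measure. Hence each exchange is done on the band,
  -- and the restriction is dropped only to apply translation invariance for fixed $p$.
  have : IsFiniteMeasure (μ.onPlane.restrict band) := ⟨by simpa using hr.onPlane_band_lt_top hn⟩
  have hT : Measurable fun x : Loop ℂ × ℂ => (x.1.translate (-x.2), -x.2) :=
    (Loop.continuous_translate.comp (continuous_fst.prodMk continuous_snd.neg)).measurable.prodMk
      measurable_snd.neg
  have hout : ∀ g : Loop ℂ → ENNReal, (∀ γ, γ ∉ band → g γ = 0) →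
      ∫⁻ γ in band, g γ ∂μ.onPlane = ∫⁻ γ, g γ ∂μ.onPlane := by
    intro g hg
    rw [← lintegral_indicator measurableSet_band]
    refine lintegral_congr fun γ => ?_
    by_cases hγ : γ ∈ band
    · rw [indicator_of_mem hγ]
    · rw [indicator_of_notMem hγ, hg γ hγ]
  have htr : ∀ p, ∫⁻ γ, G (γ, p) ∂μ.onPlane = ∫⁻ γ, G (γ.translate p, p) ∂μ.onPlane := by
    intro p
    conv_lhs => rw [← hr.onPlane_map_translate p]
    exact lintegral_map (hG.comp measurable_prodMk_right) (Loop.continuous_image _).measurable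
  calc ∫⁻ γ in band, (∫⁻ p, G (γ, p)) ∂μ.onPlane
      = ∫⁻ p, ∫⁻ γ in band, G (γ, p) ∂μ.onPlane := lintegral_lintegral_swap (f := fun γ p => G (γ, p)) hG.aemeasurable
    _ = ∫⁻ p, ∫⁻ γ, G (γ.translate p, p) ∂μ.onPlane := lintegral_congr fun p => by
        rw [hout _ fun γ hγ => h0 γ p hγ, htr]
    _ = ∫⁻ p, ∫⁻ γ, G (γ.translate (-p), -p) ∂μ.onPlane :=
        (lintegral_neg_eq_self (fun p => ∫⁻ γ, G (Loop.translate p γ, p) ∂μ.onPlane)).symm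
    _ = ∫⁻ p, ∫⁻ γ in band, G (γ.translate (-p), -p) ∂μ.onPlane := lintegral_congr fun p =>
        (hout _ fun γ hγ => h0' γ p hγ).symm
    _ = ∫⁻ γ in band, (∫⁻ p, G (γ.translate (-p), -p)) ∂μ.onPlane :=
        (lintegral_lintegral_swap (f := fun (γ : Loop ℂ) (p : ℂ) => G (γ.translate (-p), -p)) (hG.comp hT).aemeasurable).symm

/-- The area of the image of a disk under the normalized map `u`. -/
theorem lintegral_image_conformalRadius {γ : Loop ℂ} (hs : γ.Surrounds 0) {r : ℝ} (hr0 : 0 < r)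
    (hr : r < 1) :
    ∫⁻ _ in γ.innerMap '' ball 0 r, ENNReal.ofReal ((γ.conformalRadius ^ 2)⁻¹) =
      ∑' n : ℕ, ENNReal.ofReal (((n : ℝ) + 1) ^ 2 * ‖γ.u n‖ ^ 2) *
        ENNReal.ofReal (π / (n + 1) * (r ^ 2) ^ (n + 1)) := by
  have hφ := hs.isInnerMap
  have hρ := hφ.conformalRadius_eq.2
  have hd : DifferentiableOn ℂ (deriv γ.innerMap) (ball 0 1) := hφ.holomorphic.deriv isOpen_ball
  rw [lintegral_image_eq_lintegral_norm_deriv_sq_mul isOpen_ball hφ.holomorphic hφ.injective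
    (ball_subset_ball hr.le) measurableSet_ball, lintegral_mul_const' _ _ ENNReal.ofReal_ne_top,
    lintegral_ball_norm_sq hd hr0 hr, ← ENNReal.tsum_mul_right]
  refine tsum_congr fun n => ?_
  rw [mul_right_comm, ← ENNReal.ofReal_mul (by positivity), hs.taylorCoeff_deriv]
  congr 2
  have h1 : ‖(n : ℂ) + 1‖ = n + 1 := by
    rw [← Nat.cast_succ, Complex.norm_natCast]; push_cast; rfl
  rw [norm_mul, norm_mul, h1, Complex.norm_real, Real.norm_of_nonneg hρ.le]
  field_simp

/-- The Jacobian $|\phi_+'(q)|^2$ cancels against the conformal radius $(1-|q|^2)|\phi_+'(q)|$ seen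
from $\phi_+(q)$, so only the hyperbolic area of the disk remains, independent of the loop. -/
theorem lintegral_image_conformalRadius_translate {γ : Loop ℂ} (hs : γ.Surrounds 0) {r : ℝ}
    (hr0 : 0 < r) (hr : r < 1) :
    ∫⁻ p in γ.innerMap '' ball 0 r,
        ENNReal.ofReal (((γ.translate (-p)).conformalRadius ^ 2)⁻¹) =
      ∑' n : ℕ, ENNReal.ofReal ((n : ℝ) + 1) * ENNReal.ofReal (π / (n + 1) * (r ^ 2) ^ (n + 1)) := by
  have hφ := hs.isInnerMap
  rw [lintegral_image_eq_lintegral_norm_deriv_sq_mul isOpen_ball hφ.holomorphic hφ.injective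
    (ball_subset_ball hr.le) measurableSet_ball, ← lintegral_ball_poincare hr0 hr]
  refine setLIntegral_congr_fun measurableSet_ball fun q hq => ?_
  have hq1 : q ∈ ball (0 : ℂ) 1 := ball_subset_ball hr.le hq
  obtain ⟨e, -, -, h⟩ := hφ.translate hq1
  have hne : ‖deriv γ.innerMap q‖ ≠ 0 :=
    norm_ne_zero_iff.mpr (InjOn.deriv_ne_zero isOpen_ball hφ.holomorphic hφ.injective hq1)
  simp only [h]
  rw [← ENNReal.ofReal_mul (by positivity)]
  congr 1
  rw [mul_pow, mul_inv, mul_left_comm, mul_inv_cancel₀ (pow_ne_zero 2 hne), mul_one]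

theorem ConformalRestriction.lintegral_tsum_u (hr : μ.ConformalRestriction) (hn : μ.Nontrivial)
    {r : ℝ} (hr0 : 0 < r) (hr1 : r < 1) :
    ∫⁻ γ in band, ∑' n : ℕ, ENNReal.ofReal (((n : ℝ) + 1) ^ 2 * ‖γ.u n‖ ^ 2) *
        ENNReal.ofReal (π / (n + 1) * (r ^ 2) ^ (n + 1)) ∂μ.onPlane =
      (∑' n : ℕ, ENNReal.ofReal ((n : ℝ) + 1) * ENNReal.ofReal (π / (n + 1) * (r ^ 2) ^ (n + 1))) *
        μ.onPlane band := by
  obtain ⟨R, hR, hRe⟩ := Loop.exists_measurable_eq_conformalRadius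
  -- The mass transported is $\rho_0(\gamma)^{-2}$ on marked pairs. Its two sides are the area of
  -- $u(\{|z|<r\})$ and the hyperbolic area.
  set G : Loop ℂ × ℂ → ENNReal :=
    (marked r).indicator fun x => ENNReal.ofReal ((R x.1 ^ 2)⁻¹) with hGdef
  have hG : Measurable G :=
    (((hR.comp measurable_fst).pow_const 2).inv.ennreal_ofReal).indicator (measurableSet_marked hr0 hr1)
  have h := hr.lintegral_translate hn hG
    (fun γ p hγ => indicator_of_notMem (fun h => hγ h.1) _)
    (fun γ p hγ => indicator_of_notMem (fun h => hγ ((translate_mem_marked_iff hr1.le).mp h).1) _)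
  have him : ∀ γ ∈ band, MeasurableSet (γ.innerMap '' ball 0 r) := fun γ hγ =>
    (InjOn.isOpen_image isOpen_ball
      (hγ.1.isInnerMap.holomorphic.mono (ball_subset_ball hr1.le))
      (hγ.1.isInnerMap.injective.mono (ball_subset_ball hr1.le))).measurableSet
  have e1 : ∫⁻ γ in band, (∫⁻ p, G (γ, p)) ∂μ.onPlane =
      ∫⁻ γ in band, ∑' n : ℕ, ENNReal.ofReal (((n : ℝ) + 1) ^ 2 * ‖γ.u n‖ ^ 2) *
        ENNReal.ofReal (π / (n + 1) * (r ^ 2) ^ (n + 1)) ∂μ.onPlane := by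
    refine setLIntegral_congr_fun measurableSet_band fun γ hγ => ?_
    have hγ' : γ ∈ band := hγ
    change ∫⁻ p, G (γ, p) = _
    rw [← lintegral_image_conformalRadius hγ'.1 hr0 hr1, ← lintegral_indicator (him γ hγ)]
    refine lintegral_congr fun p => ?_
    by_cases hp : p ∈ γ.innerMap '' ball 0 r
    · rw [indicator_of_mem hp, hGdef, indicator_of_mem (show (γ, p) ∈ marked r from ⟨hγ, hp⟩),
        hRe γ hγ'.1]
    · rw [indicator_of_notMem hp, hGdef, indicator_of_notMem (fun h => hp h.2)]
  have e2 : ∫⁻ γ in band, (∫⁻ p, G (γ.translate (-p), -p)) ∂μ.onPlane =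
      ∫⁻ γ in band, (∑' n : ℕ, ENNReal.ofReal ((n : ℝ) + 1) *
        ENNReal.ofReal (π / (n + 1) * (r ^ 2) ^ (n + 1))) ∂μ.onPlane := by
    refine setLIntegral_congr_fun measurableSet_band fun γ hγ => ?_
    have hγ' : γ ∈ band := hγ
    change ∫⁻ p, G (γ.translate (-p), -p) = _
    rw [← lintegral_image_conformalRadius_translate hγ'.1 hr0 hr1, ← lintegral_indicator (him γ hγ)]
    refine lintegral_congr fun p => ?_
    by_cases hp : p ∈ γ.innerMap '' ball 0 r
    · have hm : (γ.translate (-p), -p) ∈ marked r := translate_mem_marked hr1.le ⟨hγ, hp⟩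
      rw [indicator_of_mem hp, hGdef, indicator_of_mem hm, hRe _ hm.1.1]
    · rw [indicator_of_notMem hp, hGdef,
        indicator_of_notMem (fun h => hp ((translate_mem_marked_iff hr1.le).mp h).2)]
  rw [← e1, h, e2, setLIntegral_const]

/-- The transport identity for all $r=\sqrt x$ is an equality of power series in $x$ after division
by $\pi x$, with coefficients $(n+1)\int|u_n|^2d\nu_0$ on one side and $1$ on the other.
Coefficients are compared in $[0,\infty]$, so finiteness of the moments comes from the geometric
series and need not be known beforehand. -/
theorem ConformalRestriction.lintegral_norm_u_sq (hr : μ.ConformalRestriction) (hn : μ.Nontrivial)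
    {ν : Measure (ℕ → ℂ)} [IsProbabilityMeasure ν] (hν : μ.Decomposes ν) (n : ℕ) :
    ∫⁻ u : ℕ → ℂ, ENNReal.ofReal (‖u n‖ ^ 2) ∂ν = ENNReal.ofReal (1 / ((n : ℝ) + 1)) := by
  have hu : AEMeasurable Loop.u (μ.onPlane.restrict band) :=
    μ.aemeasurable_u_transfiniteDiameter.fst.mono_measure
      (Measure.restrict_mono (fun γ h => h.1) le_rfl)
  have hband : μ.onPlane band = 1 := by
    have h1 : ν univ = 1 := measure_univ
    rw [hν.eq_map_band, Measure.map_apply_of_aemeasurable hu MeasurableSet.univ, preimage_univ,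
      Measure.restrict_apply_univ] at h1
    exact h1
  set M : ℕ → ENNReal := fun n => ∫⁻ γ in band, ENNReal.ofReal (‖γ.u n‖ ^ 2) ∂μ.onPlane with hM
  have hmeas : ∀ n, AEMeasurable (fun γ : Loop ℂ => ENNReal.ofReal (‖γ.u n‖ ^ 2))
      (μ.onPlane.restrict band) := fun n =>
    (((aemeasurable_pi_iff.mp hu n).norm.pow_const 2)).ennreal_ofReal
  have hνM : ∫⁻ u : ℕ → ℂ, ENNReal.ofReal (‖u n‖ ^ 2) ∂ν = M n := by
    rw [hν.eq_map_band, lintegral_map' (Measurable.aemeasurable (by fun_prop)) hu]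
  have hn1 : ∀ n : ℕ, (0 : ℝ) < n + 1 := fun n => by positivity
  have key : (fun n : ℕ => ENNReal.ofReal (n + 1) * M n) = fun _ => 1 := by
    refine ENNReal.eq_of_tsum_mul_pow_eq (fun x hx => ?_) (fun x hx => ?_)
    · have hs0 : 0 < √x := Real.sqrt_pos.mpr hx.1
      have hs1 : √x < 1 := (Real.sqrt_lt' one_pos).mpr (by simpa using hx.2)
      have h := hr.lintegral_tsum_u hn hs0 hs1
      rw [hband, mul_one, lintegral_tsum (fun n => (((((aemeasurable_pi_iff.mp hu n).norm.pow_const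
        2).const_mul _)).ennreal_ofReal).mul_const _)] at h
      have hsq : √x ^ 2 = x := Real.sq_sqrt hx.1.le
      have hc0 : ENNReal.ofReal (π * x) ≠ 0 := by
        have := mul_pos Real.pi_pos hx.1
        simpa using this
      rw [← ENNReal.mul_right_inj hc0 ENNReal.ofReal_ne_top, ← ENNReal.tsum_mul_left,
        ← ENNReal.tsum_mul_left]
      convert h using 1
      · refine tsum_congr fun n => ?_
        have e1 : ∀ γ : Loop ℂ, ENNReal.ofReal (((n : ℝ) + 1) ^ 2 * ‖γ.u n‖ ^ 2) *
            ENNReal.ofReal (π / (n + 1) * (√x ^ 2) ^ (n + 1)) =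
            (ENNReal.ofReal (π * x) * (ENNReal.ofReal (n + 1) * ENNReal.ofReal (x ^ n))) *
              ENNReal.ofReal (‖γ.u n‖ ^ 2) := fun γ => by
          have := hx.1
          have := Real.pi_pos
          rw [← ENNReal.ofReal_mul (by positivity), ← ENNReal.ofReal_mul (by positivity),
            ← ENNReal.ofReal_mul (by positivity), ← ENNReal.ofReal_mul (by positivity), hsq]
          congr 1
          have := (hn1 n).ne'
          field_simp
          ring
        simp only [e1]
        rw [lintegral_const_mul'' _ (hmeas n)]
        ring
      · refine tsum_congr fun n => ?_
        have := hx.1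
        have := Real.pi_pos
        rw [one_mul, ← ENNReal.ofReal_mul (by positivity), ← ENNReal.ofReal_mul (by positivity), hsq]
        congr 1
        have := (hn1 n).ne'
        field_simp
        ring
    · simp only [one_mul]
      rw [← ENNReal.ofReal_tsum_of_nonneg (fun n => pow_nonneg hx.1.le n)
        (summable_geometric_of_lt_one hx.1.le hx.2)]
      exact ENNReal.ofReal_ne_top
  have h1 : ENNReal.ofReal (n + 1) * M n = 1 := congrFun key n
  rw [hνM, one_div, ENNReal.ofReal_inv_of_pos (hn1 n)]
  exact ENNReal.eq_inv_of_mul_eq_one_left (by rwa [mul_comm] at h1)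

end LoopMeasureFamily

theorem mainTheorem2 (μ : LoopMeasureFamily) (hrestr : μ.ConformalRestriction)
    (hnontriv : μ.Nontrivial) :
    (∃! ν₀ : MeasureTheory.Measure (ℕ → ℂ),
      MeasureTheory.IsFiniteMeasure ν₀ ∧ ν₀ ≠ 0 ∧ μ.Decomposes ν₀) ∧
    (∀ ν₀ : MeasureTheory.Measure (ℕ → ℂ),
      MeasureTheory.IsProbabilityMeasure ν₀ → μ.Decomposes ν₀ →
        ∀ n : ℕ, MeasureTheory.Integrable (fun u : ℕ → ℂ => ‖u n‖ ^ 2) ν₀ ∧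
          ∫ u : ℕ → ℂ, ‖u n‖ ^ 2 ∂ν₀ = 1 / ((n : ℝ) + 1)) := by
  refine ⟨hrestr.existsUnique_decomposes hnontriv, fun ν₀ hν₀ hd n => ?_⟩
  have h := hrestr.lintegral_norm_u_sq hnontriv hd n
  have hm : AEStronglyMeasurable (fun u : ℕ → ℂ => ‖u n‖ ^ 2) ν₀ :=
    Measurable.aestronglyMeasurable (by fun_prop)
  have h0 : 0 ≤ᵐ[ν₀] fun u : ℕ → ℂ => ‖u n‖ ^ 2 := ae_of_all _ fun u => by positivity
  refine ⟨⟨hm, ?_⟩, ?_⟩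
  · rw [hasFiniteIntegral_iff_ofReal h0, h]
    exact ENNReal.ofReal_lt_top
  · rw [integral_eq_lintegral_of_nonneg_ae h0 hm, h, ENNReal.toReal_ofReal (by positivity)]
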